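/- Let $\gamma\in L^1(\mathbb R^+)$ be a kernel with values in $\mathbb R^{d\times d}$, let $D,G\in\mathbb R^{d\times d}$, and assume that the differential resolvent $r$, i.e., the solution of $$r'(t)=-Dr(t)-\int_0^t\gamma(t-s)r(s)\,ds\quad(t\ge 0),\qquad r(0)=I,$$ also belongs to $L^1(\mathbb R^+)$. Let $W$ and $\widetilde W$ be two-sided $d$-dimensional Brownian motions which are either the same (put $\kappa=1$) or independent of each other (put $\kappa=0$), let $\varphi\in L^2(\mathbb R)$ have values in $\mathbb R^{d\times d}$, and let $F=F_0+G\dot W$ with $F_0(t)=\int_{-\infty}^{\infty}\varphi(t-s)\,d\widetilde W(s)$. Here $F$ is a random distribution, which acts on test functions $f\in C_0^\infty(\mathbb R)$ with values in $\mathbb R^d$ by $$\langle F,f\rangle=\int_{-\infty}^{\infty} f(t)^*F_0(t)\,dt+\int_{-\infty}^{\infty} f(t)^*G\,dW(t).$$ Let $V_\infty$ be the (mean-square) bounded strong solution of $$\dot V_\infty(t)=-DV_\infty(t)-\int_{-\infty}^t\gamma(t-s)V_\infty(s)\,ds+F(t),\qquad t\in\mathbb R,$$ that is, of the integrated equation,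 which holds almost surely on each bounded time interval. Put $$\chi(t)=\kappa\bigl(\varphi(t)G^*+G\varphi(-t)^*\bigr)+\int_{-\infty}^{\infty}\varphi(s)\varphi(s-t)^*\,ds .$$ Then for $s\in\mathbb R$ and $t\ne 0$ there holds $$\mathbb E\bigl(V_\infty(s+t)F(s)^*\bigr)=\int_0^\infty r(\tau)\chi(t-\tau)\,d\tau+\begin{cases}r(t)GG^*,&t>0,\\0,&t<0,\end{cases}$$ where the integral converges absolutely. Since $F$ is a random distribution, the left-hand side is understood in the distributional sense: if $K(t)$ denotes the right-hand side, then $K$ is locally integrable and $$\mathbb E\bigl(\langle V_\infty,f\rangle\langle F,g\rangle\bigr)=\int_{-\infty}^{\infty}\int_{-\infty}^{\infty} f(t)^*K(t-s)g(s)\,ds\,dt$$ for all $\mathbb R^d$-valued test functions $f,g$, with $\langle V_\infty,f\rangle=\int_{-\infty}^\infty f(t)^*V_\infty(t)\,dt$; moreover, for every $s\in\mathbb R$ and $t\neq0$ the matrix-valued distribution with columns $\rho\mapsto\mathbb E\bigl(V_\infty(s+t)\langle F,\rho e_j\rangle\bigr)$, $j=1,\dots,d$ (where $e_j$ are the standard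 unit vectors), has the value $K(t)$ at the point $s$, i.e., $\mathbb E\bigl(V_\infty(s+t)\langle F,\rho_\varepsilon e_j\rangle\bigr)\to K(t)e_j$ as $\varepsilon\to0^+$ for $\rho_\varepsilon(x)=\varepsilon^{-1}\rho((x-s)/\varepsilon)$ and every real-valued test function $\rho$ with $\int\rho=1$. The cross-correlation thus depends only on the time lag $t$, and the joint process $(V_\infty,F)$ is stationary, i.e., $V_\infty(t)$ and $\langle F,f\rangle$ have mean zero and finite second moments, and all their auto- and cross-covariances are invariant under a common time shift of $V_\infty$ and of the test functions. -/

import Mathlib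

open MeasureTheory ProbabilityTheory Set Filter Topology Matrix
open scoped ENNReal NNReal

noncomputable section

namespace GLE

variable {Ω : Type*} [MeasurableSpace Ω] {d : ℕ}

/-! ### Matrix-valued functions of time -/

/-- Entrywise integral of a matrix-valued function over a set of times. -/
def matIntegral (S : Set ℝ) (A : ℝ → Matrix (Fin d) (Fin d) ℝ) : Matrix (Fin d) (Fin d) ℝ :=
  Matrix.of fun i j => ∫ t in S, A t i j

/-- Matrix-valued functions in `L¹(ℝ⁺)`. -/
def IsL1Pos (A : ℝ → Matrix (Fin d) (Fin d) ℝ) : Prop :=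
  ∀ i j, IntegrableOn (fun t => A t i j) (Ioi 0) volume

/-- Matrix-valued functions in `L²(ℝ)`. -/
def IsL2 (A : ℝ → Matrix (Fin d) (Fin d) ℝ) : Prop :=
  ∀ i j, MemLp (fun t => A t i j) 2 volume

/-- The differential resolvent:
`r'(t) = -D r(t) - ∫₀ᵗ γ(t-s) r(s) ds` for `t ≥ 0` (one-sided at `0`), `r(0) = I`. -/
def IsDifferentialResolvent (D : Matrix (Fin d) (Fin d) ℝ)
    (γ r : ℝ → Matrix (Fin d) (Fin d) ℝ) : Prop :=
  r 0 = 1 ∧ ∀ t, 0 ≤ t → ∀ i j,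
    HasDerivWithinAt (fun u => r u i j)
      (-(D * r t) i j - ∫ s in (0 : ℝ)..t, (γ (t - s) * r s) i j) (Ici 0) t

/-- Time reversal. -/
def timeReversal (φ : ℝ → Matrix (Fin d) (Fin d) ℝ) : ℝ → Matrix (Fin d) (Fin d) ℝ :=
  fun s => φ (-s)

/-- Convolution on the line of two matrix-valued functions. -/
def matConv (A B : ℝ → Matrix (Fin d) (Fin d) ℝ) : ℝ → Matrix (Fin d) (Fin d) ℝ :=
  fun t => matIntegral univ fun s => A s * B (t - s)

/-- The function `χ`; `κ = 1` if the two Brownian motions coincide and `κ = 0` if they are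
independent. -/
def chi (κ : ℝ) (G : Matrix (Fin d) (Fin d) ℝ) (φ : ℝ → Matrix (Fin d) (Fin d) ℝ) :
    ℝ → Matrix (Fin d) (Fin d) ℝ :=
  fun t => κ • (φ t * Gᵀ + G * (timeReversal φ t)ᵀ)
    + matConv φ (fun u => (timeReversal φ u)ᵀ) t

/-- `∫₀^∞ r(τ) χ(t-τ) dτ`, plus `r(t) G Gᵀ` if `t > 0`, plus `0` otherwise. -/
def crossKernel (κ : ℝ) (G : Matrix (Fin d) (Fin d) ℝ) (φ r : ℝ → Matrix (Fin d) (Fin d) ℝ) :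
    ℝ → Matrix (Fin d) (Fin d) ℝ :=
  fun t => matIntegral (Ioi 0) (fun τ => r τ * chi κ G φ (t - τ))
    + if 0 < t then r t * (G * Gᵀ) else 0

/-! ### Brownian motion and the Wiener integral -/

/-- Two-sided standard `d`-dimensional Brownian motion. -/
structure IsTwoSidedBrownian (P : Measure Ω) (W : ℝ → Ω → Fin d → ℝ) : Prop where
  measurable : ∀ t, Measurable (W t)
  zero : ∀ᵐ ω ∂P, W 0 ω = 0
  indep : HasIndepIncrements W P
  law : ∀ s t, s ≤ t → HasLaw (fun ω => W t ω - W s ω)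
    (Measure.pi fun _ : Fin d => gaussianReal 0 (t - s).toNNReal) P
  cont : ∀ᵐ ω ∂P, Continuous fun t => W t ω

/-- Data of a vector-valued step function `∑ₖ cₖ 1_{(aₖ, bₖ]}` on the line. -/
structure StepData (d : ℕ) where
  n : ℕ
  left : Fin n → ℝ
  right : Fin n → ℝ
  le : ∀ k, left k ≤ right k
  coef : Fin n → Fin d → ℝ

/-- The step function itself. -/
def StepData.toFun (S : StepData d) : ℝ → Fin d → ℝ :=
  fun t => ∑ k, (Ioc (S.left k) (S.right k)).indicator (fun _ => S.coef k) t

/-- The elementary stochastic integral `∑ₖ cₖ ⬝ (W(bₖ) - W(aₖ))`. -/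
def StepData.integral (S : StepData d) (W : ℝ → Ω → Fin d → ℝ) : Ω → ℝ :=
  fun ω => ∑ k, S.coef k ⬝ᵥ (W (S.right k) ω - W (S.left k) ω)

/-- `X = ∫ f(s)ᵀ dW(s)` for a deterministic `f ∈ L²(ℝ; ℝᵈ)`: `X` is the mean-square limit of the
elementary integrals of step functions that converge to `f` in `L²`. -/
def IsWienerIntegral (P : Measure Ω) (W : ℝ → Ω → Fin d → ℝ) (f : ℝ → Fin d → ℝ)
    (X : Ω → ℝ) : Prop :=
  MemLp f 2 volume ∧ MemLp X 2 P ∧ ∀ ε : ℝ, 0 < ε → ∃ S : StepData d,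
    eLpNorm (f - S.toFun) 2 volume ≤ ENNReal.ofReal ε ∧
    eLpNorm (X - S.integral W) 2 P ≤ ENNReal.ofReal ε

open Classical in
/-- A version of the Wiener integral `∫ f(s)ᵀ dW(s)`. -/
def wienerIntegral (P : Measure Ω) (W : ℝ → Ω → Fin d → ℝ) (f : ℝ → Fin d → ℝ) : Ω → ℝ :=
  if h : ∃ X, IsWienerIntegral P W f X then h.choose else 0

/-! ### The fluctuating force -/

/-- The two Brownian motions are the same (`κ = 1`) or independent of each other (`κ = 0`). -/
def IsCoupling (P : Measure Ω) (W W' : ℝ → Ω → Fin d → ℝ) (κ : ℝ) : Prop :=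
  (κ = 1 ∧ ∀ t, W' t =ᵐ[P] W t) ∨
    (κ = 0 ∧ IndepFun (fun ω t => W t ω) (fun ω t => W' t ω) P)

/-- The force `F = F₀ + G Ẇ` with `F₀(t) = ∫ φ(t-s) dW'(s)`, `φ ∈ L²(ℝ)`; `F₀` is a (jointly)
measurable process. -/
structure IsFluctuatingForce (P : Measure Ω) (W W' : ℝ → Ω → Fin d → ℝ) (κ : ℝ)
    (φ : ℝ → Matrix (Fin d) (Fin d) ℝ) (F₀ : ℝ → Ω → Fin d → ℝ) : Prop where
  brownian : IsTwoSidedBrownian P W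
  brownian' : IsTwoSidedBrownian P W'
  coupling : IsCoupling P W W' κ
  density : IsL2 φ
  measurable : Measurable (Function.uncurry F₀)
  colored : ∀ t i, IsWienerIntegral P W' (fun s => φ (t - s) i) (fun ω => F₀ t ω i)

/-- Vector-valued test functions, `C₀^∞(ℝ; ℝᵈ)`. -/
def IsTestFunction (f : ℝ → Fin d → ℝ) : Prop :=
  ContDiff ℝ (⊤ : ℕ∞) f ∧ HasCompactSupport f

/-- `⟨X, f⟩ = ∫ f(t)ᵀ X(t) dt` for a process `X`. -/
def processAction (X : ℝ → Ω → Fin d → ℝ) (f : ℝ → Fin d → ℝ) : Ω → ℝ :=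
  fun ω => ∫ t, f t ⬝ᵥ X t ω

/-- The random distribution `F = F₀ + G Ẇ`:
`⟨F, f⟩ = ∫ f(t)ᵀ F₀(t) dt + ∫ f(t)ᵀ G dW(t)`. -/
def forceAction (P : Measure Ω) (W : ℝ → Ω → Fin d → ℝ) (G : Matrix (Fin d) (Fin d) ℝ)
    (F₀ : ℝ → Ω → Fin d → ℝ) (f : ℝ → Fin d → ℝ) : Ω → ℝ :=
  fun ω => processAction F₀ f ω + wienerIntegral P W (fun t => Gᵀ *ᵥ f t) ω

/-! ### The equation with infinite time horizon -/

/-- `V` is a (mean-square) bounded strong solution of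
`V̇(t) = -D V(t) - ∫_{-∞}^t γ(t-s) V(s) ds + F₀(t) + G Ẇ(t)`, `t ∈ ℝ`, in integrated form. -/
structure IsBoundedSolution (P : Measure Ω) (D G : Matrix (Fin d) (Fin d) ℝ)
    (γ : ℝ → Matrix (Fin d) (Fin d) ℝ) (F₀ W V : ℝ → Ω → Fin d → ℝ) : Prop where
  measurable : Measurable (Function.uncurry V)
  bounded : ∃ C : ℝ≥0, ∀ t, eLpNorm (V t) 2 P ≤ C
  equation : ∀ t₁ t₂, t₁ ≤ t₂ → ∀ᵐ ω ∂P,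
    V t₂ ω - V t₁ ω =
      -(∫ τ in t₁..t₂, (D *ᵥ V τ ω + ∫ s in Iic τ, γ (τ - s) *ᵥ V s ω))
        + (∫ τ in t₁..t₂, F₀ τ ω) + G *ᵥ (W t₂ ω - W t₁ ω)

/-! ### Correlations with a random distribution -/

/-- `E(X F(s)ᵀ) = C` for a random vector `X` and a random distribution `F`: the value at the
point `s` of the distribution `g ↦ E(X ⟨F, g⟩)`, that is, the limit of `E(Xᵢ ⟨F, δ_ε eⱼ⟩)` for
every family `δ_ε(x) = ρ((x-s)/ε)/ε` with a test function `ρ` of integral one. -/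
def HasCorrelationAt (P : Measure Ω) (X : Ω → Fin d → ℝ) (F : (ℝ → Fin d → ℝ) → Ω → ℝ)
    (s : ℝ) (C : Matrix (Fin d) (Fin d) ℝ) : Prop :=
  ∀ ρ : ℝ → ℝ, ContDiff ℝ (⊤ : ℕ∞) ρ → HasCompactSupport ρ → ∫ x, ρ x = 1 → ∀ i j,
    Tendsto
      (fun ε : ℝ => ∫ ω, X ω i * F (fun x => Pi.single j (ε⁻¹ * ρ (ε⁻¹ * (x - s)))) ω ∂P)
      (𝓝[>] 0) (𝓝 (C i j))

/-- The correlation distribution of the process `V` and the random distribution `F` is the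
(locally integrable) function `K` of the time lag. -/
def HasCorrelationFunction (P : Measure Ω) (V : ℝ → Ω → Fin d → ℝ)
    (F : (ℝ → Fin d → ℝ) → Ω → ℝ) (K : ℝ → Matrix (Fin d) (Fin d) ℝ) : Prop :=
  (∀ i j, LocallyIntegrable (fun t => K t i j) volume) ∧
  ∀ f g, IsTestFunction f → IsTestFunction g →
    Integrable (fun ω => processAction V f ω * F g ω) P ∧
    ∫ ω, processAction V f ω * F g ω ∂P = ∫ t, ∫ s, f t ⬝ᵥ (K (t - s) *ᵥ g s)

/-- Second order (wide-sense) stationarity, with mean zero, of the joint process `(V, F)` of a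
process `V` and a random distribution `F`. -/
structure IsJointlyStationary (P : Measure Ω) (V : ℝ → Ω → Fin d → ℝ)
    (F : (ℝ → Fin d → ℝ) → Ω → ℝ) : Prop where
  memLp_process : ∀ t, MemLp (V t) 2 P
  memLp_force : ∀ f, IsTestFunction f → MemLp (F f) 2 P
  mean_process : ∀ t i, ∫ ω, V t ω i ∂P = 0
  mean_force : ∀ f, IsTestFunction f → ∫ ω, F f ω ∂P = 0
  cov_process : ∀ h s t i j,
    ∫ ω, V (s + h) ω i * V (t + h) ω j ∂P = ∫ ω, V s ω i * V t ω j ∂P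
  cov_cross : ∀ h t i f, IsTestFunction f →
    ∫ ω, V (t + h) ω i * F (fun x => f (x - h)) ω ∂P = ∫ ω, V t ω i * F f ω ∂P
  cov_force : ∀ h f g, IsTestFunction f → IsTestFunction g →
    ∫ ω, F (fun x => f (x - h)) ω * F (fun x => g (x - h)) ω ∂P = ∫ ω, F f ω * F g ω ∂P

end GLE

end

/-! Fix a square integrable random variable Y and correlate the integrated equation with it. The
function v(t) = E(V(t) Y) is deterministic, bounded because V is bounded in mean square, and solves
the same Volterra equation on the whole line with forcing E(F₀(t) Y) + G y(t). Here y ∈ L² is the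
Riesz representative of f ↦ E(Y ∫ f dW), so that E((W(t₂) - W(t₁)) Y) is the integral of y over (t₁,
t₂]. Variation of constants then gives v = r * (E(F₀ Y) + G y), which is
`IsBoundedSolution.integral_mul_eq`. No explicit stochastic formula for V is required.

Variation of constants is deterministic but noncommutative. The resolvent is given with the kernel
acting from the left, r' = -D r - γ * r, whereas the argument consumes r' = -r D - r * γ;
`right_resolvent_equation` passes from one to the other. Integrating r * v' by parts, the boundary
term at -∞ disappears since v is bounded and the primitive form of r tends to zero
(`bounded_solution_eq_conv`).

The rest is a choice of Y. For Y = F₀(s)ⱼ the representative is κ φ(s - ·)ⱼ, and the Itô isometry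
produces the part of r * χ due to the coloured force. For Y = ∫ (Gᵀ g) dW the representative is Gᵀ
g, and the remaining part of r * χ appears together with r G Gᵀ, both convolved with g. The sum is
E(V(t) ⟨F, g⟩) = ∫ K(t - s) g(s) ds with K = `crossKernel`. Since K is bounded and continuous away
from 0, approximate identities recover its value at every nonzero lag.

Stationarity is a duality argument (`IsShift`). If the correlations of Y' with F₀ and with the noise
are those of Y delayed by h, then the formula for v gives E(V(t + h) Y') = E(V(t) Y). Using F₀ and
Wiener integrals as Y shows that V itself is shifted in this sense, and V may then be inserted as Y.
-/

namespace GLE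

/-! ### Convolution of functions with values in a normed algebra -/

section Convolution

variable {A : Type*} [NormedRing A] [NormedAlgebra ℝ A]

/-- Convolution on the line of two functions with values in a normed algebra. -/
noncomputable def conv (f g : ℝ → A) : ℝ → A := fun t => ∫ s, f s * g (t - s)

theorem integrable_conv {f g : ℝ → A} (hf : Integrable f) (hg : Integrable g) :
    Integrable (conv f g) :=
  hf.integrable_convolution (ContinuousLinearMap.mul ℝ A) hg

theorem ae_integrable_conv {f g : ℝ → A} (hf : Integrable f) (hg : Integrable g) :
    ∀ᵐ t, Integrable fun s => f s * g (t - s) :=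
  hf.ae_convolution_exists (ContinuousLinearMap.mul ℝ A) hg

theorem conv_congr {f f' g g' : ℝ → A} (hf : f =ᵐ[volume] f') (hg : g =ᵐ[volume] g') :
    conv f g = conv f' g' :=
  convolution_congr (ContinuousLinearMap.mul ℝ A) hf hg

theorem _root_.MeasureTheory.AEStronglyMeasurable.comp_const_sub {E : Type*} [TopologicalSpace E]
    {g : ℝ → E} (hg : AEStronglyMeasurable g volume) (t : ℝ) :
    AEStronglyMeasurable (fun s => g (t - s)) volume :=
  hg.comp_quasiMeasurePreserving (quasiMeasurePreserving_sub_left_of_right_invariant volume t)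

theorem integrable_mul_bounded {f g : ℝ → A} {C : ℝ} (hf : Integrable f)
    (hg : AEStronglyMeasurable g volume) (hC : ∀ t, ‖g t‖ ≤ C) (t : ℝ) :
    Integrable fun s => f s * g (t - s) :=
  hf.mul_bdd (hg.comp_const_sub t) (ae_of_all _ fun s => hC (t - s))

theorem norm_conv_le {f g : ℝ → A} {C : ℝ} (hf : Integrable f) (hC : ∀ t, ‖g t‖ ≤ C) (t : ℝ) :
    ‖conv f g t‖ ≤ (∫ s, ‖f s‖) * C := by
  rw [← integral_mul_const]
  refine norm_integral_le_of_norm_le (hf.norm.mul_const C) (ae_of_all _ fun s => ?_)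
  exact (norm_mul_le _ _).trans (mul_le_mul_of_nonneg_left (hC _) (norm_nonneg _))

theorem aestronglyMeasurable_conv {f g : ℝ → A} (hf : AEStronglyMeasurable f volume)
    (hg : AEStronglyMeasurable g volume) : AEStronglyMeasurable (conv f g) volume := by
  have := (hf.convolution_integrand (ContinuousLinearMap.mul ℝ A) (μ := volume) hg)
  exact this.integral_prod_right'

/-- Associativity is Fubini, available at each t where the convolution of the three norms converges
absolutely; for integrable functions this is almost every t. -/
theorem conv_assoc_ae {f g k : ℝ → A} [CompleteSpace A] (hf : Integrable f) (hg : Integrable g)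
    (hk : Integrable k) : conv (conv f g) k =ᵐ[volume] conv f (conv g k) := by
  have h3 := hf.norm.ae_convolution_exists (ContinuousLinearMap.mul ℝ ℝ)
    (hg.norm.integrable_convolution (ContinuousLinearMap.mul ℝ ℝ) hk.norm)
  filter_upwards [h3] with t ht
  exact convolution_assoc (ContinuousLinearMap.mul ℝ A) (ContinuousLinearMap.mul ℝ A)
    (ContinuousLinearMap.mul ℝ A) (ContinuousLinearMap.mul ℝ A) (fun x y z => mul_assoc x y z)
    hf.aestronglyMeasurable hg.aestronglyMeasurable hk.aestronglyMeasurable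
    (hf.ae_convolution_exists _ hg) (hg.norm.ae_convolution_exists _ hk.norm) ht

/-- A bounded last factor makes the triple convolution of norms converge at every t, so there is no
exceptional null set. -/
theorem conv_assoc_of_bounded [CompleteSpace A] {f g k : ℝ → A} {C : ℝ} (hf : Integrable f)
    (hg : Integrable g) (hk : AEStronglyMeasurable k volume) (hC : ∀ t, ‖k t‖ ≤ C) (t : ℝ) :
    conv (conv f g) k t = conv f (conv g k) t := by
  have hC' : ∀ t, ‖‖k t‖‖ ≤ C := fun t => by simpa using hC t
  refine convolution_assoc (ContinuousLinearMap.mul ℝ A) (ContinuousLinearMap.mul ℝ A)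
    (ContinuousLinearMap.mul ℝ A) (ContinuousLinearMap.mul ℝ A) (fun x y z => mul_assoc x y z)
    hf.aestronglyMeasurable hg.aestronglyMeasurable hk
    (hf.ae_convolution_exists _ hg) (ae_of_all _ fun x => ?_) ?_
  · exact integrable_mul_bounded hg.norm hk.norm hC' x
  · exact integrable_mul_bounded hf.norm
      (aestronglyMeasurable_conv hg.aestronglyMeasurable.norm hk.norm)
      (fun x => norm_conv_le hg.norm hC' x) t

theorem integral_norm_conv_le {f g : ℝ → A} (hf : Integrable f) (hg : Integrable g) :
    ∫ t, ‖conv f g t‖ ≤ (∫ t, ‖f t‖) * ∫ t, ‖g t‖ := by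
  have h := integral_convolution (μ := volume) (ν := volume) (ContinuousLinearMap.mul ℝ ℝ)
    hf.norm hg.norm
  rw [ContinuousLinearMap.mul_apply'] at h
  rw [← h]
  refine integral_mono_ae (integrable_conv hf hg).norm
    (hf.norm.integrable_convolution (ContinuousLinearMap.mul ℝ ℝ) hg.norm) ?_
  filter_upwards [ae_integrable_conv hf.norm hg.norm] with t ht
  exact norm_integral_le_of_norm_le ht (ae_of_all _ fun s => norm_mul_le _ _)

theorem conv_add_right {f g g' : ℝ → A} {t : ℝ} (h : Integrable fun s => f s * g (t - s))
    (h' : Integrable fun s => f s * g' (t - s)) :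
    conv f (fun s => g s + g' s) t = conv f g t + conv f g' t := by
  simp only [conv, mul_add]
  exact integral_add h h'

theorem conv_sub_right {f g g' : ℝ → A} {t : ℝ} (h : Integrable fun s => f s * g (t - s))
    (h' : Integrable fun s => f s * g' (t - s)) :
    conv f (fun s => g s - g' s) t = conv f g t - conv f g' t := by
  simp only [conv, mul_sub]
  exact integral_sub h h'

theorem conv_add_left {f f' g : ℝ → A} {t : ℝ} (h : Integrable fun s => f s * g (t - s))
    (h' : Integrable fun s => f' s * g (t - s)) :
    conv (fun s => f s + f' s) g t = conv f g t + conv f' g t := by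
  simp only [conv, add_mul]
  exact integral_add h h'

theorem conv_sub_left {f f' g : ℝ → A} {t : ℝ} (h : Integrable fun s => f s * g (t - s))
    (h' : Integrable fun s => f' s * g (t - s)) :
    conv (fun s => f s - f' s) g t = conv f g t - conv f' g t := by
  simp only [conv, sub_mul]
  exact integral_sub h h'

theorem conv_mul_const_left (f g : ℝ → A) (a : A) :
    conv (fun s => f s * a) g = conv f fun s => a * g s := by
  ext t; simp only [conv, mul_assoc]

theorem conv_mul_const_right [CompleteSpace A] {f g : ℝ → A} (a : A) {t : ℝ}
    (h : Integrable fun s => f s * g (t - s)) :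
    conv f (fun s => g s * a) t = conv f g t * a := by
  simp only [conv, ← mul_assoc]
  exact (((ContinuousLinearMap.mul ℝ A).flip a).integral_comp_comm h)

/-- Convolution with a scalar function is commutative. -/
theorem conv_smul_one_comm (e : ℝ → ℝ) (f : ℝ → A) :
    conv (fun s => e s • (1 : A)) f = conv f fun s => e s • (1 : A) := by
  ext t
  simp only [conv, smul_one_mul, mul_smul_one]
  rw [← integral_sub_left_eq_self _ volume t]
  simp

/-- The exponential weights `exp (-l t)` are compatible with convolutions. -/
theorem conv_exp_smul (l : ℝ) (f g : ℝ → A) (t : ℝ) :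
    conv (fun s => Real.exp (-l * s) • f s) (fun s => Real.exp (-l * s) • g s) t
      = Real.exp (-l * t) • conv f g t := by
  simp only [conv]
  rw [← integral_smul]
  congr 1; ext s
  rw [smul_mul_smul_comm, ← Real.exp_add]
  congr 2; ring

theorem integrable_exp_smul {l : ℝ} (hl : 0 ≤ l) {f : ℝ → A} (hf : Integrable f)
    (hf0 : ∀ t ≤ 0, f t = 0) : Integrable fun s => Real.exp (-l * s) • f s := by
  refine hf.mono ((by fun_prop : Continuous fun s : ℝ => Real.exp (-l * s)).aestronglyMeasurable.smul
    hf.aestronglyMeasurable) (ae_of_all _ fun s => ?_)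
  rcases le_or_gt s 0 with h | h
  · simp [hf0 s h]
  · rw [norm_smul, Real.norm_eq_abs, Real.abs_exp]
    have : Real.exp (-l * s) ≤ 1 := Real.exp_le_one_iff.2 (by nlinarith)
    exact mul_le_of_le_one_left (norm_nonneg _) this

theorem integral_norm_exp_smul_le {l : ℝ} (hl : 0 ≤ l) {f : ℝ → A} (hf : Integrable f)
    (hf0 : ∀ t ≤ 0, f t = 0) : ∫ s, ‖Real.exp (-l * s) • f s‖ ≤ ∫ s, ‖f s‖ := by
  refine integral_mono (integrable_exp_smul hl hf hf0).norm hf.norm fun s => ?_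
  rcases le_or_gt s 0 with h | h
  · simp [hf0 s h]
  · simp only [norm_smul, Real.norm_eq_abs, Real.abs_exp]
    have : Real.exp (-l * s) ≤ 1 := Real.exp_le_one_iff.2 (by nlinarith)
    exact mul_le_of_le_one_left (norm_nonneg _) this

theorem conv_eq_zero_of_nonpos {f g : ℝ → A} (hf : ∀ t ≤ 0, f t = 0) (hg : ∀ t ≤ 0, g t = 0)
    {t : ℝ} (ht : t ≤ 0) : conv f g t = 0 := by
  simp only [conv]
  rw [← integral_zero ℝ A]
  congr 1; ext s
  rcases le_or_gt s 0 with h | h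
  · simp [hf s h]
  · simp [hg (t - s) (by linarith)]

end Convolution
end GLE

namespace GLE

/-! ### The resolvent and variation of constants in a Banach algebra -/

section Resolvent

variable {A : Type*} [NormedRing A] [NormedAlgebra ℝ A] [CompleteSpace A]

/-- The damped Heaviside function `exp (-l t) 1_{t > 0}`. -/
noncomputable def dampedStep (l : ℝ) : ℝ → ℝ := (Ioi 0).indicator fun t => Real.exp (-l * t)

theorem integrable_dampedStep {l : ℝ} (hl : 0 < l) : Integrable (dampedStep l) :=
  (integrable_indicator_iff measurableSet_Ioi).2
    (integrableOn_exp_mul_Ioi (neg_lt_zero.2 hl) 0)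

theorem integral_norm_dampedStep {l : ℝ} (hl : 0 < l) : ∫ t, ‖dampedStep l t‖ = 1 / l := by
  have : ∀ t, ‖dampedStep l t‖ = dampedStep l t := fun t => by
    rw [Real.norm_of_nonneg]
    exact indicator_nonneg (fun t _ => (Real.exp_pos _).le) t
  simp_rw [this, dampedStep]
  rw [integral_indicator measurableSet_Ioi, integral_exp_mul_Ioi (neg_lt_zero.2 hl)]
  simp

/-- Convolution with the damped Heaviside function is weighted integration. -/
theorem conv_dampedStep (l : ℝ) (U : ℝ → A) (t : ℝ) :
    conv (fun s => dampedStep l s • (1 : A)) (fun s => Real.exp (-l * s) • U s) t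
      = Real.exp (-l * t) • ∫ s in Iio t, U s := by
  simp only [conv, smul_one_mul]
  rw [← integral_smul, ← integral_indicator measurableSet_Iio,
    ← integral_sub_left_eq_self _ volume t]
  congr 1; ext s
  by_cases hs : s < t
  · have h : t - s ∈ Ioi (0 : ℝ) := by simpa using hs
    rw [indicator_of_mem (show s ∈ Iio t from hs), dampedStep, indicator_of_mem h, smul_smul,
      ← Real.exp_add, sub_sub_cancel]
    congr 2; ring
  · have h : t - s ∉ Ioi (0 : ℝ) := by simpa using hs
    rw [indicator_of_notMem (show s ∉ Iio t from hs), dampedStep, indicator_of_notMem h, zero_smul]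

/-- Young's inequality gives ‖p‖₁ ≤ ‖k‖₁ ‖p‖₁, and the factor is below one. -/
theorem eq_zero_of_conv_eq_neg {k p : ℝ → A} (hk : Integrable k) (hp : Integrable p)
    (h : conv k p =ᵐ[volume] fun t => -p t) (hk1 : ∫ t, ‖k t‖ < 1) : p =ᵐ[volume] 0 := by
  have h1 : ∫ t, ‖conv k p t‖ = ∫ t, ‖p t‖ := by
    refine integral_congr_ae ?_
    filter_upwards [h] with t ht
    rw [ht, norm_neg]
  have h2 := integral_norm_conv_le hk hp
  have h3 : 0 ≤ ∫ t, ‖p t‖ := integral_nonneg fun _ => norm_nonneg _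
  have h4 : ∫ t, ‖p t‖ = 0 := by nlinarith
  rw [integral_eq_zero_iff_of_nonneg (fun _ => norm_nonneg _) hp.norm] at h4
  filter_upwards [h4] with t ht
  simpa using ht

/-- A solution of the integrated resolvent equation with the kernel acting from the left solves the
equation with the kernel acting from the right. -/
theorem right_resolvent_equation {D : A} {g R : ℝ → A} (hg : Integrable g) (hR : Integrable R)
    (hg0 : ∀ t ≤ 0, g t = 0) (hR0 : ∀ t ≤ 0, R t = 0)
    (heq : ∀ t, 0 < t → R t = 1 - ∫ s in Iio t, (D * R s + conv g R s)) :
    R =ᵐ[volume] fun t => (Ioi 0).indicator 1 t - ∫ s in Iio t, (R s * D + conv R g s) := by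
  -- The damping rate is chosen so that ‖e‖₁ (‖D‖ + ‖g‖₁) = (l - 1) / l < 1, where ‖e‖₁ = ‖1‖ / l.
  -- The norm of the unit is kept because it is not assumed to be one.
  set l : ℝ := ‖(1 : A)‖ * (‖D‖ + ∫ s, ‖g s‖) + 1 with hl
  have hI0 : 0 ≤ ∫ s, ‖g s‖ := integral_nonneg fun _ => norm_nonneg _
  have hl0 : 0 < l := by positivity
  set e : ℝ → A := fun s => dampedStep l s • (1 : A) with he
  set ρ : ℝ → A := fun s => Real.exp (-l * s) • R s with hρ
  set η : ℝ → A := fun s => Real.exp (-l * s) • g s with hη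
  have iρ : Integrable ρ := integrable_exp_smul hl0.le hR hR0
  have iη : Integrable η := integrable_exp_smul hl0.le hg hg0
  have ie : Integrable e := (integrable_dampedStep hl0).smul_const _
  have iDρ : Integrable fun s => D * ρ s := iρ.const_mul D
  have iρD : Integrable fun s => ρ s * D := iρ.mul_const D
  have ieD : Integrable fun s => e s * D := ie.mul_const D
  -- After damping, integration is convolution with e, and the left equation reads k * ρ = e - ρ.
  set k : ℝ → A := fun s => e s * D + conv e η s with hk
  have ik : Integrable k := ieD.add (integrable_conv ie iη)
  have hU0 : ∀ t ≤ 0, D * R t + conv g R t = 0 := fun t ht => by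
    rw [hR0 t ht, conv_eq_zero_of_nonpos hg0 hR0 ht]; simp
  -- the weighted left equation
  have hleft : ∀ t, conv e (fun s => D * ρ s + conv η ρ s) t = e t - ρ t := fun t => by
    have h1 : (fun s => D * ρ s + conv η ρ s)
        = fun s => Real.exp (-l * s) • (D * R s + conv g R s) := by
      ext s
      rw [hη, hρ, conv_exp_smul, smul_add, mul_smul_comm]
    rw [h1, he, conv_dampedStep]
    rcases le_or_gt t 0 with ht | ht
    · have h2 : ∫ s in Iio t, (D * R s + conv g R s) = 0 := by
        refine setIntegral_eq_zero_of_forall_eq_zero fun s hs => hU0 s (le_trans (le_of_lt hs) ht)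
      simp [h2, dampedStep, hρ, hR0 t ht, not_lt.2 ht]
    · simp only [hρ, heq t ht, dampedStep, indicator_of_mem (show t ∈ Ioi (0 : ℝ) from ht)]
      rw [smul_sub]; simp
  have hkρ : conv k ρ =ᵐ[volume] fun t => e t - ρ t := by
    filter_upwards [conv_assoc_ae ie iη iρ, ae_integrable_conv ieD iρ,
      ae_integrable_conv (integrable_conv ie iη) iρ, ae_integrable_conv ie iDρ,
      ae_integrable_conv ie (integrable_conv iη iρ)] with t h1 h2 h3 h4 h5
    rw [hk, conv_add_left h2 h3, h1, conv_mul_const_left, ← conv_add_right h4 h5, hleft]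
  have hρk : conv ρ k =ᵐ[volume] conv e fun s => ρ s * D + conv ρ η s := by
    have hc : conv e ρ = conv ρ e := conv_smul_one_comm _ _
    have h6 := conv_assoc_ae ie iρ iη
    rw [hc] at h6
    filter_upwards [conv_assoc_ae iρ ie iη, h6, ae_integrable_conv iρ ieD,
      ae_integrable_conv iρ (integrable_conv ie iη), ae_integrable_conv ie iρD,
      ae_integrable_conv ie (integrable_conv iρ iη), ae_integrable_conv ie iρ,
      ae_integrable_conv iρ ie] with t h1 h2 h3 h4 h5 h7 h8 h9
    rw [hk, conv_add_right h3 h4, conv_add_right h5 h7, ← h1, ← h2, conv_mul_const_right D h9,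
      conv_mul_const_right D h8, hc]
  -- The defect of the right equation ρ * k = e - ρ. Substituting the left equation twice gives k *
  -- p = (e - ρ) - e * k + (e - ρ) * k = -p, so the contraction estimate makes p vanish.
  set p : ℝ → A := fun t => ρ t - e t + conv ρ k t with hp
  have ip : Integrable p := (iρ.sub ie).add (integrable_conv iρ ik)
  have hkp : conv k p =ᵐ[volume] fun t => -p t := by
    -- The damped step is a scalar function times the unit, so it commutes under convolution
    -- although A need not be commutative.
    have hke : conv k e = conv e k := (conv_smul_one_comm _ _).symm
    have hc : conv (conv k ρ) k = conv (fun t => e t - ρ t) k := conv_congr hkρ (ae_eq_refl _)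
    have h6 := conv_assoc_ae ik iρ ik
    rw [hc] at h6
    filter_upwards [h6, hkρ, ae_integrable_conv ik (iρ.sub ie),
      ae_integrable_conv ik (integrable_conv iρ ik), ae_integrable_conv ik iρ,
      ae_integrable_conv ik ie, ae_integrable_conv ie ik, ae_integrable_conv iρ ik]
      with t h1 h2 h3 h4 h5 h7 h8 h9
    have h10 : conv k p t = conv k (fun s => ρ s - e s) t + conv k (conv ρ k) t :=
      conv_add_right h3 h4
    rw [h10, conv_sub_right h5 h7, ← h1, conv_sub_left h8 h9, h2, hke, hp]
    simp only
    abel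
  have hk1 : ∫ t, ‖k t‖ < 1 := by
    have h1 : ∫ t, ‖k t‖ ≤ (∫ t, ‖e t‖) * ‖D‖ + (∫ t, ‖e t‖) * ∫ t, ‖η t‖ := by
      calc ∫ t, ‖k t‖ ≤ ∫ t, (‖e t‖ * ‖D‖ + ‖conv e η t‖) := by
            refine integral_mono ik.norm ((ie.norm.mul_const _).add (integrable_conv ie iη).norm)
              fun t => (norm_add_le _ _).trans (add_le_add_left (norm_mul_le _ _) _)
        _ = (∫ t, ‖e t‖) * ‖D‖ + ∫ t, ‖conv e η t‖ := by
            rw [integral_add (ie.norm.mul_const _) (integrable_conv ie iη).norm, integral_mul_const]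
        _ ≤ _ := by gcongr; exact integral_norm_conv_le ie iη
    have h2 : ∫ t, ‖e t‖ = 1 / l * ‖(1 : A)‖ := by
      simp only [he, norm_smul]
      rw [integral_mul_const, integral_norm_dampedStep hl0]
    have h3 : ∫ t, ‖η t‖ ≤ ∫ t, ‖g t‖ := integral_norm_exp_smul_le hl0.le hg hg0
    calc ∫ t, ‖k t‖ ≤ (∫ t, ‖e t‖) * ‖D‖ + (∫ t, ‖e t‖) * ∫ t, ‖g t‖ := by
          refine h1.trans ?_; gcongr
      _ = (l - 1) / l := by rw [h2, hl]; ring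
      _ < 1 := by rw [div_lt_one hl0]; linarith
  filter_upwards [eq_zero_of_conv_eq_neg ik ip hkp hk1, hρk] with t h1 h2
  have h3 : (fun s => ρ s * D + conv ρ η s)
      = fun s => Real.exp (-l * s) • (R s * D + conv R g s) := by
    ext s
    rw [hη, hρ, conv_exp_smul, smul_add, smul_mul_assoc]
  rw [h3, he, conv_dampedStep] at h2
  have h4 : ρ t - e t + conv ρ k t = 0 := h1
  have h5 : e t = Real.exp (-l * t) • (Ioi 0).indicator (1 : ℝ → A) t := by
    by_cases ht : t ∈ Ioi (0 : ℝ) <;> simp [he, dampedStep, ht]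
  rw [h2, h5, hρ] at h4
  simp only [← smul_sub, ← smul_add] at h4
  rw [smul_eq_zero_iff_right (Real.exp_pos _).ne'] at h4
  rw [← sub_eq_zero, ← h4]; abel

/-- Integration by parts for the primitive of an integrable function `q`. -/
theorem intervalIntegral_primitive_mul {q h : ℝ → A} (hq : Integrable q) {N : ℝ} (hN : 0 ≤ N)
    (hh : IntervalIntegrable h volume 0 N) :
    ∫ σ in (0 : ℝ)..N, (∫ s in (0 : ℝ)..σ, q s) * h σ
      = ∫ s in (0 : ℝ)..N, q s * ((∫ σ in (0 : ℝ)..N, h σ) - ∫ σ in (0 : ℝ)..s, h σ) := by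
  have hh' : Integrable h (volume.restrict (Ioc 0 N)) :=
    (intervalIntegrable_iff_integrableOn_Ioc_of_le hN).1 hh
  have hq' : Integrable q (volume.restrict (Ioc 0 N)) := hq.integrableOn
  have hms : MeasurableSet {z : ℝ × ℝ | z.2 < z.1} := measurableSet_lt measurable_snd measurable_fst
  have hint : Integrable (Function.uncurry fun σ s : ℝ => if s < σ then q s * h σ else 0)
      ((volume.restrict (Ioc 0 N)).prod (volume.restrict (Ioc 0 N))) := by
    have := (Integrable.mul_prod hq' hh').swap.indicator hms
    refine this.congr (ae_of_all _ fun z => ?_)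
    simp [indicator, Function.uncurry]
  have hsw := integral_integral_swap hint
  rw [intervalIntegral.integral_of_le hN, intervalIntegral.integral_of_le hN]
  refine Eq.trans (setIntegral_congr_fun measurableSet_Ioc fun σ hσ => ?_)
    (hsw.trans (setIntegral_congr_fun measurableSet_Ioc fun s hs => ?_))
  · have h1 : ∀ s, (if s < σ then q s * h σ else 0) = (Iio σ).indicator (fun s => q s * h σ) s :=
      fun s => by simp [indicator]
    simp_rw [h1]
    rw [integral_indicator measurableSet_Iio, Measure.restrict_restrict measurableSet_Iio]
    have h2 : Iio σ ∩ Ioc 0 N = Ioo 0 σ := by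
      ext x; constructor
      · rintro ⟨a, b, c⟩; exact ⟨b, a⟩
      · rintro ⟨a, b⟩; exact ⟨b, a, b.le.trans hσ.2⟩
    rw [h2, intervalIntegral.integral_of_le hσ.1.le, integral_Ioc_eq_integral_Ioo]
    exact (((ContinuousLinearMap.mul ℝ A).flip (h σ)).integral_comp_comm hq.integrableOn).symm
  · have h1 : ∀ σ, (if s < σ then q s * h σ else 0) = (Ioi s).indicator (fun σ => q s * h σ) σ :=
      fun s => by simp [indicator]
    simp_rw [h1]
    rw [integral_indicator measurableSet_Ioi, Measure.restrict_restrict measurableSet_Ioi]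
    have h2 : Ioi s ∩ Ioc 0 N = Ioc s N := by
      ext x; constructor
      · rintro ⟨a, b, c⟩; exact ⟨a, c⟩
      · rintro ⟨a, b⟩; exact ⟨a, hs.1.trans a, b⟩
    have h0s : IntervalIntegrable h volume 0 s := hh.mono_set (by
      rw [uIcc_of_le hN, uIcc_of_le hs.1.le]; exact Icc_subset_Icc_right hs.2)
    rw [h2, intervalIntegral.integral_interval_sub_left hh h0s,
      intervalIntegral.integral_of_le hs.2]
    exact (((ContinuousLinearMap.mul ℝ A) (q s)).integral_comp_comm
      (hh'.mono_measure (Measure.restrict_mono (Ioc_subset_Ioc_left hs.1.le) le_rfl)))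

/-- Variation of constants on the whole line: a bounded solution of the Volterra equation on the
line is the convolution of the resolvent with the forcing term. -/
theorem bounded_solution_eq_conv {D : A} {g R v F : ℝ → A} (hg : Integrable g) (hR : Integrable R)
    (hg0 : ∀ t ≤ 0, g t = 0) (hR0 : ∀ t ≤ 0, R t = 0)
    (heq : ∀ t, 0 < t → R t = 1 - ∫ s in Iio t, (D * R s + conv g R s))
    {C : ℝ} (hv : AEStronglyMeasurable v volume) (hC : ∀ t, ‖v t‖ ≤ C)
    (hF : ∀ a b, IntervalIntegrable F volume a b) (hRF : ∀ t, Integrable fun s => R s * F (t - s))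
    (hvF : ∀ t₁ t₂, t₁ ≤ t₂ → v t₂ - v t₁ = ∫ τ in t₁..t₂, (F τ - D * v τ - conv g v τ)) (t : ℝ) :
    v t = conv R F t := by
  -- By the right equation, -q is the derivative of R on the positive axis in integrated form: R = 1
  -- - Q almost everywhere, with Q the primitive of q.
  set q : ℝ → A := fun s => R s * D + conv R g s with hq
  have iRD : Integrable fun s => R s * D := hR.mul_const D
  have iq : Integrable q := iRD.add (integrable_conv hR hg)
  have hq0 : ∀ s ≤ 0, q s = 0 := fun s hs => by
    simp only [hq]
    rw [hR0 s hs, conv_eq_zero_of_nonpos hR0 hg0 hs]; simp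
  set h : ℝ → A := fun τ => F τ - D * v τ - conv g v τ with hh
  have mgv : AEStronglyMeasurable (conv g v) volume :=
    aestronglyMeasurable_conv hg.aestronglyMeasurable hv
  have bgv : ∀ t, ‖conv g v t‖ ≤ (∫ s, ‖g s‖) * C := norm_conv_le hg hC
  have mDv : AEStronglyMeasurable (fun s => D * v s) volume := hv.const_mul D
  have bDv : ∀ t, ‖D * v t‖ ≤ ‖D‖ * C := fun t =>
    (norm_mul_le _ _).trans (mul_le_mul_of_nonneg_left (hC t) (norm_nonneg _))
  have loc : ∀ {f : ℝ → A} {B : ℝ} (a b : ℝ), AEStronglyMeasurable f volume →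
      (∀ t, ‖f t‖ ≤ B) → IntervalIntegrable f volume a b := fun {f B} a b hf hB =>
    (intervalIntegrable_const (c := B)).mono_fun' hf.restrict (ae_of_all _ hB)
  have hint : ∀ a b, IntervalIntegrable h volume a b := fun a b =>
    ((hF a b).sub (loc a b mDv bDv)).sub (loc a b mgv bgv)
  -- the primitive of `q`
  set Q : ℝ → A := fun N => ∫ s in (0 : ℝ)..N, q s with hQ
  have hQlim : Tendsto Q atTop (𝓝 (∫ s, q s)) := by
    have h1 := intervalIntegral_tendsto_integral_Ioi (f := q) (μ := volume) 0 iq.integrableOn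
      tendsto_id
    have h2 : ∫ s in Ioi 0, q s = ∫ s, q s :=
      setIntegral_eq_integral_of_forall_compl_eq_zero fun s hs => hq0 s (by simpa using hs)
    rwa [h2] at h1
  have hRQ : ∀ᵐ s, 0 < s → R s = 1 - Q s := by
    filter_upwards [right_resolvent_equation hg hR hg0 hR0 heq] with s hs hs0
    rw [hs, indicator_of_mem (show s ∈ Ioi (0 : ℝ) from hs0)]
    simp only [hQ, Pi.one_apply]
    rw [intervalIntegral.integral_of_le hs0.le, integral_Ioc_eq_integral_Ioo,
      setIntegral_eq_of_subset_of_forall_sdiff_eq_zero measurableSet_Iio Ioo_subset_Iio_self]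
    rintro x ⟨hx, hx'⟩
    exact hq0 x (by by_contra hc; exact hx' ⟨not_le.1 hc, hx⟩)
  -- An integrable function on a half-line of infinite measure that has a limit at infinity has
  -- limit zero; 1 - Q agrees almost everywhere with R there.
  have hQ1 : (1 : A) - ∫ s, q s = 0 := by
    refine IntegrableAtFilter.eq_zero_of_tendsto (μ := volume) (l := atTop)
      (f := fun N => 1 - Q N) ?_ ?_ (tendsto_const_nhds.sub hQlim)
    · refine ⟨Ioi 0, Ioi_mem_atTop 0, hR.integrableOn.congr ?_⟩
      exact (ae_restrict_iff' measurableSet_Ioi).2 hRQ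
    · intro s hs
      obtain ⟨a, ha⟩ := mem_atTop_sets.1 hs
      exact measure_mono_top (fun x hx => ha x hx) (Real.volume_Ici (a := a))
  have iqv : Integrable fun s => q s * v (t - s) := integrable_mul_bounded iq hv hC t
  have iRh : Integrable fun s => R s * h (t - s) := by
    have := ((hRF t).sub (integrable_mul_bounded hR mDv bDv t)).sub
      (integrable_mul_bounded hR mgv bgv t)
    refine this.congr (ae_of_all _ fun s => ?_)
    simp [hh, mul_sub]
  have hΨ : ∀ s, 0 ≤ s → ∫ σ in (0 : ℝ)..s, h (t - σ) = v t - v (t - s) := fun s hs => by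
    rw [intervalIntegral.integral_comp_sub_left (fun σ => h σ), hvF _ _ (by linarith), sub_zero]
  -- Integration by parts on [0, N]. The derivative falls on R through Q, and h enters only through
  -- its primitive, the increments of v, so v need not be differentiated.
  have key : ∀ N, 0 ≤ N → ∫ σ in (0 : ℝ)..N, R σ * h (t - σ)
      = v t - (1 - Q N) * v (t - N) - ∫ s in (0 : ℝ)..N, q s * v (t - s) := fun N hN => by
    have i1 : IntervalIntegrable (fun σ => h (t - σ)) volume 0 N := by
      have := (hint (t - 0) (t - N)).comp_sub_left t
      simpa using this
    have hQc : Continuous Q := intervalIntegral.continuous_primitive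
      (fun a b => iq.intervalIntegrable) 0
    have i2 : IntervalIntegrable (fun σ => Q σ * h (t - σ)) volume 0 N :=
      i1.continuousOn_mul hQc.continuousOn
    have e1 : ∫ σ in (0 : ℝ)..N, R σ * h (t - σ)
        = ∫ σ in (0 : ℝ)..N, (h (t - σ) - Q σ * h (t - σ)) := by
      refine intervalIntegral.integral_congr_ae ?_
      filter_upwards [hRQ] with s hs hs'
      rw [uIoc_of_le hN] at hs'
      rw [hs hs'.1, sub_mul, one_mul]
    have i3 : IntervalIntegrable (fun s => q s * v (t - s)) volume 0 N := iqv.intervalIntegrable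
    have i4 : IntervalIntegrable (fun s => q s * v (t - N)) volume 0 N :=
      (iq.mul_const _).intervalIntegrable
    have e2 : ∫ s in (0 : ℝ)..N, q s * ((∫ σ in (0 : ℝ)..N, h (t - σ)) - ∫ σ in (0 : ℝ)..s, h (t - σ))
        = ∫ s in (0 : ℝ)..N, (q s * v (t - s) - q s * v (t - N)) := by
      refine intervalIntegral.integral_congr fun s hs => ?_
      rw [uIcc_of_le hN] at hs
      rw [hΨ N hN, hΨ s hs.1, ← mul_sub]
      congr 1; abel
    have e3 : ∫ s in (0 : ℝ)..N, q s * v (t - N) = Q N * v (t - N) := by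
      rw [hQ]
      exact (((ContinuousLinearMap.mul ℝ A).flip (v (t - N))).intervalIntegral_comp_comm
        iq.intervalIntegrable)
    rw [e1, intervalIntegral.integral_sub i1 i2, intervalIntegral_primitive_mul iq hN i1, e2,
      intervalIntegral.integral_sub i3 i4, e3, hΨ N hN, sub_mul, one_mul]
    abel
  have lim1 : Tendsto (fun N => ∫ σ in (0 : ℝ)..N, R σ * h (t - σ)) atTop (𝓝 (conv R h t)) := by
    have h1 := intervalIntegral_tendsto_integral_Ioi (μ := volume) 0 iRh.integrableOn tendsto_id
    have h2 : ∫ s in Ioi 0, R s * h (t - s) = conv R h t :=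
      setIntegral_eq_integral_of_forall_compl_eq_zero fun s hs => by
        rw [hR0 s (by simpa using hs), zero_mul]
    rwa [h2] at h1
  have lim2 : Tendsto (fun N => ∫ s in (0 : ℝ)..N, q s * v (t - s)) atTop (𝓝 (conv q v t)) := by
    have h1 := intervalIntegral_tendsto_integral_Ioi (μ := volume) 0 iqv.integrableOn tendsto_id
    have h2 : ∫ s in Ioi 0, q s * v (t - s) = conv q v t :=
      setIntegral_eq_integral_of_forall_compl_eq_zero fun s hs => by
        rw [hq0 s (by simpa using hs), zero_mul]
    rwa [h2] at h1
  have lim3 : Tendsto (fun N => (1 - Q N) * v (t - N)) atTop (𝓝 0) := by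
    have h1 : Tendsto (fun N => 1 - Q N) atTop (𝓝 0) := by
      have := (tendsto_const_nhds (x := (1 : A))).sub hQlim
      rwa [hQ1] at this
    refine squeeze_zero_norm (fun N => (norm_mul_le _ _).trans
      (mul_le_mul_of_nonneg_left (hC _) (norm_nonneg _))) ?_
    simpa using h1.norm.mul_const C
  have lim4 := ((tendsto_const_nhds (x := v t)).sub lim3).sub lim2
  -- In the limit R * h = v - q * v. Expanding h on the left and q on the right, the terms R * (D v)
  -- and R * (g * v) occur on both sides, which leaves v = R * F.
  have e := tendsto_nhds_unique (lim1.congr' ((eventually_ge_atTop 0).mono key)) lim4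
  have e5 : conv R h t = conv R F t - conv R (fun s => D * v s) t - conv R (conv g v) t := by
    have i1 := integrable_mul_bounded hR mDv bDv t
    have i2 := integrable_mul_bounded hR mgv bgv t
    rw [← conv_sub_right (hRF t) i1]
    refine conv_sub_right ?_ i2
    refine ((hRF t).sub i1).congr (ae_of_all _ fun s => ?_)
    simp [mul_sub]
  have e6 : conv q v t = conv R (fun s => D * v s) t + conv R (conv g v) t := by
    rw [hq, conv_add_left (integrable_mul_bounded iRD hv hC t)
      (integrable_mul_bounded (integrable_conv hR hg) hv hC t), conv_mul_const_left,
      conv_assoc_of_bounded hR hg hv hC]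
  rw [e5, e6, sub_zero] at e
  have : conv R F t = v t := by
    have := congrArg (fun x => x + conv R (fun s => D * v s) t + conv R (conv g v) t) e
    simpa [sub_add_eq_sub_sub] using this
  exact this.symm

end Resolvent
end GLE

/-! ### Transfer to matrices and vectors -/

namespace GLE

/-- The extension by zero of a kernel on `ℝ⁺` to the line. -/
noncomputable def causal {d : ℕ} (M : ℝ → Matrix (Fin d) (Fin d) ℝ) :
    ℝ → Matrix (Fin d) (Fin d) ℝ := (Ioi 0).indicator M

section MatrixNorm

attribute [local instance] Matrix.linftyOpNormedRing Matrix.linftyOpNormedAlgebra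

/-- The topology of the operator norm on matrices. -/
@[reducible] noncomputable def matrixNormTopology (d : ℕ) :
    TopologicalSpace (Matrix (Fin d) (Fin d) ℝ) :=
  (Matrix.linftyOpNormedRing (n := Fin d) (α := ℝ)).toMetricSpace.toUniformSpace.toTopologicalSpace

attribute [local instance] matrixNormTopology

variable {d : ℕ}

/-- The entries of a matrix as continuous linear functionals. -/
noncomputable def entryCLM (i j : Fin d) : Matrix (Fin d) (Fin d) ℝ →L[ℝ] ℝ :=
  LinearMap.toContinuousLinearMap (Matrix.entryLinearMap ℝ ℝ i j)

theorem eq_sum_smul_single (M : Matrix (Fin d) (Fin d) ℝ) :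
    M = ∑ i, ∑ j, M i j • Matrix.single i j (1 : ℝ) := by
  conv_lhs => rw [Matrix.matrix_eq_sum_single M]
  simp [Matrix.smul_single]

variable {X : Type*} [MeasurableSpace X] {μ : Measure X}

theorem integrable_matrix {f : X → Matrix (Fin d) (Fin d) ℝ}
    (h : ∀ i j, Integrable (fun t => f t i j) μ) : Integrable f μ := by
  have : f = fun t => ∑ i, ∑ j, f t i j • Matrix.single i j (1 : ℝ) :=
    funext fun t => eq_sum_smul_single (f t)
  rw [this]
  exact integrable_finsetSum _ fun i _ => integrable_finsetSum _ fun j _ => (h i j).smul_const _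

theorem aestronglyMeasurable_matrix {f : X → Matrix (Fin d) (Fin d) ℝ}
    (h : ∀ i j, AEStronglyMeasurable (fun t => f t i j) μ) : AEStronglyMeasurable f μ := by
  have : f = fun t => ∑ i, ∑ j, f t i j • Matrix.single i j (1 : ℝ) :=
    funext fun t => eq_sum_smul_single (f t)
  rw [this]
  exact Finset.aestronglyMeasurable_fun_sum _ fun i _ =>
    Finset.aestronglyMeasurable_fun_sum _ fun j _ => (h i j).smul_const _

theorem integrable_entry {f : X → Matrix (Fin d) (Fin d) ℝ} (h : Integrable f μ) (i j : Fin d) :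
    Integrable (fun t => f t i j) μ := (entryCLM i j).integrable_comp h

theorem integral_entry {f : X → Matrix (Fin d) (Fin d) ℝ} (h : Integrable f μ) (i j : Fin d) :
    (∫ t, f t ∂μ) i j = ∫ t, f t i j ∂μ := ((entryCLM i j).integral_comp_comm h).symm

theorem norm_entry_le (M : Matrix (Fin d) (Fin d) ℝ) (i j : Fin d) : |M i j| ≤ ‖M‖ := by
  rw [Matrix.linfty_opNorm_def]
  have h1 : ‖M i j‖₊ ≤ ∑ k, ‖M i k‖₊ :=
    Finset.single_le_sum (f := fun k => ‖M i k‖₊) (fun _ _ => zero_le) (Finset.mem_univ j)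
  have h2 := h1.trans (Finset.le_sup (f := fun i => ∑ k, ‖M i k‖₊) (Finset.mem_univ i))
  exact_mod_cast h2

theorem causal_of_nonpos (M : ℝ → Matrix (Fin d) (Fin d) ℝ) {t : ℝ} (ht : t ≤ 0) :
    causal M t = 0 := indicator_of_notMem (by simpa using ht) _

theorem causal_of_pos (M : ℝ → Matrix (Fin d) (Fin d) ℝ) {t : ℝ} (ht : 0 < t) :
    causal M t = M t := indicator_of_mem (show t ∈ Ioi (0 : ℝ) from ht) _

theorem causal_apply (M : ℝ → Matrix (Fin d) (Fin d) ℝ) (i j : Fin d) :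
    (fun t => causal M t i j) = (Ioi 0).indicator fun t => M t i j := by
  ext t
  by_cases ht : t ∈ Ioi (0 : ℝ) <;> simp [causal, ht]

theorem IsL1Pos.integrable_causal {M : ℝ → Matrix (Fin d) (Fin d) ℝ} (h : IsL1Pos M)
    (i j : Fin d) : Integrable fun t => causal M t i j := by
  rw [causal_apply]
  exact (integrable_indicator_iff measurableSet_Ioi).2 (h i j)

variable {D : Matrix (Fin d) (Fin d) ℝ} {γ r : ℝ → Matrix (Fin d) (Fin d) ℝ}

/-- The fundamental theorem of calculus with one-sided derivatives, recast for causal extensions so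
that the Banach algebra results apply. The extension is zero at t = 0 although r 0 = 1, hence the
restriction to positive times. -/
theorem IsDifferentialResolvent.integral_equation (hγ : IsL1Pos γ)
    (hr : IsDifferentialResolvent D γ r) (hr1 : IsL1Pos r) (t : ℝ) (ht : 0 < t) :
    causal r t = 1 - ∫ s in Iio t, (D * causal r s + conv (causal γ) (causal r) s) := by
  have ig : Integrable (causal γ) := integrable_matrix hγ.integrable_causal
  have iR : Integrable (causal r) := integrable_matrix hr1.integrable_causal
  have iU : Integrable fun s => D * causal r s + conv (causal γ) (causal r) s :=
    (iR.const_mul D).add (integrable_conv ig iR)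
  have hU0 : ∀ s ≤ 0, D * causal r s + conv (causal γ) (causal r) s = 0 := fun s hs => by
    rw [causal_of_nonpos r hs, conv_eq_zero_of_nonpos (fun _ => causal_of_nonpos γ)
      (fun _ => causal_of_nonpos r) hs]
    simp
  have e1 : ∫ s in Iio t, (D * causal r s + conv (causal γ) (causal r) s)
      = ∫ s in Ioc 0 t, (D * causal r s + conv (causal γ) (causal r) s) := by
    rw [integral_Ioc_eq_integral_Ioo]
    refine setIntegral_eq_of_subset_of_forall_sdiff_eq_zero measurableSet_Iio
      Ioo_subset_Iio_self ?_
    rintro x ⟨hx, hx'⟩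
    exact hU0 x (by by_contra hc; exact hx' ⟨not_le.1 hc, hx⟩)
  rw [e1, causal_of_pos r ht]
  ext i j
  rw [Matrix.sub_apply, integral_entry iU.integrableOn]
  have hUe : ∀ᵐ s, s ∈ Ioc 0 t → (D * causal r s + conv (causal γ) (causal r) s) i j
      = -(-(D * r s) i j - ∫ u in (0 : ℝ)..s, (γ (s - u) * r u) i j) := by
    filter_upwards [ae_integrable_conv ig iR] with s hs hst
    rw [Matrix.add_apply, causal_of_pos r hst.1, conv, integral_entry hs,
      ← integral_sub_left_eq_self _ volume s, intervalIntegral.integral_of_le hst.1.le,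
      integral_Ioc_eq_integral_Ioo]
    have : ∫ u in Ioo 0 s, (γ (s - u) * r u) i j
        = ∫ u, (causal γ (s - u) * causal r (s - (s - u))) i j := by
      rw [← integral_indicator measurableSet_Ioo]
      congr 1; ext u
      rw [sub_sub_cancel]
      by_cases hu : u ∈ Ioo 0 s
      · rw [indicator_of_mem hu, causal_of_pos r hu.1, causal_of_pos γ (sub_pos.2 hu.2)]
      · rw [indicator_of_notMem hu]
        rcases le_or_gt u 0 with h | h
        · simp [causal_of_nonpos r h]
        · have h' : s - u ≤ 0 := by
            by_contra hc; exact hu ⟨h, by linarith⟩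
          simp [causal_of_nonpos γ h']
    rw [this]; ring
  have iU' := integrable_entry iU i j
  have hd : ∀ x : ℝ, 0 ≤ x → _ := fun x hx => hr.2 x hx i j
  -- Integrability of the derivative is not part of the resolvent hypothesis; it follows because the
  -- derivative agrees almost everywhere on (0, t] with an entry of -(D R + γ * R), which is
  -- integrable.
  have hint : IntervalIntegrable
      (fun s => -(D * r s) i j - ∫ u in (0 : ℝ)..s, (γ (s - u) * r u) i j) volume 0 t := by
    rw [intervalIntegrable_iff_integrableOn_Ioc_of_le ht.le]
    refine iU'.neg.integrableOn.congr ?_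
    rw [EventuallyEq, ae_restrict_iff' measurableSet_Ioc]
    filter_upwards [hUe] with s hs hst
    rw [Pi.neg_apply, hs hst, neg_neg]
  have ftc := intervalIntegral.integral_eq_sub_of_hasDeriv_right (a := 0) (b := t)
    (f := fun u => r u i j)
    (f' := fun s => -(D * r s) i j - ∫ u in (0 : ℝ)..s, (γ (s - u) * r u) i j)
    (fun x hx => by
      rw [uIcc_of_le ht.le] at hx
      exact (hd x hx.1).continuousWithinAt.mono (uIcc_of_le ht.le ▸ Icc_subset_Ici_self))
    (fun x hx => by
      rw [min_eq_left ht.le] at hx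
      exact (hd x hx.1.le).mono (Ioi_subset_Ici hx.1.le))
    hint
  have e2 : ∫ s in Ioc 0 t, (D * causal r s + conv (causal γ) (causal r) s) i j
      = -∫ s in (0 : ℝ)..t, (-(D * r s) i j - ∫ u in (0 : ℝ)..s, (γ (s - u) * r u) i j) := by
    rw [intervalIntegral.integral_of_le ht.le, ← integral_neg]
    exact setIntegral_congr_ae measurableSet_Ioc hUe
  rw [e2, ftc, hr.1]
  ring

/-- The resolvent is the identity minus a primitive of an integrable function. Together with r ∈ L¹
this yields r ∈ L², which is what allows convolution with merely square integrable data. -/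
theorem IsDifferentialResolvent.bounded (hγ : IsL1Pos γ)
    (hr : IsDifferentialResolvent D γ r) (hr1 : IsL1Pos r) :
    ∃ B, ∀ t i j, |causal r t i j| ≤ B := by
  have ig : Integrable (causal γ) := integrable_matrix hγ.integrable_causal
  have iR : Integrable (causal r) := integrable_matrix hr1.integrable_causal
  have iU : Integrable fun s => D * causal r s + conv (causal γ) (causal r) s :=
    (iR.const_mul D).add (integrable_conv ig iR)
  refine ⟨‖(1 : Matrix (Fin d) (Fin d) ℝ)‖
    + ∫ s, ‖D * causal r s + conv (causal γ) (causal r) s‖, fun t i j => ?_⟩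
  have hn : 0 ≤ ∫ s, ‖D * causal r s + conv (causal γ) (causal r) s‖ :=
    integral_nonneg fun _ => norm_nonneg _
  rcases le_or_gt t 0 with ht | ht
  · rw [causal_of_nonpos r ht]; simp only [Matrix.zero_apply, abs_zero]; positivity
  · refine (norm_entry_le _ i j).trans ?_
    rw [hr.integral_equation hγ hr1 t ht]
    refine (norm_sub_le _ _).trans (add_le_add_right ?_ _)
    exact (norm_integral_le_integral_norm _).trans
      (setIntegral_le_integral iU.norm (ae_of_all _ fun _ => norm_nonneg _))

theorem IsDifferentialResolvent.continuousOn (hr : IsDifferentialResolvent D γ r) (i j : Fin d) :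
    ContinuousOn (fun t => r t i j) (Ici 0) :=
  fun t ht => (hr.2 t ht i j).continuousWithinAt

/-- Variation of constants for bounded vector-valued functions on the whole line. -/
theorem bounded_solution_eq (hγ : IsL1Pos γ)
    (hr : IsDifferentialResolvent D γ r) (hr1 : IsL1Pos r) {v F : ℝ → Fin d → ℝ} {C : ℝ}
    (hv : ∀ i, AEStronglyMeasurable (fun t => v t i) volume) (hC : ∀ t i, |v t i| ≤ C)
    (hF : ∀ j a b, IntervalIntegrable (fun t => F t j) volume a b)
    (hRF : ∀ t i j, Integrable fun s => causal r s i j * F (t - s) j)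
    (hvF : ∀ t₁ t₂, t₁ ≤ t₂ → ∀ i, v t₂ i - v t₁ i = ∫ τ in t₁..t₂,
      (F τ i - ∑ j, D i j * v τ j - ∑ j, ∫ s, causal γ s i j * v (τ - s) j)) (t : ℝ) (i : Fin d) :
    v t i = ∑ j, ∫ s, causal r s i j * F (t - s) j := by
  have ig : Integrable (causal γ) := integrable_matrix hγ.integrable_causal
  have iR : Integrable (causal r) := integrable_matrix hr1.integrable_causal
  -- A vector becomes the square matrix all of whose columns equal it, so matrix-vector products are
  -- products in the Banach algebra of matrices.
  set col : (ℝ → Fin d → ℝ) → ℝ → Matrix (Fin d) (Fin d) ℝ :=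
    fun u t => Matrix.of fun i _ => u t i with hcol
  have hmul : ∀ (M : Matrix (Fin d) (Fin d) ℝ) (u : ℝ → Fin d → ℝ) t i j,
      (M * col u t) i j = ∑ k, M i k * u t k := fun M u t i j => by
    simp [hcol, Matrix.mul_apply]
  have hC0 : 0 ≤ C := (abs_nonneg _).trans (hC 0 i)
  have hCm : ∀ t, ‖col v t‖ ≤ d * C := fun t => by
    rw [Matrix.linfty_opNorm_def]
    have : ∀ i ∈ Finset.univ, ∑ j, ‖col v t i j‖₊ ≤ (d : ℝ≥0) * C.toNNReal := fun i _ => by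
      refine (Finset.sum_le_card_nsmul _ _ C.toNNReal fun j _ => ?_).trans (by simp)
      rw [← NNReal.coe_le_coe, Real.coe_toNNReal _ hC0]
      simpa [hcol] using hC t i
    have := NNReal.coe_le_coe.2 (Finset.sup_le this)
    simpa [Real.coe_toNNReal _ hC0] using this
  have mv : AEStronglyMeasurable (col v) volume := aestronglyMeasurable_matrix fun i _ => hv i
  have iRF : ∀ t, Integrable fun s => causal r s * col F (t - s) := fun t =>
    integrable_matrix fun i j => by
      simp_rw [hmul]
      exact integrable_finsetSum _ fun k _ => hRF t i k
  have iF : ∀ a b, IntervalIntegrable (col F) volume a b := fun a b =>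
    ⟨integrable_matrix fun i _ => (hF i a b).1, integrable_matrix fun i _ => (hF i a b).2⟩
  have igv : ∀ t, Integrable fun s => causal γ s * col v (t - s) :=
    integrable_mul_bounded ig mv hCm
  have igv' : ∀ t i j, Integrable fun s => causal γ s i j * v (t - s) j := fun t i j =>
    (hγ.integrable_causal i j).mul_bdd ((hv j).comp_const_sub t) (ae_of_all _ fun s => hC _ j)
  have econv : ∀ τ i j, conv (causal γ) (col v) τ i j
      = ∑ k, ∫ s, causal γ s i k * v (τ - s) k := fun τ i j => by
    rw [conv, integral_entry (igv τ)]
    simp_rw [hmul]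
    exact integral_finsetSum _ fun k _ => igv' τ i k
  have key := bounded_solution_eq_conv (D := D) ig iR (fun _ => causal_of_nonpos γ)
    (fun _ => causal_of_nonpos r) (hr.integral_equation hγ hr1) mv hCm iF iRF
    (fun t₁ t₂ h12 => by
      ext a b
      have iall : IntervalIntegrable
          (fun τ => col F τ - D * col v τ - conv (causal γ) (col v) τ) volume t₁ t₂ := by
        have mg := aestronglyMeasurable_conv ig.aestronglyMeasurable mv
        have b1 : ∀ t, ‖D * col v t‖ ≤ ‖D‖ * (d * C) := fun t =>
          (norm_mul_le _ _).trans (mul_le_mul_of_nonneg_left (hCm t) (norm_nonneg _))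
        refine ((iF t₁ t₂).sub ?_).sub ?_
        · exact (intervalIntegrable_const (c := ‖D‖ * (d * C))).mono_fun'
            (mv.const_mul D).restrict (ae_of_all _ b1)
        · exact (intervalIntegrable_const (c := (∫ s, ‖causal γ s‖) * (d * C))).mono_fun'
            mg.restrict (ae_of_all _ (norm_conv_le ig hCm))
      rw [Matrix.sub_apply, intervalIntegral.integral_of_le h12, integral_entry iall.1]
      have := hvF t₁ t₂ h12 a
      rw [intervalIntegral.integral_of_le h12] at this
      simp only [Matrix.sub_apply, hmul, econv]
      exact this) t
  have := congrFun (congrFun key i) i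
  rw [conv, integral_entry (iRF t)] at this
  simp_rw [hmul] at this
  rw [integral_finsetSum _ fun k _ => hRF t i k] at this
  exact this

end MatrixNorm
end GLE

namespace GLE

/-! ### The Cauchy–Schwarz inequality in L² -/

section SquareIntegrable

variable {X : Type*} [MeasurableSpace X] {μ : Measure X}

theorem integrable_mul_of_memLp {f g : X → ℝ} (hf : MemLp f 2 μ) (hg : MemLp g 2 μ) :
    Integrable (fun x => f x * g x) μ := hf.integrable_mul hg

/-- The Cauchy–Schwarz inequality. -/
theorem sq_integral_mul_le {f g : X → ℝ} (hf : MemLp f 2 μ) (hg : MemLp g 2 μ) :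
    (∫ x, f x * g x ∂μ) ^ 2 ≤ (∫ x, f x ^ 2 ∂μ) * ∫ x, g x ^ 2 ∂μ := by
  have h : ∀ t : ℝ, 0 ≤ (∫ x, f x ^ 2 ∂μ) * (t * t) + (2 * ∫ x, f x * g x ∂μ) * t
      + ∫ x, g x ^ 2 ∂μ := fun t => by
    have e : ∫ x, (t * f x + g x) ^ 2 ∂μ = (∫ x, f x ^ 2 ∂μ) * (t * t)
        + (2 * ∫ x, f x * g x ∂μ) * t + ∫ x, g x ^ 2 ∂μ := by
      have e1 : ∀ x, (t * f x + g x) ^ 2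
          = t * t * f x ^ 2 + 2 * t * (f x * g x) + g x ^ 2 := fun x => by ring
      simp_rw [e1]
      have i1 := hf.integrable_sq.const_mul (t * t)
      have i2 := (integrable_mul_of_memLp hf hg).const_mul (2 * t)
      have i3 : Integrable (fun x => t * t * f x ^ 2 + 2 * t * (f x * g x)) μ := i1.add i2
      rw [integral_add i3 hg.integrable_sq, integral_add i1 i2,
        integral_const_mul, integral_const_mul]
      ring
    rw [← e]
    exact integral_nonneg fun x => sq_nonneg _
  have := discrim_le_zero h
  rw [discrim] at this
  nlinarith

theorem abs_integral_mul_le {f g : X → ℝ} (hf : MemLp f 2 μ) (hg : MemLp g 2 μ) :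
    |∫ x, f x * g x ∂μ| ≤ √(∫ x, f x ^ 2 ∂μ) * √(∫ x, g x ^ 2 ∂μ) := by
  rw [← Real.sqrt_mul (integral_nonneg fun x => sq_nonneg _)]
  exact Real.abs_le_sqrt (sq_integral_mul_le hf hg)

theorem integral_abs_mul_le {f g : X → ℝ} (hf : MemLp f 2 μ) (hg : MemLp g 2 μ) :
    ∫ x, |f x * g x| ∂μ ≤ √(∫ x, f x ^ 2 ∂μ) * √(∫ x, g x ^ 2 ∂μ) := by
  have := (le_abs_self _).trans (abs_integral_mul_le hf.abs hg.abs)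
  simpa only [Pi.abs_apply, abs_mul, sq_abs] using this

theorem eLpNorm_two_eq {f : X → ℝ} (hf : MemLp f 2 μ) :
    eLpNorm f 2 μ = ENNReal.ofReal √(∫ x, f x ^ 2 ∂μ) := by
  rw [hf.eLpNorm_eq_integral_rpow_norm (by simp) (by simp), Real.sqrt_eq_rpow]
  simp

theorem integral_sq_le_of_eLpNorm_le {f : X → ℝ} (hf : MemLp f 2 μ) {C : ℝ} (hC : 0 ≤ C)
    (h : eLpNorm f 2 μ ≤ ENNReal.ofReal C) : ∫ x, f x ^ 2 ∂μ ≤ C ^ 2 := by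
  rw [eLpNorm_two_eq hf, ENNReal.ofReal_le_ofReal_iff hC] at h
  exact (Real.sqrt_le_left hC).1 h

end SquareIntegrable

/-! ### Processes bounded in mean square -/

section SecondOrder

variable {Ω : Type*} [MeasurableSpace Ω] {P : Measure Ω} [IsProbabilityMeasure P]

/-- Jointly measurable processes that are bounded in mean square. -/
structure IsL2Process (P : Measure Ω) (X : ℝ → Ω → ℝ) : Prop where
  measurable : Measurable (Function.uncurry X)
  memLp : ∀ t, MemLp (X t) 2 P
  bounded : ∃ C, ∀ t, ∫ ω, X t ω ^ 2 ∂P ≤ C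

theorem IsL2Process.of_eLpNorm_le {X : ℝ → Ω → ℝ} (h : Measurable (Function.uncurry X)) {C : ℝ≥0}
    (hC : ∀ t, eLpNorm (X t) 2 P ≤ C) : IsL2Process P X := by
  have hm : ∀ t, MemLp (X t) 2 P := fun t =>
    ⟨(h.comp measurable_prodMk_left).aestronglyMeasurable, (hC t).trans_lt ENNReal.coe_lt_top⟩
  refine ⟨h, hm, (C : ℝ) ^ 2, fun t => integral_sq_le_of_eLpNorm_le (hm t) C.2 ?_⟩
  simpa using hC t

theorem IsL2Process.comp_const_sub {X : ℝ → Ω → ℝ} (h : IsL2Process P X) (t : ℝ) :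
    IsL2Process P fun s => X (t - s) :=
  ⟨h.measurable.comp ((measurable_const.sub measurable_fst).prodMk measurable_snd),
    fun s => h.memLp _, h.bounded.imp fun _ hC s => hC _⟩

variable {X : ℝ → Ω → ℝ} {Y : Ω → ℝ} {h : ℝ → ℝ}

/-- Cauchy–Schwarz, with a bound uniform in t; the uniformity is what makes correlations convolvable
with L¹ kernels. -/
theorem IsL2Process.correlation_bounded (hX : IsL2Process P X) (hY : MemLp Y 2 P) :
    ∃ C, ∀ t, ∫ ω, |X t ω * Y ω| ∂P ≤ C := by
  obtain ⟨C, hC⟩ := hX.bounded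
  exact ⟨√C * √(∫ ω, Y ω ^ 2 ∂P), fun t => (integral_abs_mul_le (hX.memLp t) hY).trans
    (mul_le_mul_of_nonneg_right (Real.sqrt_le_sqrt (hC t)) (Real.sqrt_nonneg _))⟩

theorem IsL2Process.abs_correlation_bounded (hX : IsL2Process P X) (hY : MemLp Y 2 P) :
    ∃ C, ∀ t, |∫ ω, X t ω * Y ω ∂P| ≤ C :=
  (hX.correlation_bounded hY).imp fun _ hC t => (abs_integral_le_integral_abs).trans (hC t)

theorem IsL2Process.aestronglyMeasurable_mul (hX : IsL2Process P X)
    (hY : AEStronglyMeasurable Y P) :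
    AEStronglyMeasurable (Function.uncurry fun t ω => X t ω * Y ω)
      ((volume : Measure ℝ).prod P) :=
  hX.measurable.aestronglyMeasurable.mul hY.comp_snd

theorem IsL2Process.aestronglyMeasurable_correlation (hX : IsL2Process P X) (hY : MemLp Y 2 P) :
    AEStronglyMeasurable (fun t => ∫ ω, X t ω * Y ω ∂P) volume :=
  (hX.aestronglyMeasurable_mul hY.1).integral_prod_right'

/-- Absolute integrability over time and probability, which justifies exchanging expectations with
time integrals. -/
theorem IsL2Process.integrable_prod (hX : IsL2Process P X) (hY : MemLp Y 2 P)
    (hh : Integrable h) :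
    Integrable (Function.uncurry fun t ω => h t * X t ω * Y ω) ((volume : Measure ℝ).prod P) := by
  have hm : AEStronglyMeasurable (Function.uncurry fun t ω => h t * X t ω * Y ω)
      ((volume : Measure ℝ).prod P) := by
    refine (hh.aestronglyMeasurable.comp_fst.mul (hX.aestronglyMeasurable_mul hY.1)).congr
      (ae_of_all _ fun z => ?_)
    simp [Function.uncurry, mul_assoc]
  obtain ⟨C, hC⟩ := hX.correlation_bounded hY
  rw [integrable_prod_iff hm]
  constructor
  · refine ae_of_all _ fun t => ?_
    simpa [Function.uncurry, mul_assoc]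
      using (integrable_mul_of_memLp (hX.memLp t) hY).const_mul (h t)
  · refine (hh.norm.mul_const C).mono' hm.norm.integral_prod_right' (ae_of_all _ fun t => ?_)
    have e : ∫ ω, ‖Function.uncurry (fun t ω => h t * X t ω * Y ω) (t, ω)‖ ∂P
        = ‖h t‖ * ∫ ω, |X t ω * Y ω| ∂P := by
      rw [← integral_const_mul]
      congr 1; ext ω
      simp [Function.uncurry, abs_mul, mul_assoc]
    rw [e, Real.norm_of_nonneg (by positivity)]
    exact mul_le_mul_of_nonneg_left (hC t) (norm_nonneg _)

theorem IsL2Process.ae_integrable (hX : IsL2Process P X) (hh : Integrable h) :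
    ∀ᵐ ω ∂P, Integrable fun t => h t * X t ω := by
  have := (hX.integrable_prod (memLp_const (1 : ℝ)) hh).prod_left_ae
  simpa [Function.uncurry] using this

theorem IsL2Process.integral_mul_eq (hX : IsL2Process P X) (hY : MemLp Y 2 P)
    (hh : Integrable h) :
    ∫ ω, (∫ t, h t * X t ω) * Y ω ∂P = ∫ t, h t * ∫ ω, X t ω * Y ω ∂P := by
  have := integral_integral_swap (hX.integrable_prod hY hh)
  simp_rw [mul_assoc, integral_const_mul] at this
  rw [this]
  congr 1; ext ω
  rw [← integral_mul_const]
  simp_rw [mul_assoc]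

/-- Writing |h X| = √|h| · (√|h| |X|), Cauchy–Schwarz in time bounds the square by ‖h‖₁ ∫ |h| X²;
taking expectations under the integral costs another factor ‖h‖₁. -/
theorem IsL2Process.sq_integral_le (hX : IsL2Process P X) (hh : Integrable h) {C : ℝ}
    (hC : ∀ t, ∫ ω, X t ω ^ 2 ∂P ≤ C) :
    MemLp (fun ω => ∫ t, h t * X t ω) 2 P ∧
      ∫ ω, (∫ t, h t * X t ω) ^ 2 ∂P ≤ (∫ t, |h t|) ^ 2 * C := by
  have hmX : AEStronglyMeasurable (Function.uncurry fun t ω => h t * X t ω)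
      ((volume : Measure ℝ).prod P) :=
    hh.aestronglyMeasurable.comp_fst.mul hX.measurable.aestronglyMeasurable
  have hm : AEStronglyMeasurable (fun ω => ∫ t, h t * X t ω) P :=
    hmX.prod_swap.integral_prod_right'
  -- the weighted squares are integrable on the product
  have hm2 : AEStronglyMeasurable (Function.uncurry fun t ω => |h t| * X t ω ^ 2)
      ((volume : Measure ℝ).prod P) :=
    (hh.aestronglyMeasurable.norm.comp_fst).mul (hX.measurable.pow_const 2).aestronglyMeasurable
  have hi2 : Integrable (Function.uncurry fun t ω => |h t| * X t ω ^ 2)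
      ((volume : Measure ℝ).prod P) := by
    rw [integrable_prod_iff hm2]
    constructor
    · exact ae_of_all _ fun t => (hX.memLp t).integrable_sq.const_mul |h t|
    · refine (hh.abs.mul_const C).mono' hm2.norm.integral_prod_right' (ae_of_all _ fun t => ?_)
      have e : ∫ ω, ‖Function.uncurry (fun t ω => |h t| * X t ω ^ 2) (t, ω)‖ ∂P
          = |h t| * ∫ ω, X t ω ^ 2 ∂P := by
        rw [← integral_const_mul]
        congr 1; ext ω
        simp [Function.uncurry]
      rw [e, Real.norm_of_nonneg (mul_nonneg (abs_nonneg _) (integral_nonneg fun _ => sq_nonneg _))]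
      exact mul_le_mul_of_nonneg_left (hC t) (abs_nonneg _)
  have hi3 : Integrable (fun ω => (∫ t, |h t|) * ∫ t, |h t| * X t ω ^ 2) P :=
    hi2.integral_prod_right.const_mul _
  have hle : ∀ᵐ ω ∂P, (∫ t, h t * X t ω) ^ 2 ≤ (∫ t, |h t|) * ∫ t, |h t| * X t ω ^ 2 := by
    filter_upwards [hi2.prod_left_ae] with ω hω
    have hω' : Integrable fun t => |h t| * X t ω ^ 2 := hω
    have mX : Measurable fun t => X t ω := hX.measurable.comp measurable_prodMk_right
    have m1 : AEStronglyMeasurable (fun t => √|h t|) volume :=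
      Real.continuous_sqrt.comp_aestronglyMeasurable hh.aestronglyMeasurable.norm
    have l1 : MemLp (fun t => √|h t|) 2 volume := by
      rw [memLp_two_iff_integrable_sq m1]
      simpa [Real.sq_sqrt (abs_nonneg _)] using hh.abs
    have l2 : MemLp (fun t => √|h t| * |X t ω|) 2 volume := by
      have m2 : AEStronglyMeasurable (fun t => √|h t| * |X t ω|) volume :=
        m1.mul mX.aestronglyMeasurable.norm
      rw [memLp_two_iff_integrable_sq m2]
      simpa [mul_pow, Real.sq_sqrt (abs_nonneg _)] using hω'
    have cs := sq_integral_mul_le l1 l2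
    simp only [mul_pow, Real.sq_sqrt (abs_nonneg _), sq_abs] at cs
    refine le_trans ?_ cs
    rw [← sq_abs]
    refine pow_le_pow_left₀ (abs_nonneg _) ?_ 2
    refine abs_integral_le_integral_abs.trans (le_of_eq ?_)
    congr 1; ext t
    rw [← mul_assoc, Real.mul_self_sqrt (abs_nonneg _), abs_mul]
  have hi : Integrable (fun ω => (∫ t, h t * X t ω) ^ 2) P :=
    hi3.mono' (hm.pow 2) (hle.mono fun ω hω => by
      rw [Real.norm_of_nonneg (sq_nonneg _)]; exact hω)
  refine ⟨(memLp_two_iff_integrable_sq hm).2 hi, (integral_mono_ae hi hi3 hle).trans ?_⟩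
  rw [integral_const_mul, sq, mul_assoc]
  refine mul_le_mul_of_nonneg_left ?_ (integral_nonneg fun _ => abs_nonneg _)
  rw [← integral_integral_swap hi2, ← integral_mul_const]
  simp_rw [integral_const_mul]
  refine integral_mono_of_nonneg (ae_of_all _ fun t =>
    mul_nonneg (abs_nonneg _) (integral_nonneg fun _ => sq_nonneg _)) (hh.abs.mul_const C)
    (ae_of_all _ fun t => mul_le_mul_of_nonneg_left (hC t) (abs_nonneg _))

theorem IsL2Process.memLp_integral (hX : IsL2Process P X) (hh : Integrable h) :
    MemLp (fun ω => ∫ t, h t * X t ω) 2 P := by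
  obtain ⟨C, hC⟩ := hX.bounded
  exact (hX.sq_integral_le hh hC).1

/-- Convolutions of an `L²`-bounded process with integrable kernels are `L²`-bounded processes. -/
theorem IsL2Process.conv (hX : IsL2Process P X) (hh : Integrable h) :
    IsL2Process P fun t ω => ∫ s, h s * X (t - s) ω := by
  obtain ⟨C, hC⟩ := hX.bounded
  refine ⟨?_, fun t => (hX.comp_const_sub t).memLp_integral hh, (∫ t, |h t|) ^ 2 * C,
    fun t => ((hX.comp_const_sub t).sq_integral_le hh fun s => hC _).2⟩
  -- Joint measurability is required outright, not up to null sets. Replacing h by a strongly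
  -- measurable representative does not change the integral at any point (t, ω).
  set k := hh.aestronglyMeasurable.mk h
  have hk : StronglyMeasurable k := hh.aestronglyMeasurable.stronglyMeasurable_mk
  have e : (Function.uncurry fun t ω => ∫ s, h s * X (t - s) ω)
      = fun z : ℝ × Ω => ∫ s, k s * X (z.1 - s) z.2 := by
    ext z
    refine integral_congr_ae ?_
    filter_upwards [hh.aestronglyMeasurable.ae_eq_mk] with s hs
    rw [hs]
  rw [e]
  have hm : Measurable fun q : (ℝ × Ω) × ℝ => k q.2 * X (q.1.1 - q.2) q.1.2 :=
    (hk.measurable.comp measurable_snd).mul (hX.measurable.comp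
      ((measurable_fst.fst.sub measurable_snd).prodMk measurable_fst.snd))
  exact (hm.stronglyMeasurable.integral_prod_right').measurable

end SecondOrder
end GLE

namespace GLE

/-! ### Continuity of the L² pairing -/

section Limits

variable {X : Type*} [MeasurableSpace X] {μ : Measure X} {ι : Type*} {l : Filter ι}

/-- The integral of the product is the inner product of the L² classes, which is jointly continuous.
-/
theorem tendsto_integral_mul {f g : ι → X → ℝ} {f₀ g₀ : X → ℝ} (hf : ∀ n, MemLp (f n) 2 μ)
    (hg : ∀ n, MemLp (g n) 2 μ) (hf₀ : MemLp f₀ 2 μ) (hg₀ : MemLp g₀ 2 μ)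
    (lf : Tendsto (fun n => eLpNorm (f n - f₀) 2 μ) l (𝓝 0))
    (lg : Tendsto (fun n => eLpNorm (g n - g₀) 2 μ) l (𝓝 0)) :
    Tendsto (fun n => ∫ x, f n x * g n x ∂μ) l (𝓝 (∫ x, f₀ x * g₀ x ∂μ)) := by
  have e : ∀ {f g : X → ℝ} (hf : MemLp f 2 μ) (hg : MemLp g 2 μ),
      inner ℝ (hf.toLp f) (hg.toLp g) = ∫ x, f x * g x ∂μ := fun {f g} hf hg => by
    rw [L2.inner_def]
    refine integral_congr_ae ?_
    filter_upwards [hf.coeFn_toLp, hg.coeFn_toLp] with x h1 h2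
    rw [h1, h2]
    simp [mul_comm]
  have h1 := (Lp.tendsto_Lp_iff_tendsto_eLpNorm'' f hf f₀ hf₀).2 lf
  have h2 := (Lp.tendsto_Lp_iff_tendsto_eLpNorm'' g hg g₀ hg₀).2 lg
  have := h1.inner (𝕜 := ℝ) h2
  simpa only [e] using this

end Limits

variable {d : ℕ}

section DotProduct

variable {X : Type*} [MeasurableSpace X] {μ : Measure X}

theorem memLp_component {f : X → Fin d → ℝ} (hf : MemLp f 2 μ) (i : Fin d) :
    MemLp (fun x => f x i) 2 μ := memLp_pi_iff.1 hf i

theorem eLpNorm_component_le (f : X → Fin d → ℝ) (i : Fin d) :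
    eLpNorm (fun x => f x i) 2 μ ≤ eLpNorm f 2 μ :=
  eLpNorm_mono fun x => norm_le_pi_norm (f x) i

theorem integrable_dotProduct {f g : X → Fin d → ℝ} (hf : MemLp f 2 μ) (hg : MemLp g 2 μ) :
    Integrable (fun x => f x ⬝ᵥ g x) μ :=
  integrable_finsetSum _ fun i _ =>
    integrable_mul_of_memLp (memLp_component hf i) (memLp_component hg i)

theorem integral_dotProduct {f g : X → Fin d → ℝ} (hf : MemLp f 2 μ) (hg : MemLp g 2 μ) :
    ∫ x, f x ⬝ᵥ g x ∂μ = ∑ i, ∫ x, f x i * g x i ∂μ :=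
  integral_finsetSum _ fun i _ =>
    integrable_mul_of_memLp (memLp_component hf i) (memLp_component hg i)

theorem tendsto_integral_dotProduct {ι : Type*} {l : Filter ι} {f g : ι → X → Fin d → ℝ}
    {f₀ g₀ : X → Fin d → ℝ} (hf : ∀ n, MemLp (f n) 2 μ)
    (hg : ∀ n, MemLp (g n) 2 μ) (hf₀ : MemLp f₀ 2 μ) (hg₀ : MemLp g₀ 2 μ)
    (lf : Tendsto (fun n => eLpNorm (f n - f₀) 2 μ) l (𝓝 0))
    (lg : Tendsto (fun n => eLpNorm (g n - g₀) 2 μ) l (𝓝 0)) :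
    Tendsto (fun n => ∫ x, f n x ⬝ᵥ g n x ∂μ) l (𝓝 (∫ x, f₀ x ⬝ᵥ g₀ x ∂μ)) := by
  simp_rw [fun n => integral_dotProduct (hf n) (hg n), integral_dotProduct hf₀ hg₀]
  refine tendsto_finsetSum _ fun i _ => tendsto_integral_mul
    (fun n => memLp_component (hf n) i) (fun n => memLp_component (hg n) i)
    (memLp_component hf₀ i) (memLp_component hg₀ i) ?_ ?_
  · exact tendsto_of_tendsto_of_tendsto_of_le_of_le tendsto_const_nhds lf
      (fun _ => zero_le) fun n => eLpNorm_component_le (f n - f₀) i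
  · exact tendsto_of_tendsto_of_tendsto_of_le_of_le tendsto_const_nhds lg
      (fun _ => zero_le) fun n => eLpNorm_component_le (g n - g₀) i

end DotProduct

/-! ### Density of step functions -/

section Step

theorem StepData.memLp_toFun (S : StepData d) : MemLp S.toFun 2 volume := by
  have : S.toFun = fun t => ∑ k, (Ioc (S.left k) (S.right k)).indicator (fun _ => S.coef k) t := rfl
  rw [this]
  exact memLp_finsetSum _ fun k _ =>
    memLp_indicator_const 2 measurableSet_Ioc _ (Or.inr (by simp))

/-- The step data of the right-endpoint interpolation of `g` with mesh `1 / n` on `(-N, N]`. -/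
noncomputable def gridStep (g : ℝ → Fin d → ℝ) (N n : ℕ) : StepData d where
  n := 2 * N * n
  left k := -N + k / n
  right k := -N + (k + 1) / n
  le k := by gcongr; simp
  coef k := g (-N + (k + 1) / n)

theorem gridStep_apply_of_notMem (g : ℝ → Fin d → ℝ) {N n : ℕ} (hn : 0 < n) {t : ℝ}
    (ht : t ∉ Ioc (-N : ℝ) N) : (gridStep g N n).toFun t = 0 := by
  have hn' : (0 : ℝ) < n := by exact_mod_cast hn
  refine Finset.sum_eq_zero fun k _ => indicator_of_notMem (fun hk => ht ?_) _
  have h1 : (-N + (k : ℕ) / n : ℝ) < t := hk.1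
  have h2 : t ≤ (-N + ((k : ℕ) + 1) / n : ℝ) := hk.2
  have h3 : ((k : ℕ) + 1 : ℝ) ≤ 2 * N * n := by exact_mod_cast k.2
  have h4 : ((k : ℕ) + 1 : ℝ) / n ≤ 2 * N := by rw [div_le_iff₀ hn']; exact h3
  have h5 : (0 : ℝ) ≤ (k : ℕ) / n := by positivity
  exact ⟨by linarith, by linarith⟩

theorem gridStep_apply_of_mem (g : ℝ → Fin d → ℝ) {N n : ℕ} (hn : 0 < n) {t : ℝ}
    (ht : t ∈ Ioc (-N : ℝ) N) :
    ∃ u, |t - u| ≤ 1 / n ∧ (gridStep g N n).toFun t = g u := by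
  have hn' : (0 : ℝ) < n := by exact_mod_cast hn
  have hx0 : 0 < (t + N) * n := mul_pos (by linarith [ht.1]) hn'
  -- The cells are open on the left and closed on the right, so the cell containing t has index one
  -- less than the ceiling.
  obtain ⟨m, hm⟩ : ∃ m, ⌈(t + N) * n⌉₊ = m + 1 :=
    ⟨_, (Nat.succ_pred_eq_of_pos (Nat.ceil_pos.2 hx0)).symm⟩
  obtain ⟨h1, h2⟩ := (Nat.ceil_eq_iff (by omega)).1 hm
  simp only [Nat.add_sub_cancel] at h1
  push_cast at h2
  have hml : m < 2 * N * n := by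
    have : ((m : ℕ) : ℝ) < (2 * N * n : ℕ) := by
      push_cast
      refine h1.trans_le ?_
      have : (t + N) ≤ 2 * N := by linarith [ht.2]
      gcongr
    exact_mod_cast this
  have a1 : (m : ℝ) / n < t + N := by rwa [div_lt_iff₀ hn']
  have a2 : t + N ≤ ((m : ℝ) + 1) / n := by rwa [le_div_iff₀ hn']
  refine ⟨-N + (m + 1) / n, ?_, ?_⟩
  · have : ((m : ℝ) + 1) / n = m / n + 1 / n := by ring
    rw [abs_le]; constructor <;> linarith
  · refine (Finset.sum_eq_single (⟨m, hml⟩ : Fin (2 * N * n)) (fun k _ hk => ?_)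
      fun h => absurd (Finset.mem_univ _) h).trans ?_
    · refine indicator_of_notMem (fun hk' => hk ?_) _
      have b1 : (-N + (k : ℕ) / n : ℝ) < t := hk'.1
      have b2 : t ≤ (-N + ((k : ℕ) + 1) / n : ℝ) := hk'.2
      have c1 : ((k : ℕ) : ℝ) / n < (m + 1) / n := by linarith
      have c2 : (m : ℝ) / n < ((k : ℕ) + 1) / n := by linarith
      rw [div_lt_div_iff_of_pos_right hn'] at c1 c2
      have d1 : (k : ℕ) < m + 1 := by exact_mod_cast c1
      have d2 : m < (k : ℕ) + 1 := by exact_mod_cast c2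
      exact Fin.ext (by simp only; omega)
    · refine indicator_of_mem ?_ _
      exact ⟨by simp only [gridStep]; linarith, by simp only [gridStep]; linarith⟩

/-- Step functions are dense in `L²(ℝ; ℝᵈ)`. -/
theorem exists_stepData_eLpNorm_sub_le {f : ℝ → Fin d → ℝ} (hf : MemLp f 2 volume) {ε : ℝ}
    (hε : 0 < ε) : ∃ S : StepData d, eLpNorm (f - S.toFun) 2 volume ≤ ENNReal.ofReal ε := by
  obtain ⟨g, hgs, hfg, hgc, hgm⟩ := hf.exists_hasCompactSupport_eLpNorm_sub_le (by simp)
    (ENNReal.ofReal_pos.2 (half_pos hε)).ne'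
  obtain ⟨N, hN⟩ : ∃ N : ℕ, ∀ t, t ∉ Ioc (-N : ℝ) N → g t = 0 := by
    obtain ⟨B, hB⟩ := hgs.isCompact.isBounded.subset_closedBall 0
    obtain ⟨N, hN⟩ := exists_nat_gt B
    refine ⟨N, fun t ht => ?_⟩
    by_contra hne
    have h1 := hB (subset_tsupport g hne)
    rw [mem_closedBall_zero_iff, Real.norm_eq_abs, abs_le] at h1
    exact ht ⟨by linarith, by linarith⟩
  -- A uniform error η on an interval of length 2N has L² norm η √(2N), at most ε / 2; the added 1
  -- keeps the denominator positive when N = 0.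
  set η : ℝ := ε / 2 / (√(2 * N) + 1) with hη
  have hη0 : 0 < η := by positivity
  obtain ⟨δ, hδ, hu⟩ := Metric.uniformContinuous_iff.1
    (hgs.uniformContinuous_of_continuous hgc) η hη0
  obtain ⟨n, hn⟩ := exists_nat_one_div_lt hδ
  refine ⟨gridStep g N (n + 1), ?_⟩
  have hb : ∀ t, ‖(g - (gridStep g N (n + 1)).toFun) t‖
      ≤ ‖(Ioc (-N : ℝ) N).indicator (fun _ => η) t‖ := fun t => by
    by_cases ht : t ∈ Ioc (-N : ℝ) N
    · obtain ⟨u, hu1, hu2⟩ := gridStep_apply_of_mem g n.succ_pos ht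
      rw [Pi.sub_apply, hu2, indicator_of_mem ht, ← dist_eq_norm, Real.norm_of_nonneg hη0.le]
      refine (hu ?_).le
      rw [Real.dist_eq]
      refine hu1.trans_lt ?_
      push_cast
      exact hn
    · rw [Pi.sub_apply, hN t ht, gridStep_apply_of_notMem g n.succ_pos ht]
      simp
  have h2 : eLpNorm (g - (gridStep g N (n + 1)).toFun) 2 volume ≤ ENNReal.ofReal (ε / 2) := by
    refine (eLpNorm_mono hb).trans ?_
    rw [eLpNorm_indicator_const measurableSet_Ioc (by simp) (by simp), Real.volume_Ioc,
      Real.enorm_eq_ofReal hη0.le, ENNReal.ofReal_rpow_of_nonneg (by linarith [N.cast_nonneg (α := ℝ)])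
      (by simp), ← ENNReal.ofReal_mul hη0.le]
    refine ENNReal.ofReal_le_ofReal ?_
    have e : ((N : ℝ) - -N) ^ (1 / (2 : ℝ≥0∞).toReal) = √(2 * N) := by
      rw [Real.sqrt_eq_rpow]
      norm_num
      ring_nf
    rw [e, hη, div_mul_eq_mul_div, div_le_iff₀ (by positivity)]
    gcongr
    linarith
  have hsum : f - (gridStep g N (n + 1)).toFun = (f - g) + (g - (gridStep g N (n + 1)).toFun) := by
    abel
  rw [hsum]
  refine (eLpNorm_add_le (hf.1.sub hgm.1) (hgm.1.sub (StepData.memLp_toFun _).1) (by simp)).trans ?_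
  refine (add_le_add hfg h2).trans ?_
  rw [← ENNReal.ofReal_add (by positivity) (by positivity), add_halves]

end Step
end GLE

namespace GLE

variable {Ω : Type*} [MeasurableSpace Ω] {P : Measure Ω} [IsProbabilityMeasure P] {d : ℕ}

/-! ### Covariances of Brownian increments -/

section Increments

variable {W W' : ℝ → Ω → Fin d → ℝ}

theorem IsTwoSidedBrownian.memLp_increment (hW : IsTwoSidedBrownian P W) {a b : ℝ} (hab : a ≤ b)
    (i : Fin d) : MemLp (fun ω => W b ω i - W a ω i) 2 P := by
  have h := (hW.law a b hab)
  have h1 : MemLp (fun x : Fin d → ℝ => x i) 2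
      (Measure.pi fun _ : Fin d => gaussianReal 0 (b - a).toNNReal) :=
    (memLp_id_gaussianReal' 2 (by simp)).comp_measurePreserving (measurePreserving_eval _ i)
  rw [← h.map_eq] at h1
  exact (memLp_map_measure_iff h1.1 h.aemeasurable).1 h1

theorem IsTwoSidedBrownian.integral_increment (hW : IsTwoSidedBrownian P W) {a b : ℝ}
    (hab : a ≤ b) (i : Fin d) : ∫ ω, (W b ω i - W a ω i) ∂P = 0 := by
  have h := (hW.law a b hab).integral_comp (f := fun x : Fin d → ℝ => x i)
    (measurable_pi_apply i).aestronglyMeasurable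
  have h2 := (measurePreserving_eval (fun _ : Fin d => gaussianReal 0 (b - a).toNNReal) i).hasLaw
    |>.integral_comp (f := fun x : ℝ => x) measurable_id.aestronglyMeasurable
  rw [integral_id_gaussianReal] at h2
  exact h.trans h2

theorem integral_mul_pi_gaussianReal (v : ℝ≥0) (i j : Fin d) :
    ∫ x : Fin d → ℝ, x i * x j ∂(Measure.pi fun _ : Fin d => gaussianReal 0 v)
      = if i = j then (v : ℝ) else 0 := by
  have ev : ∀ i, ∫ x : Fin d → ℝ, x i ∂(Measure.pi fun _ : Fin d => gaussianReal 0 v) = 0 :=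
    fun i => by
      have h2 := (measurePreserving_eval (fun _ : Fin d => gaussianReal 0 v) i).hasLaw
        |>.integral_comp (f := fun x : ℝ => x) measurable_id.aestronglyMeasurable
      rw [integral_id_gaussianReal] at h2
      exact h2
  split_ifs with hij
  · subst hij
    have h2 := (measurePreserving_eval (fun _ : Fin d => gaussianReal 0 v) i).hasLaw
      |>.integral_comp (f := fun x : ℝ => x * x)
        (measurable_id.mul measurable_id).aestronglyMeasurable
    refine h2.trans ?_
    have h3 := variance_of_integral_eq_zero (X := fun x : ℝ => x) (μ := gaussianReal 0 v)
      measurable_id.aemeasurable integral_id_gaussianReal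
    rw [variance_fun_id_gaussianReal] at h3
    rw [h3]
    congr 1; ext x; ring
  · have hind : iIndepFun (fun (k : Fin d) (x : Fin d → ℝ) => x k)
        (Measure.pi fun _ : Fin d => gaussianReal 0 v) :=
      iIndepFun_pi (X := fun _ x => x) fun _ => measurable_id.aemeasurable
    rw [(hind.indepFun hij).integral_fun_mul_eq_mul_integral
      (measurable_pi_apply i).aestronglyMeasurable (measurable_pi_apply j).aestronglyMeasurable,
      ev, zero_mul]

theorem IsTwoSidedBrownian.integral_increment_mul_self (hW : IsTwoSidedBrownian P W) {a b : ℝ}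
    (hab : a ≤ b) (i j : Fin d) :
    ∫ ω, (W b ω i - W a ω i) * (W b ω j - W a ω j) ∂P = if i = j then b - a else 0 := by
  have h := (hW.law a b hab).integral_comp (f := fun x : Fin d → ℝ => x i * x j)
    ((measurable_pi_apply i).mul (measurable_pi_apply j)).aestronglyMeasurable
  refine h.trans ?_
  rw [integral_mul_pi_gaussianReal, Real.coe_toNNReal _ (sub_nonneg.2 hab)]

theorem IsTwoSidedBrownian.integral_increment_mul_of_le (hW : IsTwoSidedBrownian P W)
    {a b c : ℝ} (hab : a ≤ b) (hbc : b ≤ c) (i j : Fin d) :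
    ∫ ω, (W b ω i - W a ω i) * (W c ω j - W b ω j) ∂P = 0 := by
  have h := (hW.indep.indepFun_sub_sub hab hbc).comp (measurable_pi_apply i)
    (measurable_pi_apply j)
  have h2 := h.integral_mul_eq_mul_integral (hW.memLp_increment hab i).1
    (hW.memLp_increment hbc j).1
  have h3 : ∫ ω, ((fun x : Fin d → ℝ => x i) ∘ (W b - W a)) ω ∂P = 0 :=
    hW.integral_increment hab i
  rw [h3, zero_mul] at h2
  exact h2

/-- Covariance of the motion started at `N`. -/
theorem IsTwoSidedBrownian.integral_started_mul (hW : IsTwoSidedBrownian P W) {N s t : ℝ}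
    (hs : N ≤ s) (ht : N ≤ t) (i j : Fin d) :
    ∫ ω, (W s ω i - W N ω i) * (W t ω j - W N ω j) ∂P = if i = j then min s t - N else 0 := by
  wlog hst : s ≤ t generalizing s t i j with H
  · have := H ht hs j i (le_of_not_ge hst)
    simp_rw [mul_comm (W t _ j - _)] at this
    rw [this, min_comm]
    simp only [eq_comm]
  have e : ∀ ω, (W s ω i - W N ω i) * (W t ω j - W N ω j)
      = (W s ω i - W N ω i) * (W s ω j - W N ω j)
        + (W s ω i - W N ω i) * (W t ω j - W s ω j) := fun ω => by ring
  simp_rw [e]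
  rw [integral_add (integrable_mul_of_memLp (hW.memLp_increment hs i) (hW.memLp_increment hs j))
    (integrable_mul_of_memLp (hW.memLp_increment hs i) (hW.memLp_increment hst j)),
    hW.integral_increment_mul_self hs, hW.integral_increment_mul_of_le hs hst, min_eq_left hst,
    add_zero]

/-- The combination of minima is the one obtained by expanding a product of two Brownian increments,
so the covariance of increments becomes the L² pairing of their indicators. -/
theorem integral_indicator_mul_indicator {a b c e : ℝ} (hab : a ≤ b) (hce : c ≤ e) :
    ∫ t, (Ioc a b).indicator (fun _ => (1 : ℝ)) t * (Ioc c e).indicator (fun _ => (1 : ℝ)) t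
      = min b e + min a c - min b c - min a e := by
  have h : ∀ t, (Ioc a b).indicator (fun _ => (1 : ℝ)) t * (Ioc c e).indicator (fun _ => (1 : ℝ)) t
      = (Ioc a b ∩ Ioc c e).indicator (fun _ => (1 : ℝ)) t := fun t => by
    rw [← inter_indicator_mul]; simp
  simp_rw [h]
  rw [Ioc_inter_Ioc, integral_indicator_const _ measurableSet_Ioc, Real.volume_real_Ioc, smul_eq_mul,
    mul_one]
  rcases le_total a c with h1 | h1 <;> rcases le_total b e with h2 | h2 <;>
    rcases le_total b c with h3 | h3 <;> rcases le_total a e with h4 | h4 <;>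
    simp only [max_def, min_def] <;> split_ifs <;> linarith

/-- `W` and `W'` are families with square integrable centred increments, whose covariances are `κ`
times those of white noise. -/
structure HasNoiseCovariance (P : Measure Ω) (W W' : ℝ → Ω → Fin d → ℝ) (κ : ℝ) : Prop where
  memLp_left : ∀ {a b}, a ≤ b → ∀ i, MemLp (fun ω => W b ω i - W a ω i) 2 P
  memLp_right : ∀ {a b}, a ≤ b → ∀ i, MemLp (fun ω => W' b ω i - W' a ω i) 2 P
  covariance : ∀ {a b c e}, a ≤ b → c ≤ e → ∀ i j,
    ∫ ω, (W b ω i - W a ω i) * (W' e ω j - W' c ω j) ∂P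
      = κ * if i = j then ∫ t, (Ioc a b).indicator (fun _ => (1 : ℝ)) t
          * (Ioc c e).indicator (fun _ => (1 : ℝ)) t else 0

theorem IsTwoSidedBrownian.hasNoiseCovariance (hW : IsTwoSidedBrownian P W) :
    HasNoiseCovariance P W W 1 := by
  refine ⟨fun h => hW.memLp_increment h, fun h => hW.memLp_increment h,
    fun {a b c e} hab hce i j => ?_⟩
  rw [integral_indicator_mul_indicator hab hce, one_mul]
  -- Restarting the motion at a time to the left of both intervals makes every covariance in the
  -- expansion equal to min s t - N; the four copies of N cancel.
  set N := min a c with hN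
  have hNa : N ≤ a := min_le_left _ _
  have hNc : N ≤ c := min_le_right _ _
  have hNb := hNa.trans hab
  have hNe := hNc.trans hce
  have e1 : ∀ ω, (W b ω i - W a ω i) * (W e ω j - W c ω j)
      = (W b ω i - W N ω i) * (W e ω j - W N ω j) + (W a ω i - W N ω i) * (W c ω j - W N ω j)
        - (W b ω i - W N ω i) * (W c ω j - W N ω j)
        - (W a ω i - W N ω i) * (W e ω j - W N ω j) := fun ω => by ring
  have int : ∀ {s t}, N ≤ s → N ≤ t →
      Integrable (fun ω => (W s ω i - W N ω i) * (W t ω j - W N ω j)) P := fun hs ht =>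
    integrable_mul_of_memLp (hW.memLp_increment hs i) (hW.memLp_increment ht j)
  have i1 : Integrable (fun ω => (W b ω i - W N ω i) * (W e ω j - W N ω j)
      + (W a ω i - W N ω i) * (W c ω j - W N ω j)) P := (int hNb hNe).add (int hNa hNc)
  have i2 : Integrable (fun ω => (W b ω i - W N ω i) * (W e ω j - W N ω j)
      + (W a ω i - W N ω i) * (W c ω j - W N ω j)
      - (W b ω i - W N ω i) * (W c ω j - W N ω j)) P := i1.sub (int hNb hNc)
  simp_rw [e1]
  rw [integral_sub i2 (int hNa hNe), integral_sub i1 (int hNb hNc),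
    integral_add (int hNb hNe) (int hNa hNc), hW.integral_started_mul hNb hNe,
    hW.integral_started_mul hNa hNc, hW.integral_started_mul hNb hNc,
    hW.integral_started_mul hNa hNe]
  split_ifs
  · ring
  · ring

/-- If the motions coincide, almost sure equality at the two times a and b suffices. If they are
independent, the expectation factorises and the increments are centred. From here on the two cases
differ only in the value of κ. -/
theorem IsCoupling.hasNoiseCovariance {κ : ℝ} (h : IsCoupling P W W' κ)
    (hW : IsTwoSidedBrownian P W) (hW' : IsTwoSidedBrownian P W') :
    HasNoiseCovariance P W' W κ := by
  refine ⟨fun h => hW'.memLp_increment h, fun h => hW.memLp_increment h,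
    fun {a b c e} hab hce i j => ?_⟩
  rcases h with ⟨rfl, h⟩ | ⟨rfl, h⟩
  · rw [← hW.hasNoiseCovariance.covariance hab hce i j]
    refine integral_congr_ae ?_
    filter_upwards [h a, h b] with ω h1 h2
    rw [h1, h2]
  · have h1 := h.symm.comp
      (φ := fun x : ℝ → Fin d → ℝ => x b i - x a i) (ψ := fun x : ℝ → Fin d → ℝ => x e j - x c j)
      (by fun_prop) (by fun_prop)
    have h2 := h1.integral_mul_eq_mul_integral (hW'.memLp_increment hab i).1
      (hW.memLp_increment hce j).1
    have h3 : ∫ ω, ((fun x : ℝ → Fin d → ℝ => x b i - x a i) ∘ fun ω t => W' t ω) ω ∂P = 0 :=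
      hW'.integral_increment hab i
    rw [h3, zero_mul] at h2
    rw [zero_mul]
    exact h2

end Increments

/-! ### The Wiener integral and the Itô isometry -/

section WienerIntegral

variable {W W' : ℝ → Ω → Fin d → ℝ} {κ : ℝ}

theorem memLp_step_integral
    (hW : ∀ {a b}, a ≤ b → ∀ i, MemLp (fun ω => W b ω i - W a ω i) 2 P) (S : StepData d) :
    MemLp (S.integral W) 2 P :=
  memLp_finsetSum _ fun k _ => memLp_finsetSum _ fun i _ => (hW (S.le k) i).const_mul _

theorem IsTwoSidedBrownian.integral_step_integral (hW : IsTwoSidedBrownian P W) (S : StepData d) :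
    ∫ ω, S.integral W ω ∂P = 0 := by
  have h : ∀ ω, S.integral W ω
      = ∑ k, ∑ i, S.coef k i * (W (S.right k) ω i - W (S.left k) ω i) := fun ω => rfl
  simp_rw [h]
  have hi : ∀ k i, Integrable (fun ω => S.coef k i * (W (S.right k) ω i - W (S.left k) ω i)) P :=
    fun k i => ((hW.memLp_increment (S.le k) i).integrable (by simp)).const_mul _
  rw [integral_finsetSum _ fun k _ => integrable_finsetSum _ fun i _ => hi k i]
  refine Finset.sum_eq_zero fun k _ => ?_
  rw [integral_finsetSum _ fun i _ => hi k i]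
  refine Finset.sum_eq_zero fun i _ => ?_
  rw [integral_const_mul, hW.integral_increment (S.le k), mul_zero]

theorem StepData.toFun_apply (S : StepData d) (t : ℝ) (i : Fin d) :
    S.toFun t i = ∑ k, S.coef k i * (Ioc (S.left k) (S.right k)).indicator (fun _ => (1 : ℝ)) t := by
  simp only [StepData.toFun, Finset.sum_apply]
  refine Finset.sum_congr rfl fun k _ => ?_
  by_cases h : t ∈ Ioc (S.left k) (S.right k)
  · rw [indicator_of_mem h, indicator_of_mem h, mul_one]
  · rw [indicator_of_notMem h, indicator_of_notMem h, mul_zero, Pi.zero_apply]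

theorem memLp_indicator_one (a b : ℝ) :
    MemLp ((Ioc a b).indicator fun _ => (1 : ℝ)) 2 volume :=
  memLp_indicator_const 2 measurableSet_Ioc _ (Or.inr (by simp))

/-- Both sides are bilinear in the steps, which reduces the isometry to single intervals and
components; distinct components are uncorrelated, so only the diagonal survives. -/
theorem HasNoiseCovariance.step_integral (h : HasNoiseCovariance P W W' κ) (S T : StepData d) :
    ∫ ω, S.integral W ω * T.integral W' ω ∂P = κ * ∫ t, S.toFun t ⬝ᵥ T.toFun t := by
  have e1 : ∀ ω, S.integral W ω * T.integral W' ω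
      = ∑ k, ∑ i, ∑ m, ∑ j, S.coef k i * T.coef m j *
        ((W (S.right k) ω i - W (S.left k) ω i) * (W' (T.right m) ω j - W' (T.left m) ω j)) :=
    fun ω => by
      simp only [StepData.integral, dotProduct, Pi.sub_apply]
      simp only [Finset.sum_mul]
      simp only [Finset.mul_sum]
      refine Finset.sum_congr rfl fun k _ => Finset.sum_congr rfl fun i _ =>
        Finset.sum_congr rfl fun m _ => Finset.sum_congr rfl fun j _ => by ring
  have hi : ∀ k i m j, Integrable (fun ω => S.coef k i * T.coef m j *
        ((W (S.right k) ω i - W (S.left k) ω i) * (W' (T.right m) ω j - W' (T.left m) ω j))) P :=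
    fun k i m j => (integrable_mul_of_memLp (h.memLp_left (S.le k) i)
      (h.memLp_right (T.le m) j)).const_mul _
  have e2 : ∀ t, S.toFun t ⬝ᵥ T.toFun t = ∑ k, ∑ i, ∑ m, S.coef k i * T.coef m i *
      ((Ioc (S.left k) (S.right k)).indicator (fun _ => (1 : ℝ)) t *
        (Ioc (T.left m) (T.right m)).indicator (fun _ => (1 : ℝ)) t) := fun t => by
    simp only [dotProduct, StepData.toFun_apply]
    simp only [Finset.sum_mul]
    simp only [Finset.mul_sum]
    rw [Finset.sum_comm]
    refine Finset.sum_congr rfl fun k _ => Finset.sum_congr rfl fun i _ =>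
        Finset.sum_congr rfl fun m _ => by ring
  have hi' : ∀ k i m, Integrable (fun t => S.coef k i * T.coef m i *
      ((Ioc (S.left k) (S.right k)).indicator (fun _ => (1 : ℝ)) t *
        (Ioc (T.left m) (T.right m)).indicator (fun _ => (1 : ℝ)) t)) volume := fun k i m =>
    (integrable_mul_of_memLp (memLp_indicator_one _ _) (memLp_indicator_one _ _)).const_mul _
  simp_rw [e1, e2]
  rw [integral_finsetSum _ fun k _ => integrable_finsetSum _ fun i _ =>
      integrable_finsetSum _ fun m _ => integrable_finsetSum _ fun j _ => hi k i m j,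
    integral_finsetSum _ fun k _ => integrable_finsetSum _ fun i _ =>
      integrable_finsetSum _ fun m _ => hi' k i m, Finset.mul_sum]
  refine Finset.sum_congr rfl fun k _ => ?_
  rw [integral_finsetSum _ fun i _ =>
      integrable_finsetSum _ fun m _ => integrable_finsetSum _ fun j _ => hi k i m j,
    integral_finsetSum _ fun i _ => integrable_finsetSum _ fun m _ => hi' k i m, Finset.mul_sum]
  refine Finset.sum_congr rfl fun i _ => ?_
  rw [integral_finsetSum _ fun m _ => integrable_finsetSum _ fun j _ => hi k i m j,
    integral_finsetSum _ fun m _ => hi' k i m, Finset.mul_sum]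
  refine Finset.sum_congr rfl fun m _ => ?_
  rw [integral_finsetSum _ fun j _ => hi k i m j, integral_const_mul]
  simp_rw [integral_const_mul, h.covariance (S.le k) (T.le m)]
  rw [Finset.sum_eq_single i (fun j _ hj => by rw [if_neg hj.symm]; ring)
    (fun h => absurd (Finset.mem_univ _) h), if_pos rfl]
  ring

/-- Approximating sequences for Wiener integrals. -/
theorem IsWienerIntegral.exists_seq {f : ℝ → Fin d → ℝ} {X : Ω → ℝ}
    (h : IsWienerIntegral P W f X) : ∃ S : ℕ → StepData d,
      Tendsto (fun n => eLpNorm ((S n).toFun - f) 2 volume) atTop (𝓝 0) ∧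
      Tendsto (fun n => eLpNorm ((S n).integral W - X) 2 P) atTop (𝓝 0) := by
  choose S h1 h2 using fun n : ℕ => h.2.2 (1 / (n + 1)) Nat.one_div_pos_of_nat
  have hl : Tendsto (fun n : ℕ => ENNReal.ofReal (1 / ((n : ℝ) + 1))) atTop (𝓝 0) := by
    have := ENNReal.tendsto_ofReal tendsto_one_div_add_atTop_nhds_zero_nat
    simpa using this
  refine ⟨S, ?_, ?_⟩
  · refine tendsto_of_tendsto_of_tendsto_of_le_of_le tendsto_const_nhds hl
      (fun _ => zero_le) fun n => ?_
    rw [eLpNorm_sub_comm]; exact h1 n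
  · refine tendsto_of_tendsto_of_tendsto_of_le_of_le tendsto_const_nhds hl
      (fun _ => zero_le) fun n => ?_
    rw [eLpNorm_sub_comm]; exact h2 n

/-- The Itô isometry, for two (possibly different) noises. -/
theorem HasNoiseCovariance.wienerIntegral (h : HasNoiseCovariance P W W' κ)
    {f g : ℝ → Fin d → ℝ} {X Y : Ω → ℝ} (hX : IsWienerIntegral P W f X)
    (hY : IsWienerIntegral P W' g Y) : ∫ ω, X ω * Y ω ∂P = κ * ∫ t, f t ⬝ᵥ g t := by
  obtain ⟨S, hS1, hS2⟩ := hX.exists_seq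
  obtain ⟨T, hT1, hT2⟩ := hY.exists_seq
  have l1 := tendsto_integral_mul (fun n => memLp_step_integral h.memLp_left (S n))
    (fun n => memLp_step_integral h.memLp_right (T n)) hX.2.1 hY.2.1 hS2 hT2
  have l2 := (tendsto_integral_dotProduct (fun n => (S n).memLp_toFun)
    (fun n => (T n).memLp_toFun) hX.1 hY.1 hS1 hT1).const_mul κ
  simp_rw [h.step_integral] at l1
  exact tendsto_nhds_unique l1 l2

theorem IsTwoSidedBrownian.integral_wienerIntegral (hW : IsTwoSidedBrownian P W)
    {f : ℝ → Fin d → ℝ} {X : Ω → ℝ} (hX : IsWienerIntegral P W f X) : ∫ ω, X ω ∂P = 0 := by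
  obtain ⟨S, -, hS2⟩ := hX.exists_seq
  have l1 := tendsto_integral_mul
    (fun n => memLp_step_integral (fun h => hW.memLp_increment h) (S n))
    (fun _ => memLp_const (1 : ℝ)) hX.2.1 (memLp_const (1 : ℝ)) hS2 (by simp)
  simp_rw [mul_one, hW.integral_step_integral] at l1
  exact tendsto_nhds_unique l1 tendsto_const_nhds

/-- If all E(Yₙ Yₘ) tend to one number L, then ‖Yₙ - Yₘ‖² tends to L - 2L + L = 0. This Cauchy
criterion avoids forming differences of step data. -/
theorem exists_limit_of_tendsto_integral_mul {Y : ℕ → Ω → ℝ} (hm : ∀ n, MemLp (Y n) 2 P) {L : ℝ}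
    (h : Tendsto (fun p : ℕ × ℕ => ∫ ω, Y p.1 ω * Y p.2 ω ∂P) atTop (𝓝 L)) :
    ∃ X : Ω → ℝ, MemLp X 2 P ∧ Tendsto (fun n => eLpNorm (Y n - X) 2 P) atTop (𝓝 0) := by
  have hinner : ∀ n m, inner ℝ ((hm n).toLp (Y n)) ((hm m).toLp (Y m))
      = ∫ ω, Y n ω * Y m ω ∂P := fun n m => by
    rw [L2.inner_def]
    refine integral_congr_ae ?_
    filter_upwards [(hm n).coeFn_toLp, (hm m).coeFn_toLp] with ω h1 h2
    rw [h1, h2]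
    simp [mul_comm]
  have hfst : Tendsto (fun p : ℕ × ℕ => (p.1, p.1)) atTop atTop := by
    rw [← prod_atTop_atTop_eq]; exact tendsto_fst.prodMk tendsto_fst
  have hsnd : Tendsto (fun p : ℕ × ℕ => (p.2, p.2)) atTop atTop := by
    rw [← prod_atTop_atTop_eq]; exact tendsto_snd.prodMk tendsto_snd
  have hlim : Tendsto (fun p : ℕ × ℕ => ‖(hm p.1).toLp (Y p.1) - (hm p.2).toLp (Y p.2)‖ ^ 2)
      atTop (𝓝 0) := by
    have := ((h.comp hfst).sub (h.const_mul 2)).add (h.comp hsnd)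
    have e : ∀ a : ℝ, a - 2 * a + a = 0 := fun a => by ring
    rw [e] at this
    refine this.congr fun p => ?_
    rw [norm_sub_sq_real, ← real_inner_self_eq_norm_sq, ← real_inner_self_eq_norm_sq, hinner,
      hinner, hinner]
    rfl
  have hcau : CauchySeq fun n => (hm n).toLp (Y n) := by
    rw [cauchySeq_iff_tendsto_dist_atTop_0]
    have := (Real.continuous_sqrt.tendsto 0).comp hlim
    rw [Real.sqrt_zero] at this
    refine this.congr fun p => ?_
    rw [Function.comp_apply, Real.sqrt_sq (norm_nonneg _), dist_eq_norm]
  obtain ⟨X, hX⟩ := cauchySeq_tendsto_of_complete hcau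
  refine ⟨fun ω => X ω, Lp.memLp X, ?_⟩
  refine (Lp.tendsto_Lp_iff_tendsto_eLpNorm'' Y hm (fun ω => X ω) (Lp.memLp X)).1 ?_
  have : (Lp.memLp X).toLp (fun ω => X ω) = X := Lp.toLp_coeFn X _
  rw [this]
  exact hX

/-- For step functions tending to f, the isometry turns the correlations of their integrals into L²
pairings, which converge to the pairing of f with itself; the Cauchy criterion supplies the limit.
-/
theorem IsTwoSidedBrownian.exists_isWienerIntegral (hW : IsTwoSidedBrownian P W)
    {f : ℝ → Fin d → ℝ} (hf : MemLp f 2 volume) : ∃ X, IsWienerIntegral P W f X := by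
  choose S hS using fun n : ℕ => exists_stepData_eLpNorm_sub_le hf
    (ε := 1 / ((n : ℝ) + 1)) Nat.one_div_pos_of_nat
  have hl : Tendsto (fun n : ℕ => ENNReal.ofReal (1 / ((n : ℝ) + 1))) atTop (𝓝 0) := by
    have := ENNReal.tendsto_ofReal tendsto_one_div_add_atTop_nhds_zero_nat
    simpa using this
  have hS' : Tendsto (fun n => eLpNorm ((S n).toFun - f) 2 volume) atTop (𝓝 0) := by
    refine tendsto_of_tendsto_of_tendsto_of_le_of_le tendsto_const_nhds hl
      (fun _ => zero_le) fun n => ?_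
    rw [eLpNorm_sub_comm]; exact hS n
  have hfst : Tendsto (fun p : ℕ × ℕ => eLpNorm ((S p.1).toFun - f) 2 volume) atTop (𝓝 0) := by
    rw [← prod_atTop_atTop_eq]; exact hS'.comp tendsto_fst
  have hsnd : Tendsto (fun p : ℕ × ℕ => eLpNorm ((S p.2).toFun - f) 2 volume) atTop (𝓝 0) := by
    rw [← prod_atTop_atTop_eq]; exact hS'.comp tendsto_snd
  have l1 := tendsto_integral_dotProduct (fun p : ℕ × ℕ => (S p.1).memLp_toFun)
    (fun p => (S p.2).memLp_toFun) hf hf hfst hsnd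
  obtain ⟨X, hXm, hX⟩ := exists_limit_of_tendsto_integral_mul
    (fun n => memLp_step_integral (fun h => hW.memLp_increment h) (S n))
    (l1.congr fun p => by rw [hW.hasNoiseCovariance.step_integral, one_mul])
  refine ⟨X, hf, hXm, fun ε hε => ?_⟩
  have hε' := ENNReal.ofReal_pos.2 hε
  obtain ⟨n, h1, h2⟩ := ((hX.eventually (ge_mem_nhds hε')).and
    (hS'.eventually (ge_mem_nhds hε'))).exists
  refine ⟨S n, ?_, ?_⟩
  · rw [eLpNorm_sub_comm]; exact h2
  · rw [eLpNorm_sub_comm]; exact h1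

theorem IsTwoSidedBrownian.isWienerIntegral_wienerIntegral (hW : IsTwoSidedBrownian P W)
    {f : ℝ → Fin d → ℝ} (hf : MemLp f 2 volume) :
    IsWienerIntegral P W f (wienerIntegral P W f) := by
  have h := hW.exists_isWienerIntegral hf
  rw [GLE.wienerIntegral, dif_pos h]
  exact h.choose_spec

/-- Increments are Wiener integrals of indicator functions. -/
theorem IsTwoSidedBrownian.isWienerIntegral_increment (hW : IsTwoSidedBrownian P W) {a b : ℝ}
    (hab : a ≤ b) (j : Fin d) :
    IsWienerIntegral P W (fun t => Pi.single j ((Ioc a b).indicator (fun _ => (1 : ℝ)) t))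
      (fun ω => W b ω j - W a ω j) := by
  let S : StepData d := ⟨1, fun _ => a, fun _ => b, fun _ => hab, fun _ => Pi.single j 1⟩
  have e1 : S.toFun = fun t => Pi.single j ((Ioc a b).indicator (fun _ => (1 : ℝ)) t) := by
    ext t i
    simp only [StepData.toFun_apply, S, Finset.univ_unique, Finset.sum_singleton]
    rcases eq_or_ne i j with rfl | h
    · simp
    · simp [h]
  have e2 : S.integral W = fun ω => W b ω j - W a ω j := by
    ext ω
    simp [StepData.integral, S]
  rw [← e1, ← e2]
  refine ⟨S.memLp_toFun, memLp_step_integral (fun h => hW.memLp_increment h) S, fun ε _ =>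
    ⟨S, by simp, by simp⟩⟩

end WienerIntegral
end GLE

namespace GLE

variable {Ω : Type*} [MeasurableSpace Ω] {P : Measure Ω} [IsProbabilityMeasure P] {d : ℕ}
variable {W W' : ℝ → Ω → Fin d → ℝ}

/-! ### Linearity of the Wiener integral and Riesz representatives -/

section Riesz

theorem IsTwoSidedBrownian.isometry (hW : IsTwoSidedBrownian P W)
    {f g : ℝ → Fin d → ℝ} {X Y : Ω → ℝ} (hX : IsWienerIntegral P W f X)
    (hY : IsWienerIntegral P W g Y) : ∫ ω, X ω * Y ω ∂P = ∫ t, f t ⬝ᵥ g t := by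
  rw [hW.hasNoiseCovariance.wienerIntegral hX hY, one_mul]

/-- The Wiener integral is linear. -/
theorem IsTwoSidedBrownian.wienerIntegral_linear (hW : IsTwoSidedBrownian P W)
    {f g h : ℝ → Fin d → ℝ} {X Y Z : Ω → ℝ} (hX : IsWienerIntegral P W f X)
    (hY : IsWienerIntegral P W g Y) (hZ : IsWienerIntegral P W h Z) {a b : ℝ}
    (hfg : ∀ᵐ t, h t = a • f t + b • g t) : Z =ᵐ[P] fun ω => a * X ω + b * Y ω := by
  -- By the isometry, Z - (a X + b Y) is orthogonal to every Wiener integral. Being a combination of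
  -- three of them, it is orthogonal to itself and vanishes.
  have key : ∀ {k : ℝ → Fin d → ℝ} {T : Ω → ℝ}, IsWienerIntegral P W k T →
      ∫ ω, (Z ω - (a * X ω + b * Y ω)) * T ω ∂P = 0 := fun {k T} hT => by
    have e : ∀ ω, (Z ω - (a * X ω + b * Y ω)) * T ω
        = Z ω * T ω - (a * (X ω * T ω) + b * (Y ω * T ω)) := fun ω => by ring
    have i1 := integrable_mul_of_memLp hZ.2.1 hT.2.1
    have i2 := (integrable_mul_of_memLp hX.2.1 hT.2.1).const_mul a
    have i3 := (integrable_mul_of_memLp hY.2.1 hT.2.1).const_mul b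
    have i4 : Integrable (fun ω => a * (X ω * T ω) + b * (Y ω * T ω)) P := i2.add i3
    have j2 := (integrable_dotProduct hX.1 hT.1).const_mul a
    have j3 := (integrable_dotProduct hY.1 hT.1).const_mul b
    have e2 : ∫ t, h t ⬝ᵥ k t = ∫ t, (a * (f t ⬝ᵥ k t) + b * (g t ⬝ᵥ k t)) := by
      refine integral_congr_ae ?_
      filter_upwards [hfg] with t ht
      rw [ht, add_dotProduct, smul_dotProduct, smul_dotProduct, smul_eq_mul, smul_eq_mul]
    simp_rw [e]
    rw [integral_sub i1 i4, integral_add i2 i3, integral_const_mul, integral_const_mul,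
      hW.isometry hZ hT, hW.isometry hX hT, hW.isometry hY hT, e2, integral_add j2 j3,
      integral_const_mul, integral_const_mul, sub_self]
  have mD : MemLp (fun ω => Z ω - (a * X ω + b * Y ω)) 2 P :=
    hZ.2.1.sub ((hX.2.1.const_mul a).add (hY.2.1.const_mul b))
  have h0 : ∫ ω, (Z ω - (a * X ω + b * Y ω)) ^ 2 ∂P = 0 := by
    have e : ∀ ω, (Z ω - (a * X ω + b * Y ω)) ^ 2 = (Z ω - (a * X ω + b * Y ω)) * Z ω
        - (a * ((Z ω - (a * X ω + b * Y ω)) * X ω) + b * ((Z ω - (a * X ω + b * Y ω)) * Y ω)) :=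
      fun ω => by ring
    have i1 := integrable_mul_of_memLp mD hZ.2.1
    have i2 := (integrable_mul_of_memLp mD hX.2.1).const_mul a
    have i3 := (integrable_mul_of_memLp mD hY.2.1).const_mul b
    have i4 : Integrable (fun ω => a * ((Z ω - (a * X ω + b * Y ω)) * X ω)
      + b * ((Z ω - (a * X ω + b * Y ω)) * Y ω)) P := i2.add i3
    simp_rw [e]
    rw [integral_sub i1 i4, integral_add i2 i3, integral_const_mul, integral_const_mul,
      key hZ, key hX, key hY]
    ring
  rw [integral_eq_zero_iff_of_nonneg (fun _ => sq_nonneg _) mD.integrable_sq] at h0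
  filter_upwards [h0] with ω hω
  have := pow_eq_zero_iff (two_ne_zero) |>.1 hω
  linarith

/-- `y` represents the functional `∫ f dW ↦ E(Y ∫ f dW)`. -/
def IsNoiseRepresentation (P : Measure Ω) (W : ℝ → Ω → Fin d → ℝ) (Y : Ω → ℝ)
    (y : ℝ → Fin d → ℝ) : Prop :=
  MemLp y 2 volume ∧ ∀ f X, IsWienerIntegral P W f X → ∫ ω, X ω * Y ω ∂P = ∫ t, f t ⬝ᵥ y t

theorem IsTwoSidedBrownian.isNoiseRepresentation_wienerIntegral (hW : IsTwoSidedBrownian P W)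
    {f : ℝ → Fin d → ℝ} {X : Ω → ℝ} (hX : IsWienerIntegral P W f X) :
    IsNoiseRepresentation P W X f :=
  ⟨hX.1, fun _ _ hY => hW.isometry hY hX⟩

theorem memLp_ofLp {f : ℝ → EuclideanSpace ℝ (Fin d)} (hf : MemLp f 2 volume) :
    MemLp (fun t => (f t).ofLp) 2 volume :=
  (PiLp.continuousLinearEquiv 2 ℝ (fun _ : Fin d => ℝ)).toContinuousLinearMap.comp_memLp' hf

theorem memLp_toLp {f : ℝ → Fin d → ℝ} (hf : MemLp f 2 volume) :
    MemLp (fun t => WithLp.toLp 2 (f t)) 2 volume :=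
  (PiLp.continuousLinearEquiv 2 ℝ (fun _ : Fin d => ℝ)).symm.toContinuousLinearMap.comp_memLp' hf

theorem inner_eq_integral_dotProduct (F F' : Lp (EuclideanSpace ℝ (Fin d)) 2 (volume : Measure ℝ)) :
    inner ℝ F F' = ∫ t, (F t).ofLp ⬝ᵥ (F' t).ofLp := by
  rw [L2.inner_def]
  congr 1; ext t
  simp [PiLp.inner_apply, dotProduct, mul_comm]

/-- By linearity and the isometry, f ↦ E(Y ∫ f dW) is a bounded functional on L², and the Riesz
theorem represents it. The Euclidean norm on the values is needed for L² to be a Hilbert space. -/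
theorem IsTwoSidedBrownian.exists_isNoiseRepresentation (hW : IsTwoSidedBrownian P W) {Y : Ω → ℝ}
    (hY : MemLp Y 2 P) : ∃ y, IsNoiseRepresentation P W Y y := by
  have hI : ∀ F : Lp (EuclideanSpace ℝ (Fin d)) 2 (volume : Measure ℝ),
      IsWienerIntegral P W (fun t => (F t).ofLp) (wienerIntegral P W fun t => (F t).ofLp) :=
    fun F => hW.isWienerIntegral_wienerIntegral (memLp_ofLp (Lp.memLp F))
  let L : Lp (EuclideanSpace ℝ (Fin d)) 2 (volume : Measure ℝ) →ₗ[ℝ] ℝ :=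
    { toFun := fun F => ∫ ω, wienerIntegral P W (fun t => (F t).ofLp) ω * Y ω ∂P
      map_add' := fun F F' => by
        have h := hW.wienerIntegral_linear (hI F) (hI F') (hI (F + F')) (a := 1) (b := 1) (by
          filter_upwards [Lp.coeFn_add F F'] with t ht
          rw [ht]; simp)
        rw [← integral_add (integrable_mul_of_memLp (hI F).2.1 hY)
          (integrable_mul_of_memLp (hI F').2.1 hY)]
        refine integral_congr_ae ?_
        filter_upwards [h] with ω hω
        rw [hω]; ring
      map_smul' := fun c F => by
        have h := hW.wienerIntegral_linear (hI F) (hI F) (hI (c • F)) (a := c) (b := 0) (by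
          filter_upwards [Lp.coeFn_smul c F] with t ht
          rw [ht]; simp)
        rw [RingHom.id_apply, smul_eq_mul, ← integral_const_mul]
        refine integral_congr_ae ?_
        filter_upwards [h] with ω hω
        rw [hω]; ring }
  have hL : ∀ F, ‖L F‖ ≤ √(∫ ω, Y ω ^ 2 ∂P) * ‖F‖ := fun F => by
    have h1 := abs_integral_mul_le (hI F).2.1 hY
    have h2 : ∫ ω, wienerIntegral P W (fun t => (F t).ofLp) ω ^ 2 ∂P = ‖F‖ ^ 2 := by
      rw [← real_inner_self_eq_norm_sq, inner_eq_integral_dotProduct, ← hW.isometry (hI F) (hI F)]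
      congr 1; ext ω; ring
    rw [h2, Real.sqrt_sq (norm_nonneg _), mul_comm] at h1
    exact h1
  set y₀ := (InnerProductSpace.toDual ℝ _).symm (L.mkContinuous _ hL) with hy₀
  refine ⟨fun t => (y₀ t).ofLp, memLp_ofLp (Lp.memLp y₀), fun f X hX => ?_⟩
  set F := (memLp_toLp hX.1).toLp _ with hFdef
  have hF : ∀ᵐ t, (F t).ofLp = f t := by
    filter_upwards [(memLp_toLp hX.1).coeFn_toLp] with t ht
    rw [hFdef, ht]
  have h := hW.wienerIntegral_linear (hI F) (hI F) hX (a := 1) (b := 0) (by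
    filter_upwards [hF] with t ht
    rw [ht]; simp)
  have e1 : ∫ ω, X ω * Y ω ∂P = L F := by
    refine integral_congr_ae ?_
    filter_upwards [h] with ω hω
    rw [hω]; ring
  have e2 : L F = inner ℝ y₀ F := by
    rw [hy₀, InnerProductSpace.toDual_symm_apply]; rfl
  rw [e1, e2, inner_eq_integral_dotProduct]
  refine integral_congr_ae ?_
  filter_upwards [hF] with t ht
  rw [ht, dotProduct_comm]

end Riesz

/-! ### Second moments of the coloured force -/

section Force

variable {κ : ℝ} {φ : ℝ → Matrix (Fin d) (Fin d) ℝ} {F₀ : ℝ → Ω → Fin d → ℝ}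

theorem IsFluctuatingForce.integral_colored_mul (hF : IsFluctuatingForce P W W' κ φ F₀) (t s : ℝ)
    (i j : Fin d) : ∫ ω, F₀ t ω i * F₀ s ω j ∂P = ∫ u, φ (t - u) i ⬝ᵥ φ (s - u) j :=
  hF.brownian'.isometry (hF.colored t i) (hF.colored s j)

/-- By the isometry and translation invariance of Lebesgue measure, the second moment does not
depend on t. -/
theorem IsFluctuatingForce.isL2Process (hF : IsFluctuatingForce P W W' κ φ F₀) (i : Fin d) :
    IsL2Process P fun t ω => F₀ t ω i := by
  refine ⟨(measurable_pi_apply i).comp hF.measurable, fun t => (hF.colored t i).2.1,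
    ∫ u, φ u i ⬝ᵥ φ u i, fun t => le_of_eq ?_⟩
  simp_rw [sq]
  rw [hF.integral_colored_mul]
  exact integral_sub_left_eq_self (fun u => φ u i ⬝ᵥ φ u i) volume t

/-- The correlation of the coloured force and a Wiener integral. -/
theorem IsFluctuatingForce.integral_colored_mul_wienerIntegral
    (hF : IsFluctuatingForce P W W' κ φ F₀) (t : ℝ) (i : Fin d) {f : ℝ → Fin d → ℝ} {X : Ω → ℝ}
    (hX : IsWienerIntegral P W f X) :
    ∫ ω, F₀ t ω i * X ω ∂P = κ * ∫ u, φ (t - u) i ⬝ᵥ f u :=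
  (hF.coupling.hasNoiseCovariance hF.brownian hF.brownian').wienerIntegral (hF.colored t i) hX

theorem IsFluctuatingForce.isNoiseRepresentation (hF : IsFluctuatingForce P W W' κ φ F₀) (t : ℝ)
    (i : Fin d) : IsNoiseRepresentation P W (fun ω => F₀ t ω i) fun u => κ • φ (t - u) i := by
  refine ⟨(hF.colored t i).1.const_smul κ, fun f X hX => ?_⟩
  have := hF.integral_colored_mul_wienerIntegral t i hX
  simp_rw [mul_comm (F₀ t _ i)] at this
  rw [this, ← integral_const_mul]
  congr 1; ext u
  rw [dotProduct_smul, smul_eq_mul, dotProduct_comm]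

end Force

/-! ### Correlating the equation with a random variable -/

section Solution

variable {D G : Matrix (Fin d) (Fin d) ℝ} {γ r : ℝ → Matrix (Fin d) (Fin d) ℝ}
  {V F₀ : ℝ → Ω → Fin d → ℝ}

theorem IsBoundedSolution.isL2Process (hV : IsBoundedSolution P D G γ F₀ W V) (i : Fin d) :
    IsL2Process P fun t ω => V t ω i := by
  obtain ⟨C, hC⟩ := hV.bounded
  exact IsL2Process.of_eLpNorm_le ((measurable_pi_apply i).comp hV.measurable)
    fun t => (eLpNorm_component_le (V t) i).trans (hC t)

theorem mulVec_apply_eq_sum (A : Matrix (Fin d) (Fin d) ℝ) (v : Fin d → ℝ) (i : Fin d) :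
    (A *ᵥ v) i = ∑ j, A i j * v j := rfl

/-- The memory term in components. -/
theorem memory_term_apply {u : ℝ → Fin d → ℝ} {τ : ℝ}
    (h : ∀ i j, Integrable fun s => causal γ s i j * u (τ - s) j) (i : Fin d) :
    (∫ s in Iic τ, γ (τ - s) *ᵥ u s) i = ∑ j, ∫ s, causal γ s i j * u (τ - s) j := by
  have h' : ∀ i j, Integrable fun s => causal γ (τ - s) i j * u s j := fun i j => by
    simpa using (h i j).comp_sub_left τ
  -- The causal extension vanishes at 0, where γ is arbitrary; the two integrands can differ at the
  -- endpoint s = τ, a null set.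
  have hc : ∀ i j, ∀ᵐ s, s ∈ Iic τ → causal γ (τ - s) i j * u s j = γ (τ - s) i j * u s j :=
    fun i j => by
      filter_upwards [Measure.ae_ne volume τ] with s hs hs'
      rw [causal_of_pos γ (sub_pos.2 (lt_of_le_of_ne hs' hs))]
  have hi : ∀ i j, Integrable (fun s => γ (τ - s) i j * u s j) (volume.restrict (Iic τ)) :=
    fun i j => (h' i j).integrableOn.congr ((ae_restrict_iff' measurableSet_Iic).2 (hc i j))
  have hs : ∀ k, Integrable (fun s => (γ (τ - s) *ᵥ u s) k) (volume.restrict (Iic τ)) :=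
    fun k => by
      simp_rw [mulVec_apply_eq_sum]
      exact integrable_finsetSum _ fun j _ => hi k j
  rw [eval_integral hs]
  simp_rw [mulVec_apply_eq_sum]
  refine (integral_finsetSum _ fun j _ => hi i j).trans (Finset.sum_congr rfl fun j _ => ?_)
  rw [← setIntegral_congr_ae measurableSet_Iic (hc i j),
    setIntegral_eq_integral_of_forall_compl_eq_zero fun s hs => by
      rw [causal_of_nonpos γ (by linarith [not_le.1 (show ¬ s ≤ τ from hs)])]; simp,
    ← integral_sub_left_eq_self _ volume τ]
  simp

theorem integral_indicator_one_mul {a b : ℝ} (hab : a ≤ b) (f : ℝ → ℝ) :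
    ∫ t, (Ioc a b).indicator (fun _ => (1 : ℝ)) t * f t = ∫ t in a..b, f t := by
  rw [intervalIntegral.integral_of_le hab, ← integral_indicator measurableSet_Ioc]
  congr 1; ext t
  by_cases h : t ∈ Ioc a b <;> simp [h]

theorem integrable_indicator_one (a b : ℝ) :
    Integrable ((Ioc a b).indicator fun _ => (1 : ℝ)) :=
  (integrable_indicator_iff measurableSet_Ioc).2 (integrableOn_const (by simp))

theorem IsL2Process.ae_intervalIntegrable {X : ℝ → Ω → ℝ} (hX : IsL2Process P X) {a b : ℝ} :
    ∀ᵐ ω ∂P, IntegrableOn (fun t => X t ω) (Ioc a b) := by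
  filter_upwards [hX.ae_integrable (integrable_indicator_one a b)] with ω hω
  rw [← integrable_indicator_iff measurableSet_Ioc]
  refine hω.congr (ae_of_all _ fun t => ?_)
  by_cases h : t ∈ Ioc a b <;> simp [h]

/-- For each t, integrability holds almost surely. The set of good pairs (t, ω) is measurable once h
is replaced by a strongly measurable representative, so Fubini exchanges the two quantifiers. -/
theorem IsL2Process.ae_ae_integrable_conv {X : ℝ → Ω → ℝ} (hX : IsL2Process P X) {h : ℝ → ℝ}
    (hh : Integrable h) : ∀ᵐ ω ∂P, ∀ᵐ t, Integrable fun s => h s * X (t - s) ω := by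
  obtain ⟨k, hk, hhk⟩ := hh.aestronglyMeasurable
  have hm : Measurable fun q : (ℝ × Ω) × ℝ => k q.2 * X (q.1.1 - q.2) q.1.2 :=
    (hk.measurable.comp measurable_snd).mul (hX.measurable.comp
      ((measurable_fst.fst.sub measurable_snd).prodMk measurable_fst.snd))
  obtain ⟨S, hS, hSm⟩ : ∃ S : Set (ℝ × Ω),
      (∀ t ω, (t, ω) ∈ S ↔ Integrable fun s => k s * X (t - s) ω) ∧ MeasurableSet S :=
    ⟨{z | Integrable fun s => k s * X (z.1 - s) z.2}, fun _ _ => Iff.rfl,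
      measurableSet_integrable (f := fun (z : ℝ × Ω) s => k s * X (z.1 - s) z.2)
        hm.stronglyMeasurable⟩
  have h1 : ∀ᵐ t, ∀ᵐ ω ∂P, (t, ω) ∈ S := ae_of_all _ fun t => by
    filter_upwards [(hX.comp_const_sub t).ae_integrable (hh.congr hhk)] with ω hω
    exact (hS t ω).2 hω
  have h2 := (Measure.ae_ae_comm (p := fun t ω => (t, ω) ∈ S) hSm).1 h1
  filter_upwards [h2] with ω hω
  filter_upwards [hω] with t ht
  refine ((hS t ω).1 ht).congr ?_
  filter_upwards [hhk] with s hs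
  rw [hs]

/-- The components of the equation, with every term written as a scalar integral. -/
theorem IsBoundedSolution.equation_apply (hV : IsBoundedSolution P D G γ F₀ W V)
    (hγ : IsL1Pos γ) (hF₀ : ∀ i, IsL2Process P fun t ω => F₀ t ω i) {t₁ t₂ : ℝ} (h : t₁ ≤ t₂)
    (i : Fin d) :
    ∀ᵐ ω ∂P, V t₂ ω i - V t₁ ω i =
      -(∑ j, D i j * (∫ τ, (Ioc t₁ t₂).indicator (fun _ => (1 : ℝ)) τ * V τ ω j)
        + ∑ j, ∫ τ, (Ioc t₁ t₂).indicator (fun _ => (1 : ℝ)) τ *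
            ∫ s, causal γ s i j * V (τ - s) ω j)
      + (∫ τ, (Ioc t₁ t₂).indicator (fun _ => (1 : ℝ)) τ * F₀ τ ω i)
      + ∑ j, G i j * (W t₂ ω j - W t₁ ω j) := by
  have hVp := hV.isL2Process
  have h1 : ∀ᵐ ω ∂P, ∀ j, IntegrableOn (fun τ => V τ ω j) (Ioc t₁ t₂) :=
    ae_all_iff.2 fun j => (hVp j).ae_intervalIntegrable
  have h2 : ∀ᵐ ω ∂P, ∀ j, IntegrableOn (fun τ => F₀ τ ω j) (Ioc t₁ t₂) :=
    ae_all_iff.2 fun j => (hF₀ j).ae_intervalIntegrable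
  have h3 : ∀ᵐ ω ∂P, ∀ i j, IntegrableOn (fun τ => ∫ s, causal γ s i j * V (τ - s) ω j)
      (Ioc t₁ t₂) := ae_all_iff.2 fun i => ae_all_iff.2 fun j =>
    ((hVp j).conv (hγ.integrable_causal i j)).ae_intervalIntegrable
  have h4 : ∀ᵐ ω ∂P, ∀ i j, ∀ᵐ τ, Integrable fun s => causal γ s i j * V (τ - s) ω j :=
    ae_all_iff.2 fun i => ae_all_iff.2 fun j =>
      (hVp j).ae_ae_integrable_conv (hγ.integrable_causal i j)
  filter_upwards [hV.equation t₁ t₂ h, h1, h2, h3, h4] with ω e h1 h2 h3 h4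
  have h4' : ∀ᵐ τ, ∀ i j, Integrable fun s => causal γ s i j * V (τ - s) ω j :=
    ae_all_iff.2 fun i => ae_all_iff.2 fun j => h4 i j
  have e1 : ∫ τ in t₁..t₂, (D *ᵥ V τ ω + ∫ s in Iic τ, γ (τ - s) *ᵥ V s ω)
      = ∫ τ in Ioc t₁ t₂, fun i => ∑ j, D i j * V τ ω j
          + ∑ j, ∫ s, causal γ s i j * V (τ - s) ω j := by
    rw [intervalIntegral.integral_of_le h]
    refine integral_congr_ae (ae_restrict_of_ae ?_)
    filter_upwards [h4'] with τ hτ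
    ext i
    rw [Pi.add_apply, memory_term_apply hτ, mulVec_apply_eq_sum]
  have i1 : ∀ i, Integrable (fun τ => ∑ j, D i j * V τ ω j) (volume.restrict (Ioc t₁ t₂)) :=
    fun i => integrable_finsetSum _ fun j _ => (h1 j).const_mul _
  have i2 : ∀ i, Integrable (fun τ => ∑ j, ∫ s, causal γ s i j * V (τ - s) ω j)
      (volume.restrict (Ioc t₁ t₂)) := fun i => integrable_finsetSum _ fun j _ => h3 i j
  have e' := congrFun e i
  rw [e1] at e'
  simp only [Pi.add_apply, Pi.sub_apply, Pi.neg_apply] at e'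
  have i3 : ∀ i, Integrable (fun τ => ∑ j, D i j * V τ ω j
      + ∑ j, ∫ s, causal γ s i j * V (τ - s) ω j) (volume.restrict (Ioc t₁ t₂)) :=
    fun i => (i1 i).add (i2 i)
  rw [eval_integral i3, integral_add (i1 i) (i2 i),
    integral_finsetSum _ fun j _ => (h1 j).const_mul _, integral_finsetSum _ fun j _ => h3 i j,
    intervalIntegral.integral_of_le h, eval_integral h2] at e'
  simp only [integral_const_mul] at e'
  simp_rw [integral_indicator_one_mul h, intervalIntegral.integral_of_le h]
  rw [e', mulVec_apply_eq_sum]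
  rfl

theorem integral_affine_mul {Y U f : Ω → ℝ} {w v z : Fin d → Ω → ℝ} {a b : Fin d → ℝ}
    (hY : MemLp Y 2 P) (hf : MemLp f 2 P) (hw : ∀ j, MemLp (w j) 2 P) (hv : ∀ j, MemLp (v j) 2 P)
    (hz : ∀ j, MemLp (z j) 2 P)
    (h : ∀ᵐ ω ∂P, U ω = f ω + ∑ j, a j * w j ω - ∑ j, b j * v j ω - ∑ j, z j ω) :
    ∫ ω, U ω * Y ω ∂P = ∫ ω, f ω * Y ω ∂P + ∑ j, a j * ∫ ω, w j ω * Y ω ∂P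
      - ∑ j, b j * ∫ ω, v j ω * Y ω ∂P - ∑ j, ∫ ω, z j ω * Y ω ∂P := by
  have iw := fun j => (integrable_mul_of_memLp (hw j) hY).const_mul (a j)
  have iv := fun j => (integrable_mul_of_memLp (hv j) hY).const_mul (b j)
  have iz := fun j => integrable_mul_of_memLp (hz j) hY
  have if' := integrable_mul_of_memLp hf hY
  have sw : Integrable (fun ω => ∑ j, a j * (w j ω * Y ω)) P :=
    integrable_finsetSum _ fun j _ => iw j
  have sv : Integrable (fun ω => ∑ j, b j * (v j ω * Y ω)) P :=
    integrable_finsetSum _ fun j _ => iv j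
  have sz : Integrable (fun ω => ∑ j, z j ω * Y ω) P := integrable_finsetSum _ fun j _ => iz j
  have s1 : Integrable (fun ω => f ω * Y ω + ∑ j, a j * (w j ω * Y ω)) P := if'.add sw
  have s2 : Integrable (fun ω => f ω * Y ω + ∑ j, a j * (w j ω * Y ω)
      - ∑ j, b j * (v j ω * Y ω)) P := s1.sub sv
  simp_rw [← integral_const_mul]
  rw [← integral_finsetSum _ fun j _ => iw j, ← integral_finsetSum _ fun j _ => iv j,
    ← integral_finsetSum _ fun j _ => iz j, ← integral_add if' sw, ← integral_sub s1 sv,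
    ← integral_sub s2 sz]
  refine integral_congr_ae ?_
  filter_upwards [h] with ω hω
  rw [hω]
  simp_rw [← mul_assoc, ← Finset.sum_mul]
  ring

/-- The correlations of the bounded solution with a random variable `Y`. -/
theorem IsBoundedSolution.integral_mul_eq {κ : ℝ} {φ : ℝ → Matrix (Fin d) (Fin d) ℝ}
    (hV : IsBoundedSolution P D G γ F₀ W V)
    (hγ : IsL1Pos γ) (hr : IsDifferentialResolvent D γ r) (hr1 : IsL1Pos r)
    (hF : IsFluctuatingForce P W W' κ φ F₀) {Y : Ω → ℝ} (hY : MemLp Y 2 P) {y : ℝ → Fin d → ℝ}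
    (hy : IsNoiseRepresentation P W Y y) (t : ℝ) (i : Fin d) :
    ∫ ω, V t ω i * Y ω ∂P
      = ∑ j, ∫ s, causal r s i j * (∫ ω, F₀ (t - s) ω j * Y ω ∂P + (G *ᵥ y (t - s)) j) := by
  have hVp := hV.isL2Process
  have hFp := hF.isL2Process
  obtain ⟨B, hB⟩ := hr.bounded hγ hr1
  have mGy : ∀ j, MemLp (fun τ => (G *ᵥ y τ) j) 2 volume := fun j => by
    simp_rw [mulVec_apply_eq_sum]
    exact memLp_finsetSum _ fun k _ => (memLp_component hy.1 k).const_mul (G j k)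
  have ma : ∀ j, AEStronglyMeasurable (fun τ => ∫ ω, F₀ τ ω j * Y ω ∂P) volume := fun j =>
    (hFp j).aestronglyMeasurable_correlation hY
  have mR : ∀ i j, MemLp (fun s => causal r s i j) 2 volume := fun i j =>
    (memLp_two_iff_integrable_sq (hr1.integrable_causal i j).1).2 <| by
      have := (hr1.integrable_causal i j).mul_bdd (hr1.integrable_causal i j).1
        (ae_of_all _ fun s => hB s i j)
      simpa [sq] using this
  choose Cv hCv using fun i => (hVp i).abs_correlation_bounded hY
  choose Ca hCa using fun i => (hFp i).abs_correlation_bounded hY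
  have hCv' : ∀ t i, |∫ ω, V t ω i * Y ω ∂P| ≤ ∑ k, |Cv k| := fun t i =>
    ((hCv i t).trans (le_abs_self _)).trans
      (Finset.single_le_sum (f := fun k => |Cv k|) (fun _ _ => abs_nonneg _) (Finset.mem_univ i))
  have ia : ∀ j a b, IntervalIntegrable (fun τ => ∫ ω, F₀ τ ω j * Y ω ∂P) volume a b :=
    fun j a b => (intervalIntegrable_const (c := Ca j)).mono_fun' (ma j).restrict
      (ae_of_all _ fun τ => hCa j τ)
  have iGy : ∀ j a b, IntervalIntegrable (fun τ => (G *ᵥ y τ) j) volume a b := fun j a b =>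
    (((mGy j).locallyIntegrable (by norm_num)).integrableOn_isCompact
      isCompact_uIcc).intervalIntegrable
  -- The correlations with Y are bounded, so it remains to check that r can be convolved with their
  -- forcing and that they solve the integrated deterministic equation.
  refine bounded_solution_eq (v := fun t i => ∫ ω, V t ω i * Y ω ∂P)
    (F := fun τ j => ∫ ω, F₀ τ ω j * Y ω ∂P + (G *ᵥ y τ) j) hγ hr hr1
    (fun i => (hVp i).aestronglyMeasurable_correlation hY) hCv' (fun j a b => (ia j a b).add (iGy j a b))
    (fun t i j => ?_) (fun t₁ t₂ h i => ?_) t i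
  · simp_rw [mul_add]
    refine Integrable.add ?_ ?_
    · exact (hr1.integrable_causal i j).mul_bdd ((ma j).comp_const_sub t)
        (ae_of_all _ fun s => hCa j _)
    -- The representative y is only square integrable and need not be bounded; this is where r ∈ L²
    -- is used.
    · exact integrable_mul_of_memLp (mR i j) ((mGy j).comp_measurePreserving
        (Measure.measurePreserving_sub_left volume t))
  · have hI := integrable_indicator_one t₁ t₂
    have mV : ∀ j, MemLp (fun ω => ∫ τ, (Ioc t₁ t₂).indicator (fun _ => (1 : ℝ)) τ * V τ ω j) 2 P :=
      fun j => (hVp j).memLp_integral hI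
    have mF := (hFp i).memLp_integral hI
    have hZ : ∀ j, IsL2Process P fun τ ω => ∫ s, causal γ s i j * V (τ - s) ω j := fun j =>
      (hVp j).conv (hγ.integrable_causal i j)
    have mZ : ∀ j, MemLp (fun ω => ∫ τ, (Ioc t₁ t₂).indicator (fun _ => (1 : ℝ)) τ *
        ∫ s, causal γ s i j * V (τ - s) ω j) 2 P := fun j => (hZ j).memLp_integral hI
    have mW : ∀ j, MemLp (fun ω => W t₂ ω j - W t₁ ω j) 2 P := fun j =>
      hF.brownian.memLp_increment h j
    -- correlate the equation with `Y`
    have e1 : ∫ ω, V t₂ ω i * Y ω ∂P - ∫ ω, V t₁ ω i * Y ω ∂P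
        = ∫ ω, (∫ τ, (Ioc t₁ t₂).indicator (fun _ => (1 : ℝ)) τ * F₀ τ ω i) * Y ω ∂P
          + ∑ j, G i j * ∫ ω, (W t₂ ω j - W t₁ ω j) * Y ω ∂P
          - ∑ j, D i j * ∫ ω, (∫ τ, (Ioc t₁ t₂).indicator (fun _ => (1 : ℝ)) τ * V τ ω j) * Y ω ∂P
          - ∑ j, ∫ ω, (∫ τ, (Ioc t₁ t₂).indicator (fun _ => (1 : ℝ)) τ *
              ∫ s, causal γ s i j * V (τ - s) ω j) * Y ω ∂P := by
      have := integral_affine_mul hY mF mW mV mZ (a := G i) (b := D i)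
        (U := fun ω => V t₂ ω i - V t₁ ω i) (by
          filter_upwards [hV.equation_apply hγ hFp h i] with ω hω
          rw [hω]; ring)
      rw [← this, ← integral_sub (integrable_mul_of_memLp ((hVp i).memLp t₂) hY)
        (integrable_mul_of_memLp ((hVp i).memLp t₁) hY)]
      simp_rw [sub_mul]
    -- An increment is the Wiener integral of an indicator, so the white noise contributes the
    -- locally integrable density y after correlation with Y.
    have e2 : ∀ j, ∫ ω, (W t₂ ω j - W t₁ ω j) * Y ω ∂P = ∫ τ in t₁..t₂, y τ j := fun j => by
      rw [hy.2 _ _ (hF.brownian.isWienerIntegral_increment h j), ← integral_indicator_one_mul h]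
      simp [single_dotProduct]
    have e3 : ∀ j τ, ∫ ω, (∫ s, causal γ s i j * V (τ - s) ω j) * Y ω ∂P
        = ∫ s, causal γ s i j * ∫ ω, V (τ - s) ω j * Y ω ∂P := fun j τ =>
      ((hVp j).comp_const_sub τ).integral_mul_eq hY (hγ.integrable_causal i j)
    have e4 : ∀ j, ∫ ω, (∫ τ, (Ioc t₁ t₂).indicator (fun _ => (1 : ℝ)) τ *
        ∫ s, causal γ s i j * V (τ - s) ω j) * Y ω ∂P
        = ∫ τ in t₁..t₂, ∫ s, causal γ s i j * ∫ ω, V (τ - s) ω j * Y ω ∂P := fun j => by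
      rw [(hZ j).integral_mul_eq hY hI, integral_indicator_one_mul h]
      simp_rw [e3]
    have e5 : ∀ j, ∫ ω, (∫ τ, (Ioc t₁ t₂).indicator (fun _ => (1 : ℝ)) τ * V τ ω j) * Y ω ∂P
        = ∫ τ in t₁..t₂, ∫ ω, V τ ω j * Y ω ∂P := fun j => by
      rw [(hVp j).integral_mul_eq hY hI, integral_indicator_one_mul h]
    have iv : ∀ j, IntervalIntegrable (fun τ => ∫ ω, V τ ω j * Y ω ∂P) volume t₁ t₂ := fun j =>
      (intervalIntegrable_const (c := Cv j)).mono_fun'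
        ((hVp j).aestronglyMeasurable_correlation hY).restrict (ae_of_all _ fun τ => hCv j τ)
    have iz : ∀ j, IntervalIntegrable
        (fun τ => ∫ s, causal γ s i j * ∫ ω, V (τ - s) ω j * Y ω ∂P) volume t₁ t₂ := fun j => by
      obtain ⟨C, hC⟩ := (hZ j).abs_correlation_bounded hY
      have := (hZ j).aestronglyMeasurable_correlation hY
      simp_rw [e3] at this hC
      exact (intervalIntegrable_const (c := C)).mono_fun' this.restrict (ae_of_all _ hC)
    have iy : ∀ j, IntervalIntegrable (fun τ => y τ j) volume t₁ t₂ := fun j =>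
      (((memLp_component hy.1 j).locallyIntegrable (by norm_num)).integrableOn_isCompact
        isCompact_uIcc).intervalIntegrable
    have s1 : IntervalIntegrable (fun τ => ∑ j, D i j * ∫ ω, V τ ω j * Y ω ∂P) volume t₁ t₂ :=
      ⟨integrable_finsetSum _ fun j _ => ((iv j).const_mul (D i j)).1,
        integrable_finsetSum _ fun j _ => ((iv j).const_mul (D i j)).2⟩
    have s2 : IntervalIntegrable
        (fun τ => ∑ j, ∫ s, causal γ s i j * ∫ ω, V (τ - s) ω j * Y ω ∂P) volume t₁ t₂ :=
      ⟨integrable_finsetSum _ fun j _ => (iz j).1, integrable_finsetSum _ fun j _ => (iz j).2⟩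
    rw [e1, (hFp i).integral_mul_eq hY hI, integral_indicator_one_mul h]
    simp_rw [e2, e4, e5]
    rw [intervalIntegral.integral_sub (((ia i t₁ t₂).add (iGy i t₁ t₂)).sub s1) s2,
      intervalIntegral.integral_sub ((ia i t₁ t₂).add (iGy i t₁ t₂)) s1,
      intervalIntegral.integral_add (ia i t₁ t₂) (iGy i t₁ t₂),
      intervalIntegral.integral_finsetSum fun j _ => (iv j).const_mul _,
      intervalIntegral.integral_finsetSum fun j _ => iz j]
    have e6 : ∫ τ in t₁..t₂, (G *ᵥ y τ) i = ∑ j, G i j * ∫ τ in t₁..t₂, y τ j := by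
      simp_rw [mulVec_apply_eq_sum, ← intervalIntegral.integral_const_mul]
      exact intervalIntegral.integral_finsetSum fun j _ => (iy j).const_mul (G i j)
    rw [e6]
    simp_rw [intervalIntegral.integral_const_mul]

end Solution
end GLE

namespace GLE

/-! ### Convolutions of square integrable functions -/

section SquareIntegrableConvolution

variable {f g k : ℝ → ℝ}

theorem memLp_comp_const_sub (hg : MemLp g 2 volume) (t : ℝ) :
    MemLp (fun s => g (t - s)) 2 volume :=
  hg.comp_measurePreserving (Measure.measurePreserving_sub_left volume t)

theorem integrable_conv_of_memLp (hf : MemLp f 2 volume) (hg : MemLp g 2 volume) (t : ℝ) :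
    Integrable fun s => f s * g (t - s) :=
  integrable_mul_of_memLp hf (memLp_comp_const_sub hg t)

theorem abs_conv_le_of_memLp (hf : MemLp f 2 volume) (hg : MemLp g 2 volume) (t : ℝ) :
    |conv f g t| ≤ √(∫ s, f s ^ 2) * √(∫ s, g s ^ 2) := by
  have := abs_integral_mul_le hf (memLp_comp_const_sub hg t)
  rwa [integral_sub_left_eq_self (fun s => g s ^ 2) volume t] at this

theorem conv_comm (f g : ℝ → ℝ) : conv f g = conv g f := by
  ext t
  simp only [conv]
  rw [← integral_sub_left_eq_self _ volume t]
  simp [mul_comm]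

/-- The convolution of two square integrable functions is continuous. -/
theorem continuous_conv_of_memLp (hf : MemLp f 2 volume) (hg : MemLp g 2 volume) :
    Continuous (conv f g) := by
  refine continuous_of_uniform_approx_of_continuous fun u hu => ?_
  obtain ⟨ε, hε, hu⟩ := Metric.mem_uniformity_dist.1 hu
  set B := √(∫ s, g s ^ 2) with hB
  have hB0 : 0 ≤ B := Real.sqrt_nonneg _
  set δ := ε / (B + 1) with hδ
  have hδ0 : 0 < δ := by positivity
  -- Convolution with a continuous compactly supported f' is continuous, and by Cauchy–Schwarz an L²
  -- approximation of f is a uniform approximation of the convolution.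
  obtain ⟨f', hs, hff', hc, hm⟩ := hf.exists_hasCompactSupport_eLpNorm_sub_le (by simp)
    (ENNReal.ofReal_pos.2 hδ0).ne'
  refine ⟨conv f' g, hs.continuous_convolution_left (ContinuousLinearMap.mul ℝ ℝ) hc
    (hg.locallyIntegrable (by norm_num)), fun t => hu ?_⟩
  have h1 := integral_sq_le_of_eLpNorm_le (hf.sub hm) hδ0.le hff'
  have h2 := abs_conv_le_of_memLp (hf.sub hm) hg t
  have h3 : conv (f - f') g t = conv f g t - conv f' g t :=
    conv_sub_left (integrable_conv_of_memLp hf hg t) (integrable_conv_of_memLp hm hg t)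
  rw [Real.dist_eq, ← h3]
  calc |conv (f - f') g t| ≤ √(∫ s, (f - f') s ^ 2) * B := h2
    _ ≤ δ * B := by
        gcongr
        exact Real.sqrt_le_iff.2 ⟨hδ0.le, h1⟩
    _ < ε := by
        rw [hδ, div_mul_eq_mul_div, div_lt_iff₀ (by positivity)]
        nlinarith

theorem continuous_conv_of_bounded {C : ℝ} (hf : Integrable f) (hg : Continuous g)
    (hC : ∀ t, |g t| ≤ C) : Continuous (conv f g) :=
  BddAbove.continuous_convolution_right_of_integrable (ContinuousLinearMap.mul ℝ ℝ)
    ⟨C, by rintro _ ⟨t, rfl⟩; exact hC t⟩ hf hg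

/-- The convolution of the two L² functions is bounded by Cauchy–Schwarz, and f is integrable, so
Fubini applies at every t. -/
theorem conv_assoc_of_memLp (hf : Integrable f) (hf2 : MemLp f 2 volume) (hg : MemLp g 2 volume)
    (hk : MemLp k 2 volume) (t : ℝ) : conv (conv f g) k t = conv f (conv g k) t := by
  refine convolution_assoc (ContinuousLinearMap.mul ℝ ℝ) (ContinuousLinearMap.mul ℝ ℝ)
    (ContinuousLinearMap.mul ℝ ℝ) (ContinuousLinearMap.mul ℝ ℝ) (fun x y z => mul_assoc x y z)
    hf.aestronglyMeasurable hg.1 hk.1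
    (ae_of_all _ fun x => integrable_conv_of_memLp hf2 hg x)
    (ae_of_all _ fun x => integrable_conv_of_memLp hg.norm hk.norm x) ?_
  exact integrable_mul_bounded hf.norm
      (aestronglyMeasurable_conv hg.1.norm hk.1.norm)
      (fun x => abs_conv_le_of_memLp hg.norm hk.norm x) t

end SquareIntegrableConvolution

variable {Ω : Type*} [MeasurableSpace Ω] {P : Measure Ω} [IsProbabilityMeasure P] {d : ℕ}
variable {W W' : ℝ → Ω → Fin d → ℝ}

/-! ### Pairing with test functions -/

section Action

theorem ae_processAction_eq {X : ℝ → Ω → Fin d → ℝ} (hX : ∀ i, IsL2Process P fun t ω => X t ω i)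
    {f : ℝ → Fin d → ℝ} (hf : ∀ i, Integrable fun t => f t i) :
    ∀ᵐ ω ∂P, processAction X f ω = ∑ i, ∫ t, f t i * X t ω i := by
  filter_upwards [ae_all_iff.2 fun i => (hX i).ae_integrable (hf i)] with ω hω
  exact integral_finsetSum _ fun i _ => hω i

theorem memLp_processAction {X : ℝ → Ω → Fin d → ℝ} (hX : ∀ i, IsL2Process P fun t ω => X t ω i)
    {f : ℝ → Fin d → ℝ} (hf : ∀ i, Integrable fun t => f t i) : MemLp (processAction X f) 2 P :=
  (memLp_finsetSum _ fun i _ => (hX i).memLp_integral (hf i)).ae_eq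
    ((ae_processAction_eq hX hf).mono fun _ h => h.symm)

theorem integral_processAction_mul {X : ℝ → Ω → Fin d → ℝ}
    (hX : ∀ i, IsL2Process P fun t ω => X t ω i)
    {f : ℝ → Fin d → ℝ} (hf : ∀ i, Integrable fun t => f t i) {Y : Ω → ℝ} (hY : MemLp Y 2 P) :
    ∫ ω, processAction X f ω * Y ω ∂P = ∑ i, ∫ t, f t i * ∫ ω, X t ω i * Y ω ∂P := by
  have e : ∫ ω, processAction X f ω * Y ω ∂P
      = ∫ ω, ∑ i, (∫ t, f t i * X t ω i) * Y ω ∂P := by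
    refine integral_congr_ae ?_
    filter_upwards [ae_processAction_eq hX hf] with ω hω
    rw [hω, Finset.sum_mul]
  rw [e, integral_finsetSum _ fun i _ =>
    integrable_mul_of_memLp ((hX i).memLp_integral (hf i)) hY]
  exact Finset.sum_congr rfl fun i _ => (hX i).integral_mul_eq hY (hf i)

variable {f : ℝ → Fin d → ℝ}

theorem IsTestFunction.continuous_component (hf : IsTestFunction f) (i : Fin d) :
    Continuous fun t => f t i := (continuous_apply i).comp hf.1.continuous

theorem IsTestFunction.integrable (hf : IsTestFunction f) (i : Fin d) :
    Integrable fun t => f t i :=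
  (hf.continuous_component i).integrable_of_hasCompactSupport
    (hf.2.comp_left (g := fun x : Fin d → ℝ => x i) rfl)

theorem IsTestFunction.memLp (hf : IsTestFunction f) : MemLp f 2 volume :=
  hf.1.continuous.memLp_of_hasCompactSupport hf.2

theorem IsTestFunction.memLp_mulVec (hf : IsTestFunction f) (A : Matrix (Fin d) (Fin d) ℝ) :
    MemLp (fun t => A *ᵥ f t) 2 volume :=
  memLp_pi_iff.2 fun i => by
    simp_rw [mulVec_apply_eq_sum]
    exact memLp_finsetSum _ fun j _ => (memLp_component hf.memLp j).const_mul (A i j)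

theorem IsTestFunction.comp_sub (hf : IsTestFunction f) (h : ℝ) :
    IsTestFunction fun x => f (x - h) :=
  ⟨hf.1.comp (contDiff_id.sub contDiff_const), hf.2.comp_homeomorph (Homeomorph.subRight h)⟩

variable {κ : ℝ} {φ : ℝ → Matrix (Fin d) (Fin d) ℝ} {F₀ : ℝ → Ω → Fin d → ℝ}
  {G : Matrix (Fin d) (Fin d) ℝ}

theorem IsFluctuatingForce.memLp_forceAction (hF : IsFluctuatingForce P W W' κ φ F₀)
    (hf : IsTestFunction f) : MemLp (forceAction P W G F₀ f) 2 P :=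
  (memLp_processAction hF.isL2Process hf.integrable).add
    (hF.brownian.isWienerIntegral_wienerIntegral (hf.memLp_mulVec Gᵀ)).2.1

theorem IsFluctuatingForce.integral_forceAction_mul (hF : IsFluctuatingForce P W W' κ φ F₀)
    (hf : IsTestFunction f) {Y : Ω → ℝ} (hY : MemLp Y 2 P) :
    ∫ ω, forceAction P W G F₀ f ω * Y ω ∂P = (∑ i, ∫ t, f t i * ∫ ω, F₀ t ω i * Y ω ∂P)
      + ∫ ω, wienerIntegral P W (fun t => Gᵀ *ᵥ f t) ω * Y ω ∂P := by
  simp_rw [forceAction, add_mul]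
  rw [integral_add (integrable_mul_of_memLp (memLp_processAction hF.isL2Process hf.integrable) hY)
    (integrable_mul_of_memLp
      (hF.brownian.isWienerIntegral_wienerIntegral (hf.memLp_mulVec Gᵀ)).2.1 hY),
    integral_processAction_mul hF.isL2Process hf.integrable hY]

end Action

/-! ### Stationarity by duality -/

section Shift

variable {κ : ℝ} {φ : ℝ → Matrix (Fin d) (Fin d) ℝ} {F₀ V : ℝ → Ω → Fin d → ℝ}
  {D G : Matrix (Fin d) (Fin d) ℝ} {γ r : ℝ → Matrix (Fin d) (Fin d) ℝ} {h : ℝ} {Y Y' : Ω → ℝ}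

/-- The correlations of `Y'` with the noise are those of `Y`, shifted in time by `h`. -/
structure IsShift (P : Measure Ω) (W F₀ : ℝ → Ω → Fin d → ℝ) (h : ℝ) (Y Y' : Ω → ℝ) : Prop where
  memLp : MemLp Y 2 P
  memLp' : MemLp Y' 2 P
  colored : ∀ u i, ∫ ω, F₀ (u + h) ω i * Y' ω ∂P = ∫ ω, F₀ u ω i * Y ω ∂P
  white : ∀ f X X', IsWienerIntegral P W f X → IsWienerIntegral P W (fun t => f (t - h)) X' →
    ∫ ω, X' ω * Y' ω ∂P = ∫ ω, X ω * Y ω ∂P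

theorem memLp_comp_sub_right {f : ℝ → Fin d → ℝ} (hf : MemLp f 2 volume) (h : ℝ) :
    MemLp (fun t => f (t - h)) 2 volume :=
  hf.comp_measurePreserving (measurePreserving_sub_right volume h)

/-- The representative of Y' is that of Y translated by h, and so is its correlation with F₀. The
whole forcing is translated, and convolution with r commutes with translations. -/
theorem IsShift.integral_solution_mul (hY : IsShift P W F₀ h Y Y')
    (hV : IsBoundedSolution P D G γ F₀ W V) (hγ : IsL1Pos γ) (hr : IsDifferentialResolvent D γ r)
    (hr1 : IsL1Pos r) (hF : IsFluctuatingForce P W W' κ φ F₀) (t : ℝ) (i : Fin d) :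
    ∫ ω, V (t + h) ω i * Y' ω ∂P = ∫ ω, V t ω i * Y ω ∂P := by
  obtain ⟨y, hy⟩ := hF.brownian.exists_isNoiseRepresentation hY.memLp
  have hy' : IsNoiseRepresentation P W Y' fun t => y (t - h) := by
    refine ⟨memLp_comp_sub_right hy.1 h, fun f X hX => ?_⟩
    have hf : MemLp (fun t => f (t - -h)) 2 volume := memLp_comp_sub_right hX.1 (-h)
    have hI := hF.brownian.isWienerIntegral_wienerIntegral hf
    rw [hY.white _ _ X hI (by simpa using hX), hy.2 _ _ hI,
      ← integral_sub_right_eq_self (fun t => f (t - -h) ⬝ᵥ y t) h]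
    simp
  rw [hV.integral_mul_eq hγ hr hr1 hF hY.memLp' hy' (t + h) i,
    hV.integral_mul_eq hγ hr hr1 hF hY.memLp hy t i]
  refine Finset.sum_congr rfl fun j _ => ?_
  congr 1; ext s
  rw [show t + h - s = t - s + h by ring, hY.colored, add_sub_cancel_right]

theorem IsShift.integral_forceAction_mul (hY : IsShift P W F₀ h Y Y')
    (hF : IsFluctuatingForce P W W' κ φ F₀) {f : ℝ → Fin d → ℝ} (hf : IsTestFunction f) :
    ∫ ω, forceAction P W G F₀ (fun x => f (x - h)) ω * Y' ω ∂P
      = ∫ ω, forceAction P W G F₀ f ω * Y ω ∂P := by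
  have hI := hF.brownian.isWienerIntegral_wienerIntegral (hf.memLp_mulVec Gᵀ)
  have hI' := hF.brownian.isWienerIntegral_wienerIntegral ((hf.comp_sub h).memLp_mulVec Gᵀ)
  rw [hF.integral_forceAction_mul (hf.comp_sub h) hY.memLp', hF.integral_forceAction_mul hf hY.memLp,
    hY.white _ _ _ hI hI']
  congr 1
  refine Finset.sum_congr rfl fun i _ => ?_
  rw [← integral_add_right_eq_self _ h]
  simp_rw [add_sub_cancel_right, hY.colored]

/-- The time of F₀ enters only through φ(t - u), so translating the integration variable absorbs the
shift in both kinds of correlation. -/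
theorem IsFluctuatingForce.isShift_colored (hF : IsFluctuatingForce P W W' κ φ F₀) (h s : ℝ)
    (k : Fin d) : IsShift P W F₀ h (fun ω => F₀ s ω k) fun ω => F₀ (s + h) ω k := by
  refine ⟨(hF.colored s k).2.1, (hF.colored (s + h) k).2.1, fun u i => ?_, fun f X X' hX hX' => ?_⟩
  · rw [hF.integral_colored_mul, hF.integral_colored_mul, ← integral_add_right_eq_self _ h]
    simp
  · simp_rw [mul_comm (X _), mul_comm (X' _)]
    rw [hF.integral_colored_mul_wienerIntegral _ _ hX, hF.integral_colored_mul_wienerIntegral _ _ hX',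
      ← integral_add_right_eq_self _ h]
    simp

theorem IsFluctuatingForce.isShift_wienerIntegral (hF : IsFluctuatingForce P W W' κ φ F₀)
    {f : ℝ → Fin d → ℝ} {X X' : Ω → ℝ} (hX : IsWienerIntegral P W f X)
    (hX' : IsWienerIntegral P W (fun t => f (t - h)) X') : IsShift P W F₀ h X X' := by
  refine ⟨hX.2.1, hX'.2.1, fun u i => ?_, fun g Z Z' hZ hZ' => ?_⟩
  · rw [hF.integral_colored_mul_wienerIntegral _ _ hX, hF.integral_colored_mul_wienerIntegral _ _ hX',
      ← integral_add_right_eq_self _ h]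
    simp
  · rw [hF.brownian.isometry hZ hX, hF.brownian.isometry hZ' hX',
      ← integral_add_right_eq_self _ h]
    simp

/-- Each clause is the shift identity for V, with F₀ or a Wiener integral as the partner and the
factors interchanged. Afterwards V itself can serve as the partner, which gives its autocovariance.
-/
theorem IsBoundedSolution.isShift (hV : IsBoundedSolution P D G γ F₀ W V) (hγ : IsL1Pos γ)
    (hr : IsDifferentialResolvent D γ r) (hr1 : IsL1Pos r)
    (hF : IsFluctuatingForce P W W' κ φ F₀) (h t : ℝ) (i : Fin d) :
    IsShift P W F₀ h (fun ω => V t ω i) fun ω => V (t + h) ω i := by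
  refine ⟨(hV.isL2Process i).memLp t, (hV.isL2Process i).memLp (t + h), fun u k => ?_,
    fun f X X' hX hX' => ?_⟩
  · simp_rw [mul_comm (F₀ _ _ _)]
    exact (hF.isShift_colored h u k).integral_solution_mul hV hγ hr hr1 hF t i
  · simp_rw [mul_comm (X _), mul_comm (X' _)]
    exact (hF.isShift_wienerIntegral hX hX').integral_solution_mul hV hγ hr hr1 hF t i

theorem IsFluctuatingForce.isShift_forceAction (hF : IsFluctuatingForce P W W' κ φ F₀) (h : ℝ)
    {f : ℝ → Fin d → ℝ} (hf : IsTestFunction f) :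
    IsShift P W F₀ h (forceAction P W G F₀ f) (forceAction P W G F₀ fun x => f (x - h)) := by
  refine ⟨hF.memLp_forceAction hf, hF.memLp_forceAction (hf.comp_sub h), fun u i => ?_,
    fun f X X' hX hX' => ?_⟩
  · simp_rw [mul_comm (F₀ _ _ _)]
    exact (hF.isShift_colored h u i).integral_forceAction_mul hF hf
  · simp_rw [mul_comm (X _), mul_comm (X' _)]
    exact (hF.isShift_wienerIntegral hX hX').integral_forceAction_mul hF hf

/-- The bounded solution and the force are jointly stationary. -/
theorem IsBoundedSolution.isJointlyStationary (hV : IsBoundedSolution P D G γ F₀ W V)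
    (hγ : IsL1Pos γ) (hr : IsDifferentialResolvent D γ r) (hr1 : IsL1Pos r)
    (hF : IsFluctuatingForce P W W' κ φ F₀) :
    IsJointlyStationary P V (forceAction P W G F₀) := by
  -- Means are correlations with the constant 1. Its representative is zero because Wiener integrals
  -- are centred.
  have hrep : IsNoiseRepresentation P W (fun _ => (1 : ℝ)) fun _ => 0 := by
    refine ⟨MemLp.zero, fun f X hX => ?_⟩
    simp [hF.brownian.integral_wienerIntegral hX]
  have hmean : ∀ t i, ∫ ω, F₀ t ω i * (1 : ℝ) ∂P = 0 := fun t i => by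
    simpa using hF.brownian'.integral_wienerIntegral (hF.colored t i)
  refine ⟨fun t => MemLp.of_eval fun i => (hV.isL2Process i).memLp t,
    fun f hf => hF.memLp_forceAction hf, fun t i => ?_, fun f hf => ?_, fun h s t i j => ?_,
    fun h t i f hf => ?_, fun h f g hf hg => ?_⟩
  · have := hV.integral_mul_eq hγ hr hr1 hF (memLp_const (1 : ℝ)) hrep t i
    simp_rw [hmean] at this
    simpa using this
  · have := hF.integral_forceAction_mul (G := G) hf (memLp_const (1 : ℝ))
    simp_rw [hmean, mul_one] at this
    rw [this, hF.brownian.integral_wienerIntegral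
      (hF.brownian.isWienerIntegral_wienerIntegral (hf.memLp_mulVec Gᵀ))]
    simp
  · exact (hV.isShift hγ hr hr1 hF h t j).integral_solution_mul hV hγ hr hr1 hF s i
  · exact (hF.isShift_forceAction h hf).integral_solution_mul hV hγ hr hr1 hF t i
  · exact (hF.isShift_forceAction h hg).integral_forceAction_mul hF hf

end Shift
end GLE

namespace GLE

/-! ### Regularity of the cross-correlation kernel -/

section Kernel

variable {d : ℕ} {κ : ℝ} {φ : ℝ → Matrix (Fin d) (Fin d) ℝ} {D G : Matrix (Fin d) (Fin d) ℝ}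
  {γ r : ℝ → Matrix (Fin d) (Fin d) ℝ}

/-- The part of `χ` that stems from the correlation of the coloured force with later noise. -/
noncomputable def chiWhite (κ : ℝ) (G : Matrix (Fin d) (Fin d) ℝ) (φ : ℝ → Matrix (Fin d) (Fin d) ℝ) :
    ℝ → Matrix (Fin d) (Fin d) ℝ :=
  fun t => κ • (φ t * Gᵀ)

/-- The correlation of the force with the coloured force. -/
noncomputable def chiColored (κ : ℝ) (G : Matrix (Fin d) (Fin d) ℝ) (φ : ℝ → Matrix (Fin d) (Fin d) ℝ) :
    ℝ → Matrix (Fin d) (Fin d) ℝ :=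
  fun t => κ • (G * (timeReversal φ t)ᵀ) + matConv φ (fun u => (timeReversal φ u)ᵀ) t

theorem chi_eq (t : ℝ) : chi κ G φ t = chiWhite κ G φ t + chiColored κ G φ t := by
  simp only [chi, chiWhite, chiColored, smul_add, add_assoc]

theorem chiWhite_apply (t : ℝ) (i j : Fin d) :
    chiWhite κ G φ t i j = κ * ∑ l, φ t i l * G j l := by
  simp [chiWhite, Matrix.mul_apply]

theorem IsL2.memLp_chiWhite (hφ : IsL2 φ) (i j : Fin d) :
    MemLp (fun t => chiWhite κ G φ t i j) 2 volume := by
  simp_rw [chiWhite_apply]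
  exact (memLp_finsetSum _ fun l _ => (hφ i l).mul_const (G j l)).const_mul κ

theorem IsL2.memLp_timeReversal (hφ : IsL2 φ) (i j : Fin d) :
    MemLp (fun t => timeReversal φ t i j) 2 volume :=
  (hφ i j).comp_measurePreserving (Measure.measurePreserving_neg volume)

theorem IsL2.memLp_mul_timeReversal (hφ : IsL2 φ) (i j : Fin d) :
    MemLp (fun t => (κ • (G * (timeReversal φ t)ᵀ)) i j) 2 volume := by
  simp only [Matrix.smul_apply, Matrix.mul_apply, Matrix.transpose_apply, smul_eq_mul]
  exact (memLp_finsetSum _ fun l _ => (hφ.memLp_timeReversal j l).const_mul (G i l)).const_mul κ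

theorem IsL2.matConv_apply (hφ : IsL2 φ) (t : ℝ) (i j : Fin d) :
    matConv φ (fun u => (timeReversal φ u)ᵀ) t i j
      = ∑ l, conv (fun s => φ s i l) (fun s => timeReversal φ s j l) t := by
  simp only [matConv, matIntegral, Matrix.of_apply, Matrix.mul_apply, Matrix.transpose_apply,
    Measure.restrict_univ]
  exact integral_finsetSum _ fun l _ =>
    integrable_conv_of_memLp (hφ i l) (hφ.memLp_timeReversal j l) t

theorem IsL2.continuous_matConv (hφ : IsL2 φ) (i j : Fin d) :
    Continuous fun t => matConv φ (fun u => (timeReversal φ u)ᵀ) t i j := by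
  simp_rw [hφ.matConv_apply]
  exact continuous_finsetSum _ fun l _ =>
    continuous_conv_of_memLp (hφ i l) (hφ.memLp_timeReversal j l)

theorem IsL2.matConv_bounded (hφ : IsL2 φ) (i j : Fin d) :
    ∃ C, ∀ t, |matConv φ (fun u => (timeReversal φ u)ᵀ) t i j| ≤ C := by
  simp_rw [hφ.matConv_apply]
  exact ⟨_, fun t => (Finset.abs_sum_le_sum_abs _ _).trans (Finset.sum_le_sum fun l _ =>
    abs_conv_le_of_memLp (hφ i l) (hφ.memLp_timeReversal j l) t)⟩

/-- A bounded integrable function is square integrable. -/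
theorem IsDifferentialResolvent.memLp_causal (hr : IsDifferentialResolvent D γ r)
    (hγ : IsL1Pos γ) (hr1 : IsL1Pos r) (i j : Fin d) :
    MemLp (fun s => causal r s i j) 2 volume := by
  obtain ⟨B, hB⟩ := hr.bounded hγ hr1
  refine (memLp_two_iff_integrable_sq (hr1.integrable_causal i j).1).2 ?_
  have := (hr1.integrable_causal i j).mul_bdd (hr1.integrable_causal i j).1
    (ae_of_all _ fun s => hB s i j)
  simpa [sq] using this

theorem integrable_causal_mul_chiWhite (hr : IsDifferentialResolvent D γ r)
    (hγ : IsL1Pos γ) (hr1 : IsL1Pos r) (hφ : IsL2 φ) (t : ℝ) (i k j : Fin d) :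
    Integrable fun s => causal r s i k * chiWhite κ G φ (t - s) k j :=
  integrable_conv_of_memLp (hr.memLp_causal hγ hr1 i k) (hφ.memLp_chiWhite k j) t

theorem integrable_causal_mul_matConv (hr1 : IsL1Pos r) (hφ : IsL2 φ) (t : ℝ) (i k j : Fin d) :
    Integrable fun s => causal r s i k * matConv φ (fun u => (timeReversal φ u)ᵀ) (t - s) k j := by
  obtain ⟨C, hC⟩ := hφ.matConv_bounded k j
  exact integrable_mul_bounded (hr1.integrable_causal i k)
    (hφ.continuous_matConv k j).aestronglyMeasurable hC t

theorem integrable_causal_mul_timeReversal (hr : IsDifferentialResolvent D γ r)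
    (hγ : IsL1Pos γ) (hr1 : IsL1Pos r) (hφ : IsL2 φ) (t : ℝ) (i k j : Fin d) :
    Integrable fun s => causal r s i k * (κ • (G * (timeReversal φ (t - s))ᵀ)) k j :=
  integrable_conv_of_memLp (hr.memLp_causal hγ hr1 i k) (hφ.memLp_mul_timeReversal k j) t

theorem conv_causal_chiColored (hr : IsDifferentialResolvent D γ r)
    (hγ : IsL1Pos γ) (hr1 : IsL1Pos r) (hφ : IsL2 φ) (i k j : Fin d) :
    conv (fun s => causal r s i k) (fun s => chiColored κ G φ s k j)
      = fun t => conv (fun s => causal r s i k) (fun s => (κ • (G * (timeReversal φ s)ᵀ)) k j) t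
        + conv (fun s => causal r s i k)
          (fun s => matConv φ (fun u => (timeReversal φ u)ᵀ) s k j) t :=
  funext fun t => conv_add_right (integrable_causal_mul_timeReversal hr hγ hr1 hφ t i k j)
    (integrable_causal_mul_matConv hr1 hφ t i k j)

theorem integrable_causal_mul_chiColored (hr : IsDifferentialResolvent D γ r)
    (hγ : IsL1Pos γ) (hr1 : IsL1Pos r) (hφ : IsL2 φ) (t : ℝ) (i k j : Fin d) :
    Integrable fun s => causal r s i k * chiColored κ G φ (t - s) k j := by
  simp only [chiColored, Matrix.add_apply, mul_add]
  exact (integrable_causal_mul_timeReversal hr hγ hr1 hφ t i k j).add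
    (integrable_causal_mul_matConv hr1 hφ t i k j)

theorem continuous_conv_causal_chiWhite (hr : IsDifferentialResolvent D γ r)
    (hγ : IsL1Pos γ) (hr1 : IsL1Pos r) (hφ : IsL2 φ) (i k j : Fin d) :
    Continuous (conv (fun s => causal r s i k) fun s => chiWhite κ G φ s k j) :=
  continuous_conv_of_memLp (hr.memLp_causal hγ hr1 i k) (hφ.memLp_chiWhite k j)

theorem conv_causal_chiWhite_bounded (hr : IsDifferentialResolvent D γ r)
    (hγ : IsL1Pos γ) (hr1 : IsL1Pos r) (hφ : IsL2 φ) (i k j : Fin d) :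
    ∃ C, ∀ t, |conv (fun s => causal r s i k) (fun s => chiWhite κ G φ s k j) t| ≤ C :=
  ⟨_, abs_conv_le_of_memLp (hr.memLp_causal hγ hr1 i k) (hφ.memLp_chiWhite k j)⟩

theorem continuous_conv_causal_chiColored (hr : IsDifferentialResolvent D γ r)
    (hγ : IsL1Pos γ) (hr1 : IsL1Pos r) (hφ : IsL2 φ) (i k j : Fin d) :
    Continuous (conv (fun s => causal r s i k) fun s => chiColored κ G φ s k j) := by
  rw [conv_causal_chiColored hr hγ hr1 hφ]
  obtain ⟨C, hC⟩ := hφ.matConv_bounded k j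
  exact (continuous_conv_of_memLp (hr.memLp_causal hγ hr1 i k)
    (hφ.memLp_mul_timeReversal k j)).add
    (continuous_conv_of_bounded (hr1.integrable_causal i k) (hφ.continuous_matConv k j) hC)

theorem conv_causal_chiColored_bounded (hr : IsDifferentialResolvent D γ r)
    (hγ : IsL1Pos γ) (hr1 : IsL1Pos r) (hφ : IsL2 φ) (i k j : Fin d) :
    ∃ C, ∀ t, |conv (fun s => causal r s i k) (fun s => chiColored κ G φ s k j) t| ≤ C := by
  rw [conv_causal_chiColored hr hγ hr1 hφ]
  obtain ⟨C, hC⟩ := hφ.matConv_bounded k j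
  exact ⟨_, fun t => (abs_add_le _ _).trans (add_le_add
    (abs_conv_le_of_memLp (hr.memLp_causal hγ hr1 i k) (hφ.memLp_mul_timeReversal k j) t)
    (norm_conv_le (hr1.integrable_causal i k) hC t))⟩

/-- Two pairings are at work: the terms of χ linear in φ are in L² and are paired with r ∈ L², while
the autocovariance of F₀ is bounded and is paired with r ∈ L¹. -/
theorem integrable_causal_mul_chi (hr : IsDifferentialResolvent D γ r)
    (hγ : IsL1Pos γ) (hr1 : IsL1Pos r) (hφ : IsL2 φ) (t : ℝ) (i j : Fin d) :
    Integrable fun s => (causal r s * chi κ G φ (t - s)) i j := by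
  simp only [chi_eq, Matrix.mul_apply, Matrix.add_apply, mul_add]
  exact integrable_finsetSum _ fun k _ => (integrable_causal_mul_chiWhite hr hγ hr1 hφ t i k j).add
    (integrable_causal_mul_chiColored hr hγ hr1 hφ t i k j)

theorem causal_mul_apply (M N : ℝ → Matrix (Fin d) (Fin d) ℝ) (i j : Fin d) :
    (fun s => (causal M s * N s) i j) = (Ioi 0).indicator fun s => (M s * N s) i j := by
  ext s
  by_cases hs : s ∈ Ioi (0 : ℝ) <;> simp [causal, hs]

theorem integrableOn_mul_chi (hr : IsDifferentialResolvent D γ r)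
    (hγ : IsL1Pos γ) (hr1 : IsL1Pos r) (hφ : IsL2 φ) (t : ℝ) (i j : Fin d) :
    IntegrableOn (fun s => (r s * chi κ G φ (t - s)) i j) (Ioi 0) := by
  rw [← integrable_indicator_iff measurableSet_Ioi,
    ← causal_mul_apply r (fun s => chi κ G φ (t - s))]
  exact integrable_causal_mul_chi hr hγ hr1 hφ t i j

/-- The summands are separated by origin: F₀ against white noise, the whole force against F₀, and
white noise against white noise. The case distinction in the sign of t is absorbed by the causal
extension of r. -/
theorem crossKernel_apply (hr : IsDifferentialResolvent D γ r)
    (hγ : IsL1Pos γ) (hr1 : IsL1Pos r) (hφ : IsL2 φ) (t : ℝ) (i j : Fin d) :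
    crossKernel κ G φ r t i j
      = ∑ k, conv (fun s => causal r s i k) (fun s => chiWhite κ G φ s k j) t
        + ∑ k, conv (fun s => causal r s i k) (fun s => chiColored κ G φ s k j) t
        + ∑ k, causal r t i k * (G * Gᵀ) k j := by
  have e : (if 0 < t then r t * (G * Gᵀ) else 0) = causal r t * (G * Gᵀ) := by
    split_ifs with ht
    · rw [causal_of_pos r ht]
    · rw [causal_of_nonpos r (not_lt.1 ht), zero_mul]
  rw [crossKernel, e, Matrix.add_apply, Matrix.mul_apply, ← Finset.sum_add_distrib]
  congr 1
  simp only [matIntegral, Matrix.of_apply]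
  rw [← integral_indicator measurableSet_Ioi, ← causal_mul_apply r (fun s => chi κ G φ (t - s))]
  simp only [chi_eq, Matrix.mul_apply, Matrix.add_apply, mul_add]
  refine (integral_finsetSum _ fun k _ => (integrable_causal_mul_chiWhite hr hγ hr1 hφ t i k j).add
    (integrable_causal_mul_chiColored hr hγ hr1 hφ t i k j)).trans ?_
  exact Finset.sum_congr rfl fun k _ => integral_add
    (integrable_causal_mul_chiWhite hr hγ hr1 hφ t i k j)
    (integrable_causal_mul_chiColored hr hγ hr1 hφ t i k j)

theorem IsDifferentialResolvent.continuousAt_causal (hr : IsDifferentialResolvent D γ r)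
    (i j : Fin d) {t : ℝ} (ht : t ≠ 0) : ContinuousAt (fun t => causal r t i j) t := by
  rcases ht.lt_or_gt with ht | ht
  · refine (continuousAt_const (y := (0 : ℝ))).congr ?_
    filter_upwards [Iio_mem_nhds ht] with u hu
    rw [causal_of_nonpos r (le_of_lt hu), Matrix.zero_apply]
  · refine ((hr.continuousOn i j).continuousAt (Ici_mem_nhds ht)).congr ?_
    filter_upwards [Ioi_mem_nhds ht] with u hu
    rw [causal_of_pos r hu]

/-- The kernel is continuous away from the origin. -/
theorem continuousAt_crossKernel (hr : IsDifferentialResolvent D γ r)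
    (hγ : IsL1Pos γ) (hr1 : IsL1Pos r) (hφ : IsL2 φ) (i j : Fin d) {t : ℝ} (ht : t ≠ 0) :
    ContinuousAt (fun t => crossKernel κ G φ r t i j) t := by
  simp_rw [crossKernel_apply hr hγ hr1 hφ]
  -- The convolution terms are continuous everywhere; only the term with r G Gᵀ can jump at the
  -- origin.
  refine ContinuousAt.add (Continuous.continuousAt (Continuous.add ?_ ?_)) ?_
  · exact continuous_finsetSum _ fun k _ => continuous_conv_causal_chiWhite hr hγ hr1 hφ i k j
  · exact continuous_finsetSum _ fun k _ => continuous_conv_causal_chiColored hr hγ hr1 hφ i k j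
  · exact tendsto_finsetSum _ fun k _ => (hr.continuousAt_causal i k ht).mul_const _

theorem measurable_crossKernel (hr : IsDifferentialResolvent D γ r)
    (hγ : IsL1Pos γ) (hr1 : IsL1Pos r) (hφ : IsL2 φ) (i j : Fin d) :
    Measurable fun t => crossKernel κ G φ r t i j :=
  measurable_of_continuousOn_compl_singleton 0 <| continuousOn_of_forall_continuousAt fun _ ht =>
    continuousAt_crossKernel hr hγ hr1 hφ i j ht

theorem crossKernel_bounded (hr : IsDifferentialResolvent D γ r)
    (hγ : IsL1Pos γ) (hr1 : IsL1Pos r) (hφ : IsL2 φ) (i j : Fin d) :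
    ∃ C, ∀ t, |crossKernel κ G φ r t i j| ≤ C := by
  simp_rw [crossKernel_apply hr hγ hr1 hφ]
  choose C₁ h₁ using fun k => conv_causal_chiWhite_bounded (κ := κ) (G := G) hr hγ hr1 hφ i k j
  choose C₂ h₂ using fun k => conv_causal_chiColored_bounded (κ := κ) (G := G) hr hγ hr1 hφ i k j
  obtain ⟨B, hB⟩ := hr.bounded hγ hr1
  refine ⟨∑ k, C₁ k + ∑ k, C₂ k + ∑ k, B * |(G * Gᵀ) k j|, fun t =>
    (abs_add_le _ _).trans (add_le_add ((abs_add_le _ _).trans (add_le_add ?_ ?_)) ?_)⟩ <;>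
    refine (Finset.abs_sum_le_sum_abs _ _).trans (Finset.sum_le_sum fun k _ => ?_)
  · exact h₁ k t
  · exact h₂ k t
  · rw [abs_mul]
    exact mul_le_mul_of_nonneg_right (hB t i k) (abs_nonneg _)

theorem locallyIntegrable_crossKernel (hr : IsDifferentialResolvent D γ r)
    (hγ : IsL1Pos γ) (hr1 : IsL1Pos r) (hφ : IsL2 φ) (i j : Fin d) :
    LocallyIntegrable (fun t => crossKernel κ G φ r t i j) := by
  obtain ⟨C, hC⟩ := crossKernel_bounded (κ := κ) (G := G) hr hγ hr1 hφ i j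
  exact (locallyIntegrable_const C).mono (measurable_crossKernel hr hγ hr1 hφ i j).aestronglyMeasurable
    (ae_of_all _ fun t => (hC t).trans (le_abs_self C))

end Kernel

/-! ### The cross-correlation of the solution and the force -/

variable {Ω : Type*} [MeasurableSpace Ω] {P : Measure Ω} [IsProbabilityMeasure P] {d : ℕ}
variable {W W' F₀ V : ℝ → Ω → Fin d → ℝ} {κ : ℝ} {φ γ r : ℝ → Matrix (Fin d) (Fin d) ℝ}
  {D G : Matrix (Fin d) (Fin d) ℝ}

/-- The general formula with Y = F₀(s)ⱼ. The representative κ φ(s - ·)ⱼ yields the term with G and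
the reflected φ, and the autocovariance of F₀ yields the convolution term; both depend only on t - τ
- s. -/
theorem IsBoundedSolution.integral_mul_colored (hV : IsBoundedSolution P D G γ F₀ W V)
    (hγ : IsL1Pos γ) (hr : IsDifferentialResolvent D γ r) (hr1 : IsL1Pos r)
    (hF : IsFluctuatingForce P W W' κ φ F₀) (t s : ℝ) (i j : Fin d) :
    ∫ ω, V t ω i * F₀ s ω j ∂P
      = ∑ k, conv (fun s => causal r s i k) (fun s => chiColored κ G φ s k j) (t - s) := by
  rw [hV.integral_mul_eq hγ hr hr1 hF (hF.colored s j).2.1 (hF.isNoiseRepresentation s j) t i]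
  refine Finset.sum_congr rfl fun k _ => integral_congr_ae (ae_of_all _ fun τ => ?_)
  dsimp only
  congr 1
  rw [hF.integral_colored_mul, add_comm, chiColored, Matrix.add_apply]
  congr 1
  · simp only [mulVec_apply_eq_sum, Matrix.smul_apply, Matrix.mul_apply, Matrix.transpose_apply,
      timeReversal, Pi.smul_apply, smul_eq_mul, Finset.mul_sum]
    refine Finset.sum_congr rfl fun l _ => ?_
    rw [show s - (t - τ) = -(t - s - τ) by ring]
    ring
  · simp only [matConv, matIntegral, Matrix.of_apply, Matrix.mul_apply, Matrix.transpose_apply,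
      Measure.restrict_univ, timeReversal]
    rw [← integral_sub_left_eq_self _ volume (t - τ)]
    congr 1; ext u
    rw [dotProduct, sub_sub_cancel]
    refine Finset.sum_congr rfl fun l _ => ?_
    rw [show s - (t - τ - u) = -(t - s - τ - u) by ring]

/-- The general formula with Y = ∫ (Gᵀ g) dW, represented by Gᵀ g. The coloured force correlates
with it as `chiWhite` convolved with g, and reassociation moves g outermost, which exhibits the
kernel. -/
theorem IsBoundedSolution.integral_mul_wienerIntegral (hV : IsBoundedSolution P D G γ F₀ W V)
    (hγ : IsL1Pos γ) (hr : IsDifferentialResolvent D γ r) (hr1 : IsL1Pos r)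
    (hF : IsFluctuatingForce P W W' κ φ F₀) {g : ℝ → Fin d → ℝ} (hg : IsTestFunction g)
    (t : ℝ) (i : Fin d) :
    ∫ ω, V t ω i * wienerIntegral P W (fun s => Gᵀ *ᵥ g s) ω ∂P
      = ∑ j, ∑ k, (conv (conv (fun s => causal r s i k) (fun s => chiWhite κ G φ s k j))
          (fun s => g s j) t + conv (fun s => causal r s i k * (G * Gᵀ) k j) (fun s => g s j) t) := by
  have hX := hF.brownian.isWienerIntegral_wienerIntegral (hg.memLp_mulVec Gᵀ)
  have hR := hr.memLp_causal hγ hr1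
  have hw := hF.density.memLp_chiWhite (κ := κ) (G := G)
  have hgj := memLp_component hg.memLp
  rw [hV.integral_mul_eq hγ hr hr1 hF hX.2.1
    (hF.brownian.isNoiseRepresentation_wienerIntegral hX) t i, Finset.sum_comm]
  refine Finset.sum_congr rfl fun k _ => ?_
  have e1 : ∀ u, ∫ ω, F₀ u ω k * wienerIntegral P W (fun s => Gᵀ *ᵥ g s) ω ∂P
      = ∑ j, conv (fun s => chiWhite κ G φ s k j) (fun s => g s j) u := fun u => by
    simp_rw [conv_comm (fun s => chiWhite κ G φ s k _)]
    rw [hF.integral_colored_mul_wienerIntegral u k hX, ← integral_const_mul]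
    simp only [conv]
    rw [← integral_finsetSum _ fun j _ => integrable_conv_of_memLp (hgj j) (hw k j) u]
    congr 1; ext s
    simp only [chiWhite_apply, dotProduct, mulVec_apply_eq_sum, Matrix.transpose_apply,
      Finset.mul_sum]
    rw [Finset.sum_comm]
    exact Finset.sum_congr rfl fun j _ => Finset.sum_congr rfl fun l _ => by ring
  have e2 : ∀ u, (G *ᵥ Gᵀ *ᵥ g u) k = ∑ j, (G * Gᵀ) k j * g u j := fun u => by
    rw [mulVec_mulVec, mulVec_apply_eq_sum]
  simp_rw [e1, e2, ← Finset.sum_add_distrib, Finset.mul_sum, mul_add, ← mul_assoc]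
  have i1 : ∀ j, Integrable fun s =>
      causal r s i k * conv (fun s => chiWhite κ G φ s k j) (fun s => g s j) (t - s) := fun j =>
    integrable_mul_bounded (hr1.integrable_causal i k)
      (continuous_conv_of_memLp (hw k j) (hgj j)).aestronglyMeasurable
      (abs_conv_le_of_memLp (hw k j) (hgj j)) t
  have i2 : ∀ j, Integrable fun s => causal r s i k * (G * Gᵀ) k j * g (t - s) j := fun j =>
    integrable_conv_of_memLp ((hR i k).mul_const _) (hgj j) t
  refine (integral_finsetSum _ fun j _ => (i1 j).add (i2 j)).trans
    (Finset.sum_congr rfl fun j _ => ?_)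
  refine (integral_add (i1 j) (i2 j)).trans ?_
  rw [conv_assoc_of_memLp (hr1.integrable_causal i k) (hR i k) (hw k j) (hgj j)]
  rfl

/-- The cross-correlation of the bounded solution with the force. -/
theorem IsBoundedSolution.integral_mul_forceAction (hV : IsBoundedSolution P D G γ F₀ W V)
    (hγ : IsL1Pos γ) (hr : IsDifferentialResolvent D γ r) (hr1 : IsL1Pos r)
    (hF : IsFluctuatingForce P W W' κ φ F₀) {g : ℝ → Fin d → ℝ} (hg : IsTestFunction g)
    (t : ℝ) (i : Fin d) :
    ∫ ω, V t ω i * forceAction P W G F₀ g ω ∂P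
      = ∑ j, ∫ s, g s j * crossKernel κ G φ r (t - s) i j := by
  have hφ := hF.density
  simp_rw [mul_comm (V t _ i)]
  rw [hF.integral_forceAction_mul hg ((hV.isL2Process i).memLp t)]
  simp_rw [mul_comm _ (V t _ i)]
  rw [hV.integral_mul_wienerIntegral hγ hr hr1 hF hg, ← Finset.sum_add_distrib]
  refine Finset.sum_congr rfl fun j _ => ?_
  have i1 : ∀ k, Integrable fun s => g s j *
      conv (fun s => causal r s i k) (fun s => chiWhite κ G φ s k j) (t - s) := fun k => by
    obtain ⟨C, hC⟩ := conv_causal_chiWhite_bounded (κ := κ) (G := G) hr hγ hr1 hφ i k j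
    exact integrable_mul_bounded (hg.integrable j)
      (continuous_conv_causal_chiWhite hr hγ hr1 hφ i k j).aestronglyMeasurable hC t
  have i2 : ∀ k, Integrable fun s => g s j *
      conv (fun s => causal r s i k) (fun s => chiColored κ G φ s k j) (t - s) := fun k => by
    obtain ⟨C, hC⟩ := conv_causal_chiColored_bounded (κ := κ) (G := G) hr hγ hr1 hφ i k j
    exact integrable_mul_bounded (hg.integrable j)
      (continuous_conv_causal_chiColored hr hγ hr1 hφ i k j).aestronglyMeasurable hC t
  have i3 : ∀ k, Integrable fun s => g s j * (causal r (t - s) i k * (G * Gᵀ) k j) := fun k =>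
    integrable_conv_of_memLp (memLp_component hg.memLp j)
      ((hr.memLp_causal hγ hr1 i k).mul_const ((G * Gᵀ) k j)) t
  simp_rw [hV.integral_mul_colored hγ hr hr1 hF, crossKernel_apply hr hγ hr1 hφ, mul_add,
    Finset.mul_sum]
  rw [integral_finsetSum _ fun k _ => i2 k, integral_add ?_
    (integrable_finsetSum _ fun k _ => i3 k), integral_add (integrable_finsetSum _ fun k _ => i1 k)
    (integrable_finsetSum _ fun k _ => i2 k), integral_finsetSum _ fun k _ => i1 k,
    integral_finsetSum _ fun k _ => i2 k, integral_finsetSum _ fun k _ => i3 k,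
    Finset.sum_add_distrib]
  · simp_rw [conv_comm _ fun s => g s j]
    simp only [conv]
    ring
  · exact (integrable_finsetSum _ fun k _ => i1 k).add (integrable_finsetSum _ fun k _ => i2 k)

/-- Substituting x = s + ε y gives ∫ ρ(y) K(t - ε y) dy, and dominated convergence with majorant C
|ρ| applies. Continuity at t alone suffices, and ρ may change sign. -/
theorem integral_conv_approx_identity {K ρ : ℝ → ℝ} (hK : Measurable K) {C : ℝ}
    (hC : ∀ t, |K t| ≤ C) {t : ℝ} (ht : ContinuousAt K t) (hρ : Integrable ρ)
    (hρ1 : ∫ x, ρ x = 1) (s : ℝ) :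
    Tendsto (fun ε : ℝ => ∫ x, ε⁻¹ * ρ (ε⁻¹ * (x - s)) * K (s + t - x)) (𝓝[>] 0) (𝓝 (K t)) := by
  have e : ∀ ε : ℝ, 0 < ε → ∫ x, ε⁻¹ * ρ (ε⁻¹ * (x - s)) * K (s + t - x)
      = ∫ y, ρ y * K (t - ε * y) := fun ε hε => by
    rw [← integral_add_right_eq_self _ s]
    have := Measure.integral_comp_mul_left (fun y => ρ y * K (t - ε * y)) ε⁻¹
    rw [inv_inv, abs_of_pos hε, smul_eq_mul] at this
    rw [← inv_mul_cancel_left₀ hε.ne' (∫ y, ρ y * K (t - ε * y)), ← this, ← integral_const_mul]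
    congr 1; ext x
    rw [mul_inv_cancel_left₀ hε.ne', add_sub_cancel_right, show s + t - (x + s) = t - x by ring]
    ring
  refine Tendsto.congr' (f₁ := fun ε => ∫ y, ρ y * K (t - ε * y)) ?_ ?_
  · filter_upwards [self_mem_nhdsWithin] with ε hε
    exact (e ε hε).symm
  · have hlim : ∫ y, ρ y * K t = K t := by rw [integral_mul_const, hρ1, one_mul]
    conv => enter [3]; rw [← hlim]
    refine tendsto_integral_filter_of_dominated_convergence (fun y => |ρ y| * C)
      (Eventually.of_forall fun ε => hρ.1.mul
        (hK.comp (measurable_const.sub (measurable_id.const_mul ε))).aestronglyMeasurable)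
      (Eventually.of_forall fun ε => ae_of_all _ fun y => ?_) (hρ.abs.mul_const C)
      (ae_of_all _ fun y => ?_)
    · rw [Real.norm_eq_abs, abs_mul]
      exact mul_le_mul_of_nonneg_left (hC _) (abs_nonneg _)
    · refine Tendsto.const_mul _ ?_
      have h : Tendsto (fun ε : ℝ => t - ε * y) (𝓝[>] 0) (𝓝 t) := by
        have : Tendsto (fun ε : ℝ => t - ε * y) (𝓝 0) (𝓝 (t - 0 * y)) :=
          (Continuous.tendsto (by fun_prop) 0)
        rw [zero_mul, sub_zero] at this
        exact this.mono_left nhdsWithin_le_nhds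
      exact ht.tendsto.comp h

theorem isTestFunction_single {ρ : ℝ → ℝ} (hρ : ContDiff ℝ (⊤ : ℕ∞) ρ) (hc : HasCompactSupport ρ)
    {ε : ℝ} (hε : ε ≠ 0) (s : ℝ) (j : Fin d) :
    IsTestFunction fun x => (Pi.single j (ε⁻¹ * ρ (ε⁻¹ * (x - s))) : Fin d → ℝ) := by
  constructor
  · refine contDiff_pi.2 fun k => ?_
    rcases eq_or_ne k j with rfl | h
    · simp only [Pi.single_eq_same]
      exact contDiff_const.mul (hρ.comp (contDiff_const.mul (contDiff_id.sub contDiff_const)))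
    · simp only [Pi.single_eq_of_ne h]
      exact contDiff_const
  · have h := (hc.comp_homeomorph ((Homeomorph.subRight s).trans
      (Homeomorph.mulLeft₀ ε⁻¹ (inv_ne_zero hε))))
    exact h.comp_left (g := fun v => (Pi.single j (ε⁻¹ * v) : Fin d → ℝ)) (by simp)

theorem IsBoundedSolution.hasCorrelationAt (hV : IsBoundedSolution P D G γ F₀ W V)
    (hγ : IsL1Pos γ) (hr : IsDifferentialResolvent D γ r) (hr1 : IsL1Pos r)
    (hF : IsFluctuatingForce P W W' κ φ F₀) (s : ℝ) {t : ℝ} (ht : t ≠ 0) :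
    HasCorrelationAt P (V (s + t)) (forceAction P W G F₀) s (crossKernel κ G φ r t) := by
  intro ρ hρ hc hρ1 i j
  obtain ⟨C, hC⟩ := crossKernel_bounded (κ := κ) (G := G) hr hγ hr1 hF.density i j
  refine (integral_conv_approx_identity (measurable_crossKernel hr hγ hr1 hF.density i j) hC
    (continuousAt_crossKernel hr hγ hr1 hF.density i j ht)
    (hρ.continuous.integrable_of_hasCompactSupport hc) hρ1 s).congr' ?_
  filter_upwards [self_mem_nhdsWithin] with ε hε
  rw [hV.integral_mul_forceAction hγ hr hr1 hF (isTestFunction_single hρ hc (ne_of_gt hε) s j),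
    Finset.sum_eq_single j (fun k _ h => by simp [h]) (by simp)]
  simp

theorem IsBoundedSolution.hasCorrelationFunction (hV : IsBoundedSolution P D G γ F₀ W V)
    (hγ : IsL1Pos γ) (hr : IsDifferentialResolvent D γ r) (hr1 : IsL1Pos r)
    (hF : IsFluctuatingForce P W W' κ φ F₀) :
    HasCorrelationFunction P V (forceAction P W G F₀) (crossKernel κ G φ r) := by
  refine ⟨locallyIntegrable_crossKernel hr hγ hr1 hF.density, fun f g hf hg => ⟨?_, ?_⟩⟩
  · exact integrable_mul_of_memLp (memLp_processAction hV.isL2Process hf.integrable)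
      (hF.memLp_forceAction hg)
  choose C hC using fun i j => crossKernel_bounded (κ := κ) (G := G) hr hγ hr1 hF.density i j
  have mK := measurable_crossKernel (κ := κ) (G := G) hr hγ hr1 hF.density
  have iK : ∀ t i j, Integrable fun s => g s j * crossKernel κ G φ r (t - s) i j := fun t i j =>
    integrable_mul_bounded (hg.integrable j) (mK i j).aestronglyMeasurable (hC i j) t
  have e : ∀ t, ∫ s, f t ⬝ᵥ (crossKernel κ G φ r (t - s) *ᵥ g s)
      = ∑ i, f t i * ∫ ω, V t ω i * forceAction P W G F₀ g ω ∂P := fun t => by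
    simp_rw [hV.integral_mul_forceAction hγ hr hr1 hF hg, dotProduct, mulVec_apply_eq_sum,
      mul_comm (crossKernel κ G φ r _ _ _)]
    rw [integral_finsetSum _ fun i _ => (integrable_finsetSum _ fun j _ => iK t i j).const_mul _]
    refine Finset.sum_congr rfl fun i _ => ?_
    rw [integral_const_mul, integral_finsetSum _ fun j _ => iK t i j]
  rw [integral_processAction_mul hV.isL2Process hf.integrable (hF.memLp_forceAction hg)]
  simp_rw [e]
  refine (integral_finsetSum _ fun i _ => ?_).symm
  obtain ⟨B, hB⟩ := (hV.isL2Process i).abs_correlation_bounded (hF.memLp_forceAction (G := G) hg)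
  exact (hf.integrable i).mul_bdd ((hV.isL2Process i).aestronglyMeasurable_correlation
    (hF.memLp_forceAction hg)) (ae_of_all _ hB)

end GLE

theorem proposition2 {Ω : Type*} [MeasurableSpace Ω] (P : Measure Ω) [IsProbabilityMeasure P]
    {d : ℕ} (D G : Matrix (Fin d) (Fin d) ℝ)
    (γ r φ : ℝ → Matrix (Fin d) (Fin d) ℝ) (κ : ℝ)
    (W W' F₀ V : ℝ → Ω → Fin d → ℝ)
    (hγ : GLE.IsL1Pos γ)
    (hr : GLE.IsDifferentialResolvent D γ r) (hr1 : GLE.IsL1Pos r)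
    (hF : GLE.IsFluctuatingForce P W W' κ φ F₀)
    (hV : GLE.IsBoundedSolution P D G γ F₀ W V) :
    (∀ t i j, IntegrableOn (fun τ => (r τ * GLE.chi κ G φ (t - τ)) i j) (Ioi 0) volume) ∧
    (∀ s t : ℝ, t ≠ 0 →
      GLE.HasCorrelationAt P (V (s + t)) (GLE.forceAction P W G F₀) s
        (GLE.matIntegral (Ioi 0) (fun τ => r τ * GLE.chi κ G φ (t - τ))
          + if 0 < t then r t * (G * Gᵀ) else 0)) ∧
    GLE.HasCorrelationFunction P V (GLE.forceAction P W G F₀) (GLE.crossKernel κ G φ r) ∧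
    GLE.IsJointlyStationary P V (GLE.forceAction P W G F₀) :=
  ⟨GLE.integrableOn_mul_chi hr hγ hr1 hF.density,
    -- The matrix in the statement is `crossKernel` at lag t, by definition.
    fun s _ ht => hV.hasCorrelationAt hγ hr hr1 hF s ht,
    hV.hasCorrelationFunction hγ hr hr1 hF, hV.isJointlyStationary hγ hr hr1 hF⟩
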